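/- **Setting.** Let $1\le m\le q$ and $0\le n\le p$ be integers, let $a_i,b_j\in\mathbb{C}$ and $\alpha_i,\beta_j>0$ ($1\le i\le p$, $1\le j\le q$), and let $H^{m,n}_{p,q}[z]=H^{m,n}_{p,q}\left[z\,\middle|\,{(a_i,\alpha_i)_{1,p}\atop (b_j,\beta_j)_{1,q}}\right]$ be the Fox $H$-function $$H^{m,n}_{p,q}[z]=\frac1{2\pi i}\int_L\frac{\prod_{j=1}^m\Gamma(b_j-\beta_j s)\prod_{i=1}^n\Gamma(1-a_i+\alpha_i s)}{\prod_{j=m+1}^q\Gamma(1-b_j+\beta_j s)\prod_{i=n+1}^p\Gamma(a_i-\alpha_i s)}\,z^s\,ds ,\qquad z\neq0,$$ with $z^s=e^{s(\log|z|+i\arg z)}$, $\arg z\in(-\pi,\pi]$. Here it is assumed that no pole of $\Gamma(b_j-\beta_js)$, $j\le m$, is a pole of $\Gamma(1-a_i+\alpha_is)$, $i\le n$, and $L$ is a contour that has the former poles on its right and the latter on its left: a contour from $c-i\infty$ to $c+i\infty$ if $\Omega>0$ and $|\arg z|<\frac{\pi}{2}\Omega$, and a loop beginning and ending at $+\infty$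 if $\Delta>0$, or if $\Delta=0$ and $|z|<\delta$ (both give the same value where both are allowed), where $$\Omega=\sum_{i\le n}\alpha_i-\sum_{i>n}\alpha_i+\sum_{j\le m}\beta_j-\sum_{j>m}\beta_j,\qquad \Delta=\sum_{j=1}^q\beta_j-\sum_{i=1}^p\alpha_i,\qquad \delta=\prod_{i=1}^p\alpha_i^{-\alpha_i}\prod_{j=1}^q\beta_j^{\beta_j}.$$ For $a\in\mathbb{R}$, $\alpha>0$, $\beta\in\mathbb{C}$, $w\in\mathbb{C}\setminus\{0\}$ put $$\big(\mathcal H^{w;m,n;\alpha}_{a+;p,q;\beta}\varphi\big)(x)=\int_a^x(x-t)^{\beta-1}H^{m,n}_{p,q}[w(x-t)^\alpha]\,\varphi(t)\,dt ,$$ and for $\Re(\mu)>0$, $N=[\Re(\mu)]+1$, let $$(D^\mu_{a+}f)(x)=\Big(\frac{d}{dx}\Big)^{N}(I^{N-\mu}_{a+}f)(x),\qquad (I^{\nu}_{a+}f)(x)=\frac1{\Gamma(\nu)}\int_a^x\frac{f(t)}{(x-t)^{1-\nu}}\,dt .$$ **Theorem 3.** Let $a<b$ be real, $\alpha>0$,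 $w\in\mathbb{C}\setminus\{0\}$, $\Re(\mu)>0$, $\Re(\beta)>0$, $$\Re(\beta)+\min_{1\le j\le m}\Re\Big(\frac{\alpha b_j}{\beta_j}\Big)>0\quad\text{and}\quad \Re(\beta-\mu)+\min_{1\le j\le m}\Re\Big(\frac{\alpha b_j}{\beta_j}\Big)>0 ,$$ and let one of the following hold: $\Omega>0$ and $|\arg w|<\frac{\pi}{2}\Omega$; or $\Delta>0$; or $\Delta=0$ and $|w|(b-a)^\alpha<\delta$. Let $\varphi:(a,b)\to\mathbb{C}$ be integrable. Then $$D^{\mu}_{a+}\big(\mathcal{H}^{w;m,n;\alpha}_{a+;p,q;\beta}\varphi\big)(x)=\big(\mathcal{H}^{w;m,n+2;\alpha}_{a+;p+2,q+2;\beta-\mu}\varphi\big)(x)$$ for almost every $x\in(a,b)$ and for every $x\in(a,b)$ at which $\varphi$ is continuous. The $H$-function in the operator on the right is $$H^{m,n+2}_{p+2,q+2}\left[z\,\middle|\,{(1-\beta,\alpha),\ (1-\beta-N+\mu,\alpha),\ (a_i,\alpha_i)_{1,p}\atop (b_j,\beta_j)_{1,q},\ (1-\beta-N+\mu,\alpha),\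 (1-\beta+\mu,\alpha)}\right].$$ At these $x$ the integrals that define $(\mathcal{H}^{w;m,n;\alpha}_{a+;p,q;\beta}\varphi)(x)$ and the right side converge absolutely, and the limits that define the left side exist: $I^{N-\mu}_{a+}\mathcal{H}^{w;m,n;\alpha}_{a+;p,q;\beta}\varphi$ is given near $x$ by absolutely convergent integrals, is $N-1$ times continuously differentiable near $x$, and its derivative of order $N-1$ is differentiable at $x$. -/

import Mathlib

noncomputable section

/-- The parameters of a Fox function `H^{m,n}_{p,q}`: the upper pairs `(a i, A i)`, `i < p`,
and the lower pairs `(b j, B j)`, `j < q`. The first `n` upper pairs and the first `m` lower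
pairs are the ones that contribute Gamma functions to the numerator of the Mellin transform. -/
structure FoxParams (m n p q : ℕ) where
  a : Fin p → ℂ
  A : Fin p → ℝ
  b : Fin q → ℂ
  B : Fin q → ℝ

namespace FoxParams

variable {m n p q : ℕ} (P : FoxParams m n p q)

/-- The poles of `Γ (b j - B j * s)` for `j < m`. -/
def rightPoles : Set ℂ :=
  {s | ∃ j : Fin q, (j : ℕ) < m ∧ ∃ k : ℕ, s = (P.b j + k) / (P.B j : ℂ)}

/-- The poles of `Γ (1 - a i + A i * s)` for `i < n`. -/
def leftPoles : Set ℂ :=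
  {s | ∃ i : Fin p, (i : ℕ) < n ∧ ∃ k : ℕ, s = (P.a i - 1 - k) / (P.A i : ℂ)}

/-- The standing conditions on the parameters of a Fox function: the `A i`, `B j` are positive,
and no pole of a `Γ (b j - B j * s)`, `j < m`, is a pole of a `Γ (1 - a i + A i * s)`, `i < n`. -/
structure Valid : Prop where
  A_pos : ∀ i, 0 < P.A i
  B_pos : ∀ j, 0 < P.B j
  poles_ne : ∀ i : Fin p, (i : ℕ) < n → ∀ j : Fin q, (j : ℕ) < m → ∀ k l : ℕ,
    (P.A i : ℂ) * (P.b j + k) ≠ (P.B j : ℂ) * (P.a i - l - 1)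

/-- The integrand of the Mellin-Barnes integral, without the power of `z`:
`∏_{j<m} Γ(b_j - B_j s) ∏_{i<n} Γ(1 - a_i + A_i s)` divided by
`∏_{j≥m} Γ(1 - b_j + B_j s) ∏_{i≥n} Γ(a_i - A_i s)`. -/
def theta (s : ℂ) : ℂ :=
  (∏ j : Fin q, if (j : ℕ) < m then Complex.Gamma (P.b j - P.B j * s)
    else (Complex.Gamma (1 - P.b j + P.B j * s))⁻¹) *
  (∏ i : Fin p, if (i : ℕ) < n then Complex.Gamma (1 - P.a i + P.A i * s)
    else (Complex.Gamma (P.a i - P.A i * s))⁻¹)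

/-- `Ω = ∑_{i<n} A_i - ∑_{i≥n} A_i + ∑_{j<m} B_j - ∑_{j≥m} B_j`. -/
def Omega : ℝ :=
  (∑ i : Fin p, if (i : ℕ) < n then P.A i else -P.A i) +
  (∑ j : Fin q, if (j : ℕ) < m then P.B j else -P.B j)

/-- `Δ = ∑ B_j - ∑ A_i`. -/
def Delta : ℝ := (∑ j, P.B j) - ∑ i, P.A i

/-- `δ = ∏ A_i ^ (-A_i) ∏ B_j ^ B_j`. -/
def delta : ℝ := (∏ i, (P.A i) ^ (-P.A i)) * ∏ j, (P.B j) ^ (P.B j)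

end FoxParams

/-- The main part of a Mellin-Barnes contour: either the vertical line `re s = c`, run through
upwards, or the loop that comes in from `+∞ + h₁ i` to `c + h₁ i`, goes up to `c + h₂ i`, and
returns to `+∞ + h₂ i`. -/
inductive MBBase where
  | line (c : ℝ) : MBBase
  | loop (c h₁ h₂ : ℝ) : MBBase

namespace MBBase

/-- The open region to the right of the curve. -/
def right : MBBase → Set ℂ
  | line c => {s | c < s.re}
  | loop c h₁ h₂ => {s | c < s.re ∧ h₁ < s.im ∧ s.im < h₂}

/-- The region to the right of the curve, together with the curve. -/
def closedRight : MBBase → Set ℂ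
  | line c => {s | c ≤ s.re}
  | loop c h₁ h₂ => {s | c ≤ s.re ∧ h₁ ≤ s.im ∧ s.im ≤ h₂}

/-- The integral along the curve. -/
def integral (f : ℂ → ℂ) : MBBase → ℂ
  | line c => ∫ y : ℝ, f (c + y * Complex.I) * Complex.I
  | loop c h₁ h₂ =>
      (-∫ x in Set.Ioi c, f (x + h₁ * Complex.I)) +
      (∫ y in h₁..h₂, f (c + y * Complex.I) * Complex.I) +
      ∫ x in Set.Ioi c, f (x + h₂ * Complex.I)

/-- The curve is a vertical line. -/
def IsLine : MBBase → Prop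
  | line _ => True
  | loop _ _ _ => False

/-- The curve is a loop. -/
def IsLoop : MBBase → Prop
  | line _ => False
  | loop _ h₁ h₂ => h₁ < h₂

end MBBase

/-- A Mellin-Barnes contour: a line or loop, indented so that it passes to the right of the
finitely many points of `indent`. The indentation at a point `s` is recorded, up to homology,
as a circle of radius `r` about `s`, run through counterclockwise. -/
structure MBContour where
  base : MBBase
  indent : Finset ℂ
  r : ℝ

instance : Inhabited MBContour := ⟨⟨MBBase.line 0, ∅, 1⟩⟩

/-- The integral along the contour. -/
def MBContour.integral (L : MBContour) (f : ℂ → ℂ) : ℂ :=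
  L.base.integral f + ∑ s ∈ L.indent, ∮ u in C(s, L.r), f u

namespace FoxParams

variable {m n p q : ℕ} (P : FoxParams m n p q)

/-- The contour `L` separates the two families of poles: all poles of the `Γ (b j - B j * s)`,
`j < m`, lie to the right of `L` and all poles of the `Γ (1 - a i + A i * s)`, `i < n`, to the
left. The line or loop itself has all right poles on its right and meets no left pole; the left
poles that happen to be on its right are exactly the points of `L.indent`, and the closed disc
about such a point lies to the right of the line or loop and contains no other pole. -/
structure Separates (L : MBContour) : Prop where
  r_pos : 0 < L.r
  right_mem : ∀ s ∈ P.rightPoles, s ∈ L.base.right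
  left_off : ∀ s ∈ P.leftPoles, s ∈ L.base.right ∨ s ∉ L.base.closedRight
  mem_indent : ∀ s, s ∈ L.indent ↔ s ∈ P.leftPoles ∧ s ∈ L.base.right
  disc_subset : ∀ s ∈ L.indent, Metric.closedBall s L.r ⊆ L.base.right
  disc_left : ∀ s ∈ L.indent, ∀ u ∈ P.leftPoles, u ∈ Metric.closedBall s L.r → u = s
  disc_right : ∀ s ∈ L.indent, ∀ u ∈ P.rightPoles, u ∉ Metric.closedBall s L.r

/-- Some contour from `c - i∞` to `c + i∞` that separates the poles. -/
def lineContour : MBContour :=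
  Classical.epsilon fun L => L.base.IsLine ∧ P.Separates L

/-- Some loop, beginning and ending at `+∞`, that separates the poles. -/
def loopContour : MBContour :=
  Classical.epsilon fun L => L.base.IsLoop ∧ P.Separates L

/-- The Mellin-Barnes integral `(2πi)⁻¹ ∫_L θ(s) z^s ds`. -/
def mellinBarnes (L : MBContour) (z : ℂ) : ℂ :=
  (2 * Real.pi * Complex.I)⁻¹ * L.integral fun s => P.theta s * z ^ s

/-- The range in which the Mellin-Barnes integral converges absolutely along a vertical contour. -/
def LineCase (z : ℂ) : Prop := 0 < P.Omega ∧ |z.arg| < Real.pi * P.Omega / 2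

/-- The range in which the Mellin-Barnes integral converges absolutely along a loop to `+∞`. -/
def LoopCase (z : ℂ) : Prop := 0 < P.Delta ∨ P.Delta = 0 ∧ ‖z‖ < P.delta

open Classical in
/-- The Fox function `H^{m,n}_{p,q}[z]`, for `z ≠ 0`, as a Mellin-Barnes integral (a vertical
contour where this converges, otherwise a loop to `+∞`; both give the same value where both
converge). Outside these ranges it is given the value `0`. -/
def foxH (z : ℂ) : ℂ :=
  if P.LineCase z then P.mellinBarnes P.lineContour z
  else if P.LoopCase z then P.mellinBarnes P.loopContour z
  else 0

/-- The parameters of the `H^{m,n+2}_{p+2,q+2}` that arises from `P` when the Riemann-Liouville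
derivative of order `μ` is applied, with `N = ⌊re μ⌋ + 1`: the upper pairs `(1 - β, α)` and
`(1 - β - N + μ, α)` are put in front of the upper pairs, and the lower pairs
`(1 - β - N + μ, α)` and `(1 - β + μ, α)` behind the lower pairs. -/
def raise (α : ℝ) (β μ : ℂ) : FoxParams m (n + 2) (p + 2) (q + 2) where
  a := Matrix.vecCons (1 - β) (Matrix.vecCons (1 - β - ((⌊μ.re⌋₊ + 1 : ℕ) : ℂ) + μ) P.a)
  A := Matrix.vecCons α (Matrix.vecCons α P.A)
  b := Fin.snoc (α := fun _ => ℂ)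
    (Fin.snoc (α := fun _ => ℂ) P.b (1 - β - ((⌊μ.re⌋₊ + 1 : ℕ) : ℂ) + μ)) (1 - β + μ)
  B := Fin.snoc (α := fun _ => ℝ) (Fin.snoc (α := fun _ => ℝ) P.B α) α

/-- The integrand of the integral operator with a Fox function in its kernel:
`(x - t)^(β - 1) H[w (x - t)^α] φ(t)`. -/
def opIntegrand (α : ℝ) (β w : ℂ) (φ : ℝ → ℂ) (x t : ℝ) : ℂ :=
  ((x - t : ℝ) : ℂ) ^ (β - 1) * P.foxH (w * (((x - t) ^ α : ℝ) : ℂ)) * φ t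

/-- The integral operator `𝓗^{w;m,n;α}_{a+;p,q;β}`, applied to `φ` at `x`. -/
def foxOp (a α : ℝ) (β w : ℂ) (φ : ℝ → ℂ) (x : ℝ) : ℂ :=
  ∫ t in a..x, P.opIntegrand α β w φ x t

end FoxParams

/-- The Riemann-Liouville fractional integral `(I^ν_{a+} f)(x)`, `re ν > 0`. -/
def rlIntegral (a : ℝ) (ν : ℂ) (f : ℝ → ℂ) (x : ℝ) : ℂ :=
  1 / Complex.Gamma ν * ∫ t in a..x, f t / ((x - t : ℝ) : ℂ) ^ (1 - ν)

/-- The Riemann-Liouville fractional derivative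
`(D^μ_{a+} f)(x) = (d/dx)^N (I^{N-μ}_{a+} f)(x)`, `re μ > 0`, `N = ⌊re μ⌋ + 1`. -/
def rlDeriv (a : ℝ) (μ : ℂ) (f : ℝ → ℂ) (x : ℝ) : ℂ :=
  iteratedDeriv (⌊μ.re⌋₊ + 1) (rlIntegral a (((⌊μ.re⌋₊ + 1 : ℕ) : ℂ) - μ) f) x

/-- All limits that enter `(D^μ_{a+} f)(x)` exist: the integral `(I^{N-μ}_{a+} f)(y)` converges
absolutely for all `y` near `x`, it is `N - 1` times continuously differentiable near `x`, and
its derivative of order `N - 1` is differentiable at `x`, where `N = ⌊re μ⌋ + 1`. -/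
def HasRLDeriv (a : ℝ) (μ : ℂ) (f : ℝ → ℂ) (x : ℝ) : Prop :=
  (∀ᶠ y in nhds x, IntervalIntegrable
    (fun t => f t / ((y - t : ℝ) : ℂ) ^ (1 - (((⌊μ.re⌋₊ + 1 : ℕ) : ℂ) - μ)))
    MeasureTheory.volume a y) ∧
  ContDiffAt ℝ (⌊μ.re⌋₊ : ℕ) (rlIntegral a (((⌊μ.re⌋₊ + 1 : ℕ) : ℂ) - μ) f) x ∧
  DifferentiableAt ℝ
    (iteratedDeriv ⌊μ.re⌋₊ (rlIntegral a (((⌊μ.re⌋₊ + 1 : ℕ) : ℂ) - μ) f)) x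

end

/-!
Let `H̃` be the Fox function with the raised parameters and put `K(u) = u ^ (β - 1) H[w u ^ α]`,
`K̃(u) = u ^ (β - μ - 1) H̃[w u ^ α]`. The two operators are the Volterra operators `φ ↦ K * φ`
and `φ ↦ K̃ * φ` on `(a, b)`, and the theorem comes down to one identity between the kernels, with
`N = ⌊re μ⌋ + 1`: on `(0, b - a)`, the Riemann-Liouville integral of order `N - μ` of `K` is the
one of order `N` of `K̃` (`FoxParams.exists_rlPair`).

The identity is obtained from the Mellin-Barnes representation. The integrand for `H̃` is the one
for `H` times `Γ(β + α s) / Γ(β - μ + α s)` (`FoxParams.raise_theta`). If `H` and `H̃` are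
computed on the same contour `L`, then `K` and `K̃` are superpositions of the powers
`u ^ (β + α s - 1)` and `u ^ (β - μ + α s - 1)`, `s ∈ L`; a Riemann-Liouville integral of order
`ν` maps `u ^ (l - 1)` to `Γ(l) / Γ(l + ν) u ^ (l + ν - 1)`, so by Fubini both sides are the same
superposition (`RLPair.powIntegral`). This needs `re (β + α s) > 0` and `re (β - μ + α s) > 0` on
`L`. The hypotheses on `β` and `μ` say exactly that some vertical line satisfies this and has all
right poles on its right; it serves as the contour, or as the line through the left edge of a
loop, and the left poles beyond it are taken care of by indentations. On such an `L` the kernels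
are dominated by `u ^ (ρ - 1)` and `u ^ (σ - 1)` with `ρ, σ > 0`.

The definition of `H` chooses some separating contour, so it has to be shown that the choice does
not matter (`FoxParams.foxH_eq_of_lineCase`, `FoxParams.foxH_eq_of_loopCase`). This follows from
the residue theorem for rectangles (`rectIntegral_eq_sum_circleIntegral`), applied to rectangles
that grow to strips and half-strips, and from two decay estimates for the integrand:
`e ^ (-κ |im s|)` on vertical strips if `Ω > 0` and `|arg z| < π Ω / 2`, and `e ^ (-κ re s)` on
horizontal half-strips if `Δ > 0`, or `Δ = 0` and `|z| < δ`. Both are obtained from the reflection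
formula, from `|Γ(1/2 + i y)|² = π / cosh (π y)`, from Stirling's formula for factorials, and from
the comparison `|Γ(x + i y)| Γ(X) ≤ |Γ(X + i y)| Γ(x)` for `0 < x ≤ X`
(`norm_Gamma_mul_Gamma_le`).

Given the identity, associativity of convolution (`volterra_rlKernel_volterra`) shows that the
integral of order `N - μ` of `K * φ` is the `N`-fold repeated integral of the integrable function
`K̃ * φ`. Hence `N - 1` derivatives exist everywhere, and the last one exists almost everywhere by
Lebesgue's differentiation theorem, and wherever `K̃ * φ` is continuous, in particular at the
points of continuity of `φ` (`volterra_of_continuousAt`).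
-/

section

open Complex Filter Topology Set MeasureTheory

/-! ### Integrals along rectangles and residues -/

/-- The integral along the boundary of the rectangle `[x₀, x₁] × [y₀, y₁]`, run through
counterclockwise. -/
noncomputable def rectIntegral (f : ℂ → ℂ) (x₀ x₁ y₀ y₁ : ℝ) : ℂ :=
  (∫ x : ℝ in x₀..x₁, f (x + y₀ * I)) + (∫ y : ℝ in y₀..y₁, f (x₁ + y * I) * I)
    - (∫ x : ℝ in x₀..x₁, f (x + y₁ * I)) - ∫ y : ℝ in y₀..y₁, f (x₀ + y * I) * I

/-- The boundary of the rectangle `[x₀, x₁] × [y₀, y₁]`. -/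
def rectBoundary (x₀ x₁ y₀ y₁ : ℝ) : Set ℂ :=
  {z | z.re ∈ Icc x₀ x₁ ∧ z.im ∈ Icc y₀ y₁ ∧ (z.re = x₀ ∨ z.re = x₁ ∨ z.im = y₀ ∨ z.im = y₁)}

section rect

variable {x₀ x₁ y₀ y₁ : ℝ}

lemma bottom_mem_rectBoundary (hx : x₀ ≤ x₁) (hy : y₀ ≤ y₁) {x : ℝ} (h : x ∈ uIcc x₀ x₁) :
    (x + y₀ * I : ℂ) ∈ rectBoundary x₀ x₁ y₀ y₁ := by
  rw [uIcc_of_le hx] at h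
  simp_all [rectBoundary]

lemma top_mem_rectBoundary (hx : x₀ ≤ x₁) (hy : y₀ ≤ y₁) {x : ℝ} (h : x ∈ uIcc x₀ x₁) :
    (x + y₁ * I : ℂ) ∈ rectBoundary x₀ x₁ y₀ y₁ := by
  rw [uIcc_of_le hx] at h
  simp_all [rectBoundary]

lemma left_mem_rectBoundary (hx : x₀ ≤ x₁) (hy : y₀ ≤ y₁) {y : ℝ} (h : y ∈ uIcc y₀ y₁) :
    (x₀ + y * I : ℂ) ∈ rectBoundary x₀ x₁ y₀ y₁ := by
  rw [uIcc_of_le hy] at h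
  simp_all [rectBoundary]

lemma right_mem_rectBoundary (hx : x₀ ≤ x₁) (hy : y₀ ≤ y₁) {y : ℝ} (h : y ∈ uIcc y₀ y₁) :
    (x₁ + y * I : ℂ) ∈ rectBoundary x₀ x₁ y₀ y₁ := by
  rw [uIcc_of_le hy] at h
  simp_all [rectBoundary]

lemma intervalIntegrable_horizontal {f : ℂ → ℂ} {a b h : ℝ}
    (hf : ∀ x ∈ uIcc a b, ContinuousAt f (x + h * I)) :
    IntervalIntegrable (fun x : ℝ => f (x + h * I)) volume a b := by
  refine ContinuousOn.intervalIntegrable fun x hx => ContinuousAt.continuousWithinAt ?_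
  exact ContinuousAt.comp (f := fun x : ℝ => (x + h * I : ℂ)) (hf x hx) (by fun_prop)

lemma intervalIntegrable_vertical {f : ℂ → ℂ} {a b c : ℝ}
    (hf : ∀ y ∈ uIcc a b, ContinuousAt f (c + y * I)) :
    IntervalIntegrable (fun y : ℝ => f (c + y * I) * I) volume a b := by
  refine ContinuousOn.intervalIntegrable fun y hy => ContinuousAt.continuousWithinAt ?_
  refine ContinuousAt.mul ?_ continuousAt_const
  exact ContinuousAt.comp (f := fun y : ℝ => (c + y * I : ℂ)) (hf y hy) (by fun_prop)

lemma rectIntegral_congr {f g : ℂ → ℂ} (hx : x₀ ≤ x₁) (hy : y₀ ≤ y₁)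
    (h : ∀ z ∈ rectBoundary x₀ x₁ y₀ y₁, f z = g z) :
    rectIntegral f x₀ x₁ y₀ y₁ = rectIntegral g x₀ x₁ y₀ y₁ := by
  unfold rectIntegral
  congr 1
  · congr 1
    · congr 1
      · exact intervalIntegral.integral_congr fun x hx' => h _ (bottom_mem_rectBoundary hx hy hx')
      · exact intervalIntegral.integral_congr fun y hy' => by
          simp only [h _ (right_mem_rectBoundary hx hy hy')]
    · exact intervalIntegral.integral_congr fun x hx' => h _ (top_mem_rectBoundary hx hy hx')
  · exact intervalIntegral.integral_congr fun y hy' => by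
      simp only [h _ (left_mem_rectBoundary hx hy hy')]

lemma rectIntegral_add {f g : ℂ → ℂ} (hx : x₀ ≤ x₁) (hy : y₀ ≤ y₁)
    (hf : ∀ z ∈ rectBoundary x₀ x₁ y₀ y₁, ContinuousAt f z)
    (hg : ∀ z ∈ rectBoundary x₀ x₁ y₀ y₁, ContinuousAt g z) :
    rectIntegral (fun z => f z + g z) x₀ x₁ y₀ y₁ =
      rectIntegral f x₀ x₁ y₀ y₁ + rectIntegral g x₀ x₁ y₀ y₁ := by
  unfold rectIntegral
  simp only [add_mul]
  rw [intervalIntegral.integral_add, intervalIntegral.integral_add, intervalIntegral.integral_add,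
    intervalIntegral.integral_add]
  · ring
  all_goals first
    | exact intervalIntegrable_vertical fun y h => hf _ (left_mem_rectBoundary hx hy h)
    | exact intervalIntegrable_vertical fun y h => hg _ (left_mem_rectBoundary hx hy h)
    | exact intervalIntegrable_vertical fun y h => hf _ (right_mem_rectBoundary hx hy h)
    | exact intervalIntegrable_vertical fun y h => hg _ (right_mem_rectBoundary hx hy h)
    | exact intervalIntegrable_horizontal fun y h => hf _ (bottom_mem_rectBoundary hx hy h)
    | exact intervalIntegrable_horizontal fun y h => hg _ (bottom_mem_rectBoundary hx hy h)
    | exact intervalIntegrable_horizontal fun y h => hf _ (top_mem_rectBoundary hx hy h)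
    | exact intervalIntegrable_horizontal fun y h => hg _ (top_mem_rectBoundary hx hy h)

lemma rectIntegral_const_mul (A : ℂ) (f : ℂ → ℂ) :
    rectIntegral (fun z => A * f z) x₀ x₁ y₀ y₁ = A * rectIntegral f x₀ x₁ y₀ y₁ := by
  simp only [rectIntegral, mul_assoc, intervalIntegral.integral_const_mul]
  ring

lemma integral_horizontal_of_hasDerivAt {F f : ℂ → ℂ} {a b h : ℝ}
    (hF : ∀ x ∈ uIcc a b, HasDerivAt F (f (x + h * I)) (x + h * I))
    (hf : ∀ x ∈ uIcc a b, ContinuousAt f (x + h * I)) :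
    ∫ x : ℝ in a..b, f (x + h * I) = F (b + h * I) - F (a + h * I) := by
  refine intervalIntegral.integral_eq_sub_of_hasDerivAt (f := fun x : ℝ => F (x + h * I))
    (fun x hx => ?_) (intervalIntegrable_horizontal hf)
  have h1 : HasDerivAt (fun x : ℝ => (x + h * I : ℂ)) 1 x :=
    (Complex.ofRealCLM.hasDerivAt (x := x)).add_const _
  simpa [Function.comp_def] using HasDerivAt.comp x (hF x hx) h1

lemma integral_vertical_of_hasDerivAt {F f : ℂ → ℂ} {a b c : ℝ}
    (hF : ∀ y ∈ uIcc a b, HasDerivAt F (f (c + y * I)) (c + y * I))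
    (hf : ∀ y ∈ uIcc a b, ContinuousAt f (c + y * I)) :
    ∫ y : ℝ in a..b, f (c + y * I) * I = F (c + b * I) - F (c + a * I) := by
  refine intervalIntegral.integral_eq_sub_of_hasDerivAt (f := fun y : ℝ => F (c + y * I))
    (fun y hy => ?_) (intervalIntegrable_vertical hf)
  have h1 : HasDerivAt (fun y : ℝ => (c + y * I : ℂ)) I y := by
    simpa using ((Complex.ofRealCLM.hasDerivAt (x := y)).mul_const I).const_add (c : ℂ)
  exact HasDerivAt.comp y (hF y hy) h1

/-- The integral of a derivative along the boundary of a rectangle vanishes. -/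
lemma rectIntegral_of_hasDerivAt {F f : ℂ → ℂ} (hx : x₀ ≤ x₁) (hy : y₀ ≤ y₁)
    (hF : ∀ z ∈ rectBoundary x₀ x₁ y₀ y₁, HasDerivAt F (f z) z)
    (hf : ∀ z ∈ rectBoundary x₀ x₁ y₀ y₁, ContinuousAt f z) :
    rectIntegral f x₀ x₁ y₀ y₁ = 0 := by
  unfold rectIntegral
  rw [integral_horizontal_of_hasDerivAt (fun x h => hF _ (bottom_mem_rectBoundary hx hy h))
      (fun x h => hf _ (bottom_mem_rectBoundary hx hy h)),
    integral_horizontal_of_hasDerivAt (fun x h => hF _ (top_mem_rectBoundary hx hy h))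
      (fun x h => hf _ (top_mem_rectBoundary hx hy h)),
    integral_vertical_of_hasDerivAt (fun x h => hF _ (left_mem_rectBoundary hx hy h))
      (fun x h => hf _ (left_mem_rectBoundary hx hy h)),
    integral_vertical_of_hasDerivAt (fun x h => hF _ (right_mem_rectBoundary hx hy h))
      (fun x h => hf _ (right_mem_rectBoundary hx hy h))]
  ring

lemma rectIntegral_sub_inv {s : ℂ} (hs₀ : x₀ < s.re) (hs₁ : s.re < x₁) (ht₀ : y₀ < s.im)
    (ht₁ : s.im < y₁) :
    rectIntegral (fun z => (z - s)⁻¹) x₀ x₁ y₀ y₁ = 2 * Real.pi * I := by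
  have hx : x₀ ≤ x₁ := (hs₀.trans hs₁).le
  have hy : y₀ ≤ y₁ := (ht₀.trans ht₁).le
  -- `log (z - s)` is a primitive on the right, upper and lower edges, `log (s - z)` on the left one
  have hlog : ∀ z : ℂ, z - s ∈ slitPlane → HasDerivAt (fun z => log (z - s)) ((z - s)⁻¹) z := by
    intro z hz
    simpa using ((hasDerivAt_id z).sub_const s).clog hz
  have hlog' : ∀ z : ℂ, s - z ∈ slitPlane → HasDerivAt (fun z => log (s - z)) ((z - s)⁻¹) z := by
    intro z hz
    have := ((hasDerivAt_id z).const_sub s).clog hz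
    simpa [neg_div, one_div, ← inv_neg] using this
  have hc : ∀ z : ℂ, z ≠ s → ContinuousAt (fun z => (z - s)⁻¹) z := fun z hz =>
    ContinuousAt.inv₀ (by fun_prop) (sub_ne_zero.2 hz)
  unfold rectIntegral
  rw [integral_horizontal_of_hasDerivAt (F := fun z => log (z - s)) (f := fun z => (z - s)⁻¹)
      (a := x₀) (b := x₁) (h := y₀),
    integral_horizontal_of_hasDerivAt (F := fun z => log (z - s)) (f := fun z => (z - s)⁻¹)
      (a := x₀) (b := x₁) (h := y₁),
    integral_vertical_of_hasDerivAt (F := fun z => log (z - s)) (f := fun z => (z - s)⁻¹)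
      (a := y₀) (b := y₁) (c := x₁),
    integral_vertical_of_hasDerivAt (F := fun z => log (s - z)) (f := fun z => (z - s)⁻¹)
      (a := y₀) (b := y₁) (c := x₀)]
  · have e1 : log (s - (x₀ + y₁ * I)) = log (x₀ + y₁ * I - s) - Real.pi * I := by
      rw [← neg_sub, log, log, norm_neg, arg_neg_eq_arg_sub_pi_of_im_pos (by simpa using ht₁)]
      push_cast; ring
    have e2 : log (s - (x₀ + y₀ * I)) = log (x₀ + y₀ * I - s) + Real.pi * I := by
      rw [← neg_sub, log, log, norm_neg, arg_neg_eq_arg_add_pi_of_im_neg (by simpa using ht₀)]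
      push_cast; ring
    rw [e1, e2]
    ring
  · intro y _
    refine hlog' _ (Or.inl ?_)
    simpa using hs₀
  · intro y _
    refine hc _ fun h => hs₀.ne ?_
    simp [← h]
  · intro y _
    refine hlog _ (Or.inl ?_)
    simpa using hs₁
  · intro y _
    refine hc _ fun h => hs₁.ne ?_
    simp [← h]
  · intro y _
    refine hlog _ (Or.inr ?_)
    simpa [sub_eq_zero] using ht₁.ne'
  · intro y _
    refine hc _ fun h => ht₁.ne ?_
    simp [← h]
  · intro y _
    refine hlog _ (Or.inr ?_)
    simpa [sub_eq_zero] using ht₀.ne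
  · intro y _
    refine hc _ fun h => ht₀.ne ?_
    simp [← h]

lemma rectIntegral_eq_zero {f : ℂ → ℂ} (hx : x₀ ≤ x₁) (hy : y₀ ≤ y₁)
    (hf : ∀ z : ℂ, z.re ∈ Icc x₀ x₁ → z.im ∈ Icc y₀ y₁ → DifferentiableAt ℂ f z) :
    rectIntegral f x₀ x₁ y₀ y₁ = 0 := by
  have := integral_boundary_rect_eq_zero_of_differentiableOn f (x₀ + y₀ * I) (x₁ + y₁ * I) ?_
  · simp only [add_re, ofReal_re, mul_re, I_re, mul_zero, ofReal_im, I_im, mul_one, sub_self,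
      add_zero, add_im, mul_im, zero_add, smul_eq_mul] at this
    simp only [rectIntegral, intervalIntegral.integral_mul_const]
    rw [← this]
    ring
  · intro z hz
    refine (hf z ?_ ?_).differentiableWithinAt
    · simpa [uIcc_of_le hx] using hz.1
    · simpa [uIcc_of_le hy] using hz.2

end rect

/-- Near a pole, a meromorphic function is the sum of a residue term, a derivative and an analytic
function. -/
lemma MeromorphicAt.exists_residue_decomposition {f : ℂ → ℂ} {s : ℂ} (hf : MeromorphicAt f s) :
    ∃ (A : ℂ) (Q Q' g : ℂ → ℂ), (∀ z, z ≠ s → HasDerivAt Q (Q' z) z) ∧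
      (∀ z, z ≠ s → DifferentiableAt ℂ Q' z) ∧ AnalyticAt ℂ g s ∧
      ∀ᶠ z in 𝓝[≠] s, f z = A * (z - s)⁻¹ + Q' z + g z := by
  obtain ⟨n, hn⟩ := hf
  have key : ∀ (n : ℕ) (G : ℂ → ℂ), AnalyticAt ℂ G s →
      ∃ (A : ℂ) (Q Q' g : ℂ → ℂ), (∀ z, z ≠ s → HasDerivAt Q (Q' z) z) ∧
      (∀ z, z ≠ s → DifferentiableAt ℂ Q' z) ∧ AnalyticAt ℂ g s ∧
      ∀ z, z ≠ s → ((z - s) ^ n)⁻¹ * G z = A * (z - s)⁻¹ + Q' z + g z := by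
    intro n
    induction n with
    | zero =>
      intro G hG
      exact ⟨0, 0, 0, G, fun z _ => hasDerivAt_const _ _, fun z _ => differentiableAt_const _, hG,
        fun z _ => by simp⟩
    | succ n ih =>
      intro G hG
      have hd : AnalyticAt ℂ (dslope G s) s := by
        obtain ⟨p, hp⟩ := hG
        exact ⟨_, hp.has_fpower_series_dslope_fslope⟩
      obtain ⟨A, Q, Q', g, hQ, hQ', hg, h⟩ := ih _ hd
      have hG : ∀ z, z ≠ s → G z = G s + (z - s) * dslope G s z := by
        intro z hz
        rw [dslope_of_ne _ hz, slope_def_field]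
        field_simp [sub_ne_zero.2 hz]
        ring
      rcases Nat.eq_zero_or_pos n with rfl | hpos
      · refine ⟨A + G s, Q, Q', g, hQ, hQ', hg, fun z hz => ?_⟩
        have h1 := h z hz
        have h2 := sub_ne_zero.2 hz
        simp only [pow_zero, inv_one, one_mul] at h1
        rw [hG z hz, h1]
        field_simp
        ring
      · refine ⟨A, fun z => Q z + -(n : ℂ)⁻¹ * G s * ((z - s) ^ n)⁻¹,
          fun z => Q' z + G s * ((z - s) ^ (n + 1))⁻¹, g, fun z hz => ?_, fun z hz => ?_, hg,
          fun z hz => ?_⟩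
        · have h2 := sub_ne_zero.2 hz
          have h3 : HasDerivAt (fun z => ((z - s) ^ n)⁻¹) _ z :=
            (((hasDerivAt_id z).sub_const s).pow n).inv (pow_ne_zero n h2)
          have h4 : (n : ℂ) ≠ 0 := by exact_mod_cast hpos.ne'
          obtain ⟨k, rfl⟩ : ∃ k, n = k + 1 := ⟨n - 1, by omega⟩
          refine ((hQ z hz).add (h3.const_mul (-((k + 1 : ℕ) : ℂ)⁻¹ * G s))).congr_deriv ?_
          simp only [_root_.id, Pi.pow_apply, Nat.add_sub_cancel]
          field_simp
          ring
        · have h2 := sub_ne_zero.2 hz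
          refine (hQ' z hz).add ((DifferentiableAt.inv (h := fun z => (z - s) ^ (n + 1))
            (by fun_prop) (pow_ne_zero _ h2)).const_mul _)
        · have h1 := h z hz
          have h2 := sub_ne_zero.2 hz
          calc ((z - s) ^ (n + 1))⁻¹ * G z
              = G s * ((z - s) ^ (n + 1))⁻¹ + ((z - s) ^ n)⁻¹ * dslope G s z := by
                rw [hG z hz]; field_simp; ring
            _ = _ := by rw [h1]; ring
  obtain ⟨A, Q, Q', g, hQ, hQ', hg, h⟩ := key n _ hn
  refine ⟨A, Q, Q', g, hQ, hQ', hg, eventually_nhdsWithin_of_forall fun z hz => ?_⟩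
  rw [← h z hz, smul_eq_mul, inv_mul_cancel_left₀ (pow_ne_zero n (sub_ne_zero.2 hz))]

lemma circleIntegrable_of_continuousAt {f : ℂ → ℂ} {s : ℂ} {r : ℝ} (hr : 0 ≤ r)
    (hf : ∀ z ∈ Metric.sphere s r, ContinuousAt f z) : CircleIntegrable f s r :=
  ContinuousOn.circleIntegrable hr fun z hz => (hf z hz).continuousWithinAt

/-- **Residue theorem** for a rectangle, with the residues written as integrals along circles. -/
theorem rectIntegral_eq_sum_circleIntegral {x₀ x₁ y₀ y₁ : ℝ} (hx : x₀ ≤ x₁) (hy : y₀ ≤ y₁)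
    (ρ : ℂ → ℝ) (S : Finset ℂ) (f : ℂ → ℂ)
    (hS : ∀ s ∈ S, (x₀ < s.re ∧ s.re < x₁) ∧ y₀ < s.im ∧ s.im < y₁)
    (hf : ∀ z : ℂ, z.re ∈ Icc x₀ x₁ → z.im ∈ Icc y₀ y₁ → z ∉ S → DifferentiableAt ℂ f z)
    (hmer : ∀ s ∈ S, MeromorphicAt f s) (hρ : ∀ s ∈ S, 0 < ρ s)
    (hdisc : ∀ s ∈ S, ∀ z ∈ Metric.closedBall s (ρ s), z ≠ s → z ∉ S ∧ DifferentiableAt ℂ f z) :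
    rectIntegral f x₀ x₁ y₀ y₁ = ∑ s ∈ S, ∮ z in C(s, ρ s), f z := by
  classical
  induction S using Finset.induction_on generalizing f with
  | empty =>
    rw [Finset.sum_empty]
    exact rectIntegral_eq_zero hx hy fun z h₁ h₂ => hf z h₁ h₂ (by simp)
  | insert s S hsS ih =>
    obtain ⟨A, Q, Q', g, hQ, hQ', hg, h⟩ :=
      (hmer s (Finset.mem_insert_self s S)).exists_residue_decomposition
    set p : ℂ → ℂ := fun z => A * (z - s)⁻¹ + Q' z with hp
    have hpd : ∀ z, z ≠ s → DifferentiableAt ℂ p z := fun z hz =>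
      ((DifferentiableAt.inv (h := fun z => z - s) (by fun_prop)
        (sub_ne_zero.2 hz)).const_mul A).add (hQ' z hz)
    have hAd : ∀ z, z ≠ s → DifferentiableAt ℂ (fun z => A * (z - s)⁻¹) z := fun z hz =>
      (DifferentiableAt.inv (h := fun z => z - s) (by fun_prop) (sub_ne_zero.2 hz)).const_mul A
    -- `f₁` is `f` without its principal part at `s`
    set f₁ : ℂ → ℂ := Function.update (fun z => f z - p z) s (g s) with hf₁
    have hf₁ne : ∀ z, z ≠ s → f₁ z = f z - p z := fun z hz => by
      simp [hf₁, Function.update_of_ne hz]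
    have hf₁ev : ∀ z, z ≠ s → f₁ =ᶠ[𝓝 z] fun z => f z - p z := fun z hz =>
      (isOpen_ne.eventually_mem hz).mono fun w hw => hf₁ne w hw
    have hf₁d : ∀ z, z ≠ s → DifferentiableAt ℂ f z → DifferentiableAt ℂ f₁ z := fun z hz hfz =>
      (hf₁ev z hz).differentiableAt_iff.2 (hfz.sub (hpd z hz))
    have hf₁s : DifferentiableAt ℂ f₁ s := by
      have : f₁ =ᶠ[𝓝 s] g := by
        rw [eventually_nhdsWithin_iff] at h
        filter_upwards [h] with z hz
        by_cases hzs : z = s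
        · subst hzs; simp [hf₁]
        · rw [hf₁ne z hzs, hz hzs, hp]; ring
      exact this.differentiableAt_iff.2 hg.differentiableAt
    have hbd : ∀ z ∈ rectBoundary x₀ x₁ y₀ y₁, z ∉ insert s S := by
      rintro z ⟨-, -, hz⟩ hzS
      have := hS z hzS
      rcases hz with hz | hz | hz | hz <;> rw [hz] at this <;> linarith [this.1.1, this.1.2, this.2.1, this.2.2]
    have hbs : ∀ z ∈ rectBoundary x₀ x₁ y₀ y₁, z ≠ s := fun z hz h' =>
      hbd z hz (by simp [h'])
    have hbf : ∀ z ∈ rectBoundary x₀ x₁ y₀ y₁, DifferentiableAt ℂ f z := fun z hz =>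
      hf z hz.1 hz.2.1 (hbd z hz)
    have hs' := hS s (Finset.mem_insert_self s S)
    have hρs := hρ s (Finset.mem_insert_self s S)
    have hrect_p : rectIntegral p x₀ x₁ y₀ y₁ = A * (2 * Real.pi * I) := by
      rw [hp, rectIntegral_add hx hy (fun z hz => (hAd z (hbs z hz)).continuousAt)
        (fun z hz => (hQ' z (hbs z hz)).continuousAt), rectIntegral_const_mul,
        rectIntegral_sub_inv hs'.1.1 hs'.1.2 hs'.2.1 hs'.2.2,
        rectIntegral_of_hasDerivAt hx hy (fun z hz => hQ z (hbs z hz))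
          (fun z hz => (hQ' z (hbs z hz)).continuousAt), add_zero]
    have hrect : rectIntegral f x₀ x₁ y₀ y₁ =
        rectIntegral f₁ x₀ x₁ y₀ y₁ + rectIntegral p x₀ x₁ y₀ y₁ := by
      rw [← rectIntegral_add hx hy
        (fun z hz => (hf₁d z (hbs z hz) (hbf z hz)).continuousAt)
        (fun z hz => (hpd z (hbs z hz)).continuousAt)]
      exact rectIntegral_congr hx hy fun z hz => by rw [hf₁ne z (hbs z hz)]; ring
    have hcirc : ∀ (t : ℂ) (r : ℝ), 0 < r → s ∉ Metric.sphere t r →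
        (∀ z ∈ Metric.sphere t r, DifferentiableAt ℂ f z) →
        (∮ z in C(t, r), f z) = (∮ z in C(t, r), f₁ z) + ∮ z in C(t, r), p z := by
      intro t r hr hst hfd
      have hne : ∀ z ∈ Metric.sphere t r, z ≠ s := fun z hz h' => hst (h' ▸ hz)
      rw [← circleIntegral.integral_add
        (circleIntegrable_of_continuousAt hr.le fun z hz => (hf₁d z (hne z hz) (hfd z hz)).continuousAt)
        (circleIntegrable_of_continuousAt hr.le fun z hz => (hpd z (hne z hz)).continuousAt)]
      exact circleIntegral.integral_congr hr.le fun z hz => by rw [hf₁ne z (hne z hz)]; ring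
    have hss : ∀ {t : ℂ} {r : ℝ}, 0 < r → ∀ z ∈ Metric.sphere t r, z ≠ t := by
      rintro t r hr z hz rfl
      simp at hz
      exact hr.ne hz
    have hcs : (∮ z in C(s, ρ s), f z) = A * (2 * Real.pi * I) := by
      rw [hcirc s (ρ s) hρs (fun h' => hss hρs s h' rfl) fun z hz =>
        (hdisc s (Finset.mem_insert_self s S) z (Metric.sphere_subset_closedBall hz)
          (hss hρs z hz)).2]
      have h0 : (∮ z in C(s, ρ s), f₁ z) = 0 := by
        have hd : ∀ z ∈ Metric.closedBall s (ρ s), DifferentiableAt ℂ f₁ z := by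
          intro z hz
          by_cases hzs : z = s
          · rw [hzs]; exact hf₁s
          · exact hf₁d z hzs (hdisc s (Finset.mem_insert_self s S) z hz hzs).2
        exact circleIntegral_eq_zero_of_differentiable_on_off_countable hρs.le countable_empty
          (fun z hz => (hd z hz).continuousAt.continuousWithinAt)
          (fun z hz => hd z (Metric.ball_subset_closedBall hz.1))
      rw [h0, zero_add, hp, circleIntegral.integral_add
        (circleIntegrable_of_continuousAt hρs.le fun z hz => (hAd z (hss hρs z hz)).continuousAt)
        (circleIntegrable_of_continuousAt hρs.le fun z hz => (hQ' z (hss hρs z hz)).continuousAt),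
        circleIntegral.integral_const_mul, circleIntegral.integral_sub_center_inv _ hρs.ne',
        circleIntegral.integral_eq_zero_of_hasDerivWithinAt hρs.le
          (fun z hz => (hQ z (hss hρs z hz)).hasDerivWithinAt), add_zero]
    rw [Finset.sum_insert hsS, hcs, hrect, hrect_p, add_comm]
    congr 1
    rw [ih f₁]
    · refine Finset.sum_congr rfl fun t ht => ?_
      have htS := Finset.mem_insert_of_mem (b := s) ht
      have hρt := hρ t htS
      have hts : t ≠ s := fun h' => hsS (h' ▸ ht)
      have hsb : s ∉ Metric.closedBall t (ρ t) := fun h' =>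
        (hdisc t htS s h' hts.symm).1 (Finset.mem_insert_self s S)
      have hne : ∀ z ∈ Metric.closedBall t (ρ t), z ≠ s := fun z hz h' => hsb (h' ▸ hz)
      have hptd : ∀ z ∈ Metric.closedBall t (ρ t), DifferentiableAt ℂ p z := fun z hz =>
        hpd z (hne z hz)
      rw [hcirc t (ρ t) hρt (fun h' => hsb (Metric.sphere_subset_closedBall h')) fun z hz =>
        (hdisc t htS z (Metric.sphere_subset_closedBall hz) (hss hρt z hz)).2]
      rw [circleIntegral_eq_zero_of_differentiable_on_off_countable (f := p) hρt.le countable_empty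
        (fun z hz => (hptd z hz).continuousAt.continuousWithinAt)
        (fun z hz => hptd z (Metric.ball_subset_closedBall hz.1)), add_zero]
    · exact fun t ht => hS t (Finset.mem_insert_of_mem ht)
    · intro z h₁ h₂ hz
      by_cases hzs : z = s
      · rw [hzs]; exact hf₁s
      · exact hf₁d z hzs (hf z h₁ h₂ (by simp [hzs, hz]))
    · intro t ht
      have hts : t ≠ s := fun h' => hsS (h' ▸ ht)
      have hpa : AnalyticAt ℂ p t := analyticAt_iff_eventually_differentiableAt.2
        ((isOpen_ne.eventually_mem hts).mono fun w hw => hpd w hw)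
      exact ((hmer t (Finset.mem_insert_of_mem ht)).sub hpa.meromorphicAt).congr
        (((hf₁ev t hts).symm).filter_mono nhdsWithin_le_nhds)
    · exact fun t ht => hρ t (Finset.mem_insert_of_mem ht)
    · intro t ht z hz hzt
      have htS := Finset.mem_insert_of_mem (b := s) ht
      obtain ⟨h1, h2⟩ := hdisc t htS z hz hzt
      rw [Finset.mem_insert, not_or] at h1
      exact ⟨h1.2, hf₁d z h1.1 h2⟩

/-! ### Growth of the Gamma function -/

/-- For real `0 < x ≤ X`, the quotient `|Γ(x + iy)| / Γ(x)` is at most `|Γ(X + iy)| / Γ(X)`: this is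
the estimate `|B(x + iy, X - x)| ≤ B(x, X - x)` for the Beta function. -/
lemma norm_Gamma_mul_Gamma_le {x X : ℝ} (hx : 0 < x) (hX : x ≤ X) (y : ℝ) :
    ‖Gamma (x + y * I)‖ * Real.Gamma X ≤ ‖Gamma (X + y * I)‖ * Real.Gamma x := by
  rcases hX.eq_or_lt with rfl | hlt
  · exact le_rfl
  set t : ℝ := X - x with ht
  have htpos : 0 < t := sub_pos.2 hlt
  have h1 : Gamma (x + y * I) * Gamma t = Gamma (X + y * I) * betaIntegral (x + y * I) t := by
    rw [Gamma_mul_Gamma_eq_betaIntegral (by simpa) (by simpa)]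
    congr 2
    rw [ht]; push_cast; ring
  have h2 : Real.Gamma x * Real.Gamma t = Real.Gamma X * ‖betaIntegral x t‖ := by
    have := Gamma_mul_Gamma_eq_betaIntegral (s := x) (t := t) (by simpa) (by simpa)
    rw [← ofReal_add, ht, add_sub_cancel, Gamma_ofReal, Gamma_ofReal, Gamma_ofReal] at this
    have h3 := congrArg norm this
    rw [norm_mul, norm_mul, norm_real, norm_real, norm_real, Real.norm_of_nonneg, Real.norm_of_nonneg,
      Real.norm_of_nonneg] at h3
    · exact h3
    all_goals exact (Real.Gamma_pos_of_pos (by linarith)).le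
  have h3 : ‖betaIntegral (x + y * I) t‖ ≤ ‖betaIntegral x t‖ := by
    have hreal : betaIntegral x t = ((∫ u : ℝ in 0..1, u ^ (x - 1) * (1 - u) ^ (t - 1) : ℝ) : ℂ) := by
      rw [betaIntegral, ← intervalIntegral.integral_ofReal]
      refine intervalIntegral.integral_congr fun u hu => ?_
      rw [uIcc_of_le zero_le_one] at hu
      rw [ofReal_mul, ofReal_cpow hu.1, ofReal_cpow (by linarith [hu.2])]
      push_cast
      rfl
    have hint : IntervalIntegrable (fun u : ℝ => u ^ (x - 1) * (1 - u) ^ (t - 1)) volume 0 1 := by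
      have := (betaIntegral_convergent (u := x) (v := t) (by simpa) (by simpa)).norm
      refine this.congr_ae ?_
      rw [EventuallyEq, ae_restrict_iff' measurableSet_uIoc]
      refine ae_of_all _ fun u hu => ?_
      rw [uIoc_of_le zero_le_one] at hu
      rcases hu.2.eq_or_lt with rfl | hu2
      · simp only [ofReal_one, sub_self, norm_mul, one_cpow]
        by_cases h : t - 1 = 0
        · have : (t : ℂ) - 1 = 0 := by exact_mod_cast h
          simp [h, this]
        · have : (t : ℂ) - 1 ≠ 0 := by exact_mod_cast h
          simp [Real.zero_rpow h, zero_cpow this]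
      · rw [norm_mul, norm_cpow_eq_rpow_re_of_pos hu.1]
        have : ((1 : ℂ) - u) = ((1 - u : ℝ) : ℂ) := by push_cast; rfl
        rw [this, norm_cpow_eq_rpow_re_of_pos (by linarith)]
        simp
    rw [hreal, norm_real]
    refine le_trans ?_ (le_abs_self _)
    refine intervalIntegral.norm_integral_le_of_norm_le zero_le_one ?_ hint
    have : ∀ᵐ u : ℝ, u ≠ 1 := by simp [ae_iff]
    filter_upwards [this] with u hu1 hu
    have h1u : 0 < 1 - u := sub_pos.2 (lt_of_le_of_ne hu.2 hu1)
    rw [norm_mul, norm_cpow_eq_rpow_re_of_pos hu.1]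
    have : ((1 : ℂ) - u) = ((1 - u : ℝ) : ℂ) := by push_cast; rfl
    rw [this, norm_cpow_eq_rpow_re_of_pos h1u]
    simp
  have hGt := Real.Gamma_pos_of_pos htpos
  have h4 : ‖Gamma (x + y * I)‖ * Real.Gamma t
      = ‖Gamma (X + y * I)‖ * ‖betaIntegral (x + y * I) t‖ := by
    rw [← norm_mul, ← h1, norm_mul, Gamma_ofReal, norm_real, Real.norm_of_nonneg hGt.le]
  have hGX := Real.Gamma_pos_of_pos (hx.trans hlt)
  refine le_of_mul_le_mul_right ?_ hGt
  calc ‖Gamma (x + y * I)‖ * Real.Gamma X * Real.Gamma t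
      = ‖Gamma (X + y * I)‖ * (Real.Gamma X * ‖betaIntegral (x + y * I) t‖) := by
        rw [mul_right_comm, h4]; ring
    _ ≤ ‖Gamma (X + y * I)‖ * (Real.Gamma X * ‖betaIntegral x t‖) := by gcongr
    _ = ‖Gamma (X + y * I)‖ * Real.Gamma x * Real.Gamma t := by rw [← h2]; ring

/-- **Stirling's formula** up to a logarithmic error. -/
lemma exists_abs_log_Gamma_sub_le :
    ∃ K : ℝ, ∀ u : ℝ, 2 ≤ u →
      |Real.log (Real.Gamma u) - (u * Real.log u - u)| ≤ 2 * Real.log u + K := by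
  refine ⟨max (2 + Real.log 2 + |Real.log (Stirling.stirlingSeq 1)|)
    (2 + |Real.log (2 * Real.pi) / 2|), fun u hu => ?_⟩
  set n := ⌊u⌋₊ with hn
  have hn1 : (n : ℝ) ≤ u := Nat.floor_le (by linarith)
  have hn2 : u < n + 1 := Nat.lt_floor_add_one u
  have hn3 : 2 ≤ n := Nat.le_floor (by exact_mod_cast hu)
  have hn3' : (2 : ℝ) ≤ n := by exact_mod_cast hn3
  have hlu : 0 ≤ Real.log u := Real.log_nonneg (by linarith)
  have hln : 0 ≤ Real.log n := Real.log_nonneg (by linarith)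
  have hlnu : Real.log n ≤ Real.log u := Real.log_le_log (by linarith) hn1
  have hmono := Real.Gamma_strictMonoOn_Ici.monotoneOn
  have hGu : 0 < Real.Gamma u := Real.Gamma_pos_of_pos (by linarith)
  have hup : Real.log (Real.Gamma u) ≤ Real.log (n.factorial : ℝ) := by
    refine Real.log_le_log hGu ?_
    rw [← Real.Gamma_nat_eq_factorial]
    exact hmono hu (by simp only [mem_Ici]; linarith) hn2.le
  have hlow : Real.log (n.factorial : ℝ) - Real.log n ≤ Real.log (Real.Gamma u) := by
    have h1 : Real.Gamma n ≤ Real.Gamma u := hmono hn3' hu hn1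
    have h2 : (n.factorial : ℝ) = n * Real.Gamma n := by
      rw [← Real.Gamma_nat_eq_factorial, Real.Gamma_add_one (by positivity)]
    have h3 : 0 < Real.Gamma n := Real.Gamma_pos_of_pos (by linarith)
    rw [h2, Real.log_mul (by positivity) h3.ne']
    linarith [Real.log_le_log h3 h1]
  have hS1 : Real.log (n.factorial : ℝ) ≤ Real.log (Stirling.stirlingSeq 1)
      + 1 / 2 * Real.log (2 * n) + n * Real.log (n / Real.exp 1) := by
    have h1 : Real.log (Stirling.stirlingSeq n) ≤ Real.log (Stirling.stirlingSeq 1) := by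
      obtain ⟨k, hk⟩ : ∃ k, n = k + 1 := ⟨n - 1, by omega⟩
      rw [hk]
      exact Stirling.log_stirlingSeq'_antitone (Nat.zero_le k)
    rw [Stirling.log_stirlingSeq_formula] at h1
    linarith
  have hS2 := Stirling.le_log_factorial_stirling (n := n) (by omega)
  rw [Real.log_div (by positivity) (by positivity), Real.log_exp, Real.log_mul two_ne_zero
    (by positivity)] at hS1
  have hl2 : 0 ≤ Real.log 2 := Real.log_nonneg (by norm_num)
  have h5 : (n : ℝ) * Real.log n ≤ n * Real.log u := by gcongr
  have h6 : (n : ℝ) * Real.log u ≤ n * Real.log n + 1 := by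
    have h7 : Real.log (u / n) ≤ u / n - 1 := Real.log_le_sub_one_of_pos (by positivity)
    rw [Real.log_div (by linarith) (by positivity)] at h7
    have h8 : (n : ℝ) * (Real.log u - Real.log n) ≤ n * (u / n - 1) := by gcongr
    have h9 : (n : ℝ) * (u / n - 1) = u - n := by field_simp
    linarith
  have h10 : 0 ≤ (u - n) * Real.log u := mul_nonneg (by linarith) hlu
  have h11 : (u - n) * Real.log u ≤ 1 * Real.log u :=
    mul_le_mul_of_nonneg_right (by linarith) hlu
  have ha := le_abs_self (Real.log (Stirling.stirlingSeq 1))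
  have hb := neg_abs_le (Real.log (2 * Real.pi) / 2)
  rw [abs_le]
  constructor
  · have := le_max_right (2 + Real.log 2 + |Real.log (Stirling.stirlingSeq 1)|)
      (2 + |Real.log (2 * Real.pi) / 2|)
    linarith
  · have := le_max_left (2 + Real.log 2 + |Real.log (Stirling.stirlingSeq 1)|)
      (2 + |Real.log (2 * Real.pi) / 2|)
    linarith

/-! ### Exponential estimates on strips and half-strips -/

/-- `f` is `O(exp (-κ' |im s|))` on vertical strips for every `κ' < κ`. (A constant factor in the
bound would be redundant, since `κ'` is arbitrary.) -/
def StripDecay (f : ℂ → ℂ) (κ : ℝ) : Prop :=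
  ∀ x₁ x₂ κ' : ℝ, κ' < κ → ∀ᶠ t : ℝ in atTop, ∀ x ∈ Icc x₁ x₂, ∀ y : ℝ, |y| = t →
    ‖f (x + y * I)‖ ≤ Real.exp (-κ' * t)

/-- `f` is `O(exp (-D x log x + κ' x))`, `x = re s`, for `im s ∈ Y` and `x → +∞`, for every
`κ' > κ`. -/
def HorizontalGrowth (Y : Set ℝ) (f : ℂ → ℂ) (D κ : ℝ) : Prop :=
  ∀ κ' : ℝ, κ < κ' → ∀ᶠ x : ℝ in atTop, ∀ y ∈ Y,
    ‖f (x + y * I)‖ ≤ Real.exp (-D * (x * Real.log x) + κ' * x)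

lemma StripDecay.mul {f g : ℂ → ℂ} {κ l : ℝ} (hf : StripDecay f κ) (hg : StripDecay g l) :
    StripDecay (fun s => f s * g s) (κ + l) := by
  intro x₁ x₂ κ' hκ
  filter_upwards [hf x₁ x₂ (κ - (κ + l - κ') / 2) (by linarith),
    hg x₁ x₂ (l - (κ + l - κ') / 2) (by linarith)] with t h1 h2 x hx y hy
  rw [norm_mul]
  refine (mul_le_mul (h1 x hx y hy) (h2 x hx y hy) (norm_nonneg _) (Real.exp_pos _).le).trans ?_
  rw [← Real.exp_add]
  exact Real.exp_le_exp.2 (le_of_eq (by ring))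

lemma HorizontalGrowth.mul {Y : Set ℝ} {f g : ℂ → ℂ} {D E κ l : ℝ} (hf : HorizontalGrowth Y f D κ)
    (hg : HorizontalGrowth Y g E l) : HorizontalGrowth Y (fun s => f s * g s) (D + E) (κ + l) := by
  intro κ' hκ
  filter_upwards [hf (κ + (κ' - κ - l) / 2) (by linarith), hg (l + (κ' - κ - l) / 2) (by linarith)]
    with x h1 h2 y hy
  rw [norm_mul]
  refine (mul_le_mul (h1 y hy) (h2 y hy) (norm_nonneg _) (Real.exp_pos _).le).trans ?_
  rw [← Real.exp_add]
  exact Real.exp_le_exp.2 (le_of_eq (by ring))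

lemma stripDecay_of_bound {f : ℂ → ℂ} {C : ℝ} (hf : ∀ s, ‖f s‖ ≤ C) : StripDecay f 0 := by
  intro x₁ x₂ κ' hκ
  have : Tendsto (fun t : ℝ => Real.exp (-κ' * t)) atTop atTop :=
    Real.tendsto_exp_atTop.comp (tendsto_id.const_mul_atTop (by linarith))
  filter_upwards [this.eventually_ge_atTop C] with t ht x _ y _
  exact (hf _).trans ht

lemma horizontalGrowth_of_bound {Y : Set ℝ} {f : ℂ → ℂ} {C : ℝ}
    (hf : ∀ᶠ x : ℝ in atTop, ∀ y ∈ Y, ‖f (x + y * I)‖ ≤ C) : HorizontalGrowth Y f 0 0 := by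
  intro κ' hκ
  have : Tendsto (fun t : ℝ => Real.exp (-0 * (t * Real.log t) + κ' * t)) atTop atTop := by
    simp only [neg_zero, zero_mul, zero_add]
    exact Real.tendsto_exp_atTop.comp (tendsto_id.const_mul_atTop (by linarith))
  filter_upwards [this.eventually_ge_atTop C, hf] with t ht h y hy
  exact (h y hy).trans ht

lemma StripDecay.prod {ι : Type*} (S : Finset ι) {f : ι → ℂ → ℂ} {κ : ι → ℝ}
    (hf : ∀ i ∈ S, StripDecay (f i) (κ i)) :
    StripDecay (fun s => ∏ i ∈ S, f i s) (∑ i ∈ S, κ i) := by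
  classical
  induction S using Finset.induction_on with
  | empty => simpa using stripDecay_of_bound (f := fun _ => 1) (C := 1) (by simp)
  | insert i S hi ih =>
    simp only [Finset.prod_insert hi, Finset.sum_insert hi]
    exact (hf i (by simp)).mul (ih fun j hj => hf j (by simp [hj]))

lemma HorizontalGrowth.prod {ι : Type*} (S : Finset ι) {Y : Set ℝ} {f : ι → ℂ → ℂ} {D κ : ι → ℝ}
    (hf : ∀ i ∈ S, HorizontalGrowth Y (f i) (D i) (κ i)) :
    HorizontalGrowth Y (fun s => ∏ i ∈ S, f i s) (∑ i ∈ S, D i) (∑ i ∈ S, κ i) := by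
  classical
  induction S using Finset.induction_on with
  | empty =>
    simpa using horizontalGrowth_of_bound (f := fun _ => 1) (C := 1) (by simp)
  | insert i S hi ih =>
    simp only [Finset.prod_insert hi, Finset.sum_insert hi]
    exact (hf i (by simp)).mul (ih fun j hj => hf j (by simp [hj]))

lemma StripDecay.congr {f g : ℂ → ℂ} {κ : ℝ} (hf : StripDecay f κ)
    (h : ∀ s : ℂ, s.im ≠ 0 → f s = g s) : StripDecay g κ := by
  intro x₁ x₂ κ' hκ
  filter_upwards [hf x₁ x₂ κ' hκ, eventually_gt_atTop 0] with t h1 h2 x hx y hy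
  rw [← h]
  · exact h1 x hx y hy
  · simp only [add_im, ofReal_im, mul_im, ofReal_re, I_im, mul_one, I_re, mul_zero, add_zero,
      zero_add]
    rintro rfl
    simp at hy
    linarith

lemma HorizontalGrowth.congr {Y : Set ℝ} {f g : ℂ → ℂ} {D κ : ℝ} (hf : HorizontalGrowth Y f D κ)
    (h : ∀ᶠ x : ℝ in atTop, ∀ y ∈ Y, f (x + y * I) = g (x + y * I)) :
    HorizontalGrowth Y g D κ := by
  intro κ' hκ
  filter_upwards [hf κ' hκ, h] with t h1 h2 y hy
  rw [← h2 y hy]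
  exact h1 y hy

/-- Affine changes of variable in strip estimates. -/
lemma StripDecay.comp_affine {f : ℂ → ℂ} {κ : ℝ} (hf : StripDecay f κ) (b : ℂ) {B : ℝ}
    (hB : B ≠ 0) : StripDecay (fun s => f (b + B * s)) (|B| * κ) := by
  intro x₁ x₂ κ' hκ
  have hB' : 0 < |B| := abs_pos.2 hB
  obtain ⟨κ₁, h1, h2⟩ : ∃ κ₁, κ₁ < κ ∧ κ' < |B| * κ₁ := by
    refine ⟨κ - (|B| * κ - κ') / (2 * |B|), ?_, ?_⟩
    · have : 0 < (|B| * κ - κ') / (2 * |B|) := by apply div_pos <;> linarith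
      linarith
    · have : |B| * (κ - (|B| * κ - κ') / (2 * |B|)) = (|B| * κ + κ') / 2 := by field_simp; ring
      rw [this]; linarith
  obtain ⟨T, hT⟩ := eventually_atTop.1
    (hf (b.re - |B| * (|x₁| + |x₂|)) (b.re + |B| * (|x₁| + |x₂|)) κ₁ h1)
  have e1 : Tendsto (fun t : ℝ => |B| * t - |b.im|) atTop atTop :=
    tendsto_atTop_add_const_right _ _ (tendsto_id.const_mul_atTop hB')
  have e2 : Tendsto (fun t : ℝ => (|B| * κ₁ - κ') * t) atTop atTop :=
    tendsto_id.const_mul_atTop (by linarith)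
  filter_upwards [e1.eventually_ge_atTop T, e2.eventually_ge_atTop (|κ₁| * |b.im|)]
    with t ht1 ht2 x hx y hy
  have hx' : |x| ≤ |x₁| + |x₂| := by
    rw [abs_le]
    constructor
    · linarith [hx.1, neg_abs_le x₁, abs_nonneg x₂]
    · linarith [hx.2, le_abs_self x₂, abs_nonneg x₁]
  have hBx : |B * x| ≤ |B| * (|x₁| + |x₂|) := by rw [abs_mul]; gcongr
  rw [abs_le] at hBx
  have hy1 : |B| * t - |b.im| ≤ |b.im + B * y| := by
    have := abs_sub_abs_le_abs_sub (B * y) (-b.im)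
    rw [abs_neg, abs_mul, hy, sub_neg_eq_add, add_comm (B * y)] at this
    exact this
  have hy2 : |b.im + B * y| ≤ |B| * t + |b.im| := by
    have := abs_add_le b.im (B * y)
    rw [abs_mul, hy] at this
    linarith
  have h3 := hT _ (ht1.trans hy1) (b.re + B * x) ⟨by linarith [hBx.1], by linarith [hBx.2]⟩
    (b.im + B * y) rfl
  have harg : ((b.re + B * x : ℝ) : ℂ) + ((b.im + B * y : ℝ) : ℂ) * I = b + B * (x + y * I) := by
    apply Complex.ext <;> simp
  rw [harg] at h3
  refine h3.trans (Real.exp_le_exp.2 ?_)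
  have h4 : -κ₁ * (|b.im + B * y| - |B| * t) ≤ |κ₁| * |b.im| := by
    calc _ ≤ |-κ₁ * (|b.im + B * y| - |B| * t)| := le_abs_self _
      _ = |κ₁| * |(|b.im + B * y| - |B| * t)| := by rw [abs_mul, abs_neg]
      _ ≤ _ := mul_le_mul_of_nonneg_left (abs_le.2 ⟨by linarith, by linarith⟩) (abs_nonneg _)
  linarith

lemma norm_sin_le_exp (s : ℂ) : ‖sin s‖ ≤ Real.exp |s.im| := by
  rw [sin]
  have h1 : ‖cexp (-s * I)‖ ≤ Real.exp |s.im| := by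
    rw [norm_exp]
    exact Real.exp_le_exp.2 (by simpa using le_abs_self s.im)
  have h2 : ‖cexp (s * I)‖ ≤ Real.exp |s.im| := by
    rw [norm_exp]
    exact Real.exp_le_exp.2 (by simpa using neg_le_abs s.im)
  rw [norm_div, norm_mul, norm_I, mul_one]
  have := norm_sub_le (cexp (-s * I)) (cexp (s * I))
  simp only [RCLike.norm_ofNat]
  linarith

lemma abs_sinh_im_le_norm_sin (s : ℂ) : |Real.sinh s.im| ≤ ‖sin s‖ := by
  rw [sin, norm_div, norm_mul, norm_I, mul_one, Real.sinh_eq]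
  have h1 : ‖cexp (-s * I)‖ = Real.exp s.im := by rw [norm_exp]; simp
  have h2 : ‖cexp (s * I)‖ = Real.exp (-s.im) := by rw [norm_exp]; simp
  have := abs_norm_sub_norm_le (cexp (-s * I)) (cexp (s * I))
  rw [h1, h2] at this
  rw [abs_div]
  simp only [RCLike.norm_ofNat, abs_two]
  linarith

lemma norm_Gamma_half_add_le (y : ℝ) :
    ‖Gamma (1 / 2 + y * I)‖ ≤ √(2 * Real.pi) * Real.exp (-(Real.pi / 2) * |y|) := by
  have h1 : ‖Gamma (1 / 2 + y * I)‖ ^ 2 * Real.cosh (Real.pi * y) = Real.pi := by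
    have h := Gamma_mul_Gamma_one_sub (1 / 2 + y * I)
    have hc : (1 : ℂ) - (1 / 2 + y * I) = (starRingEnd ℂ) (1 / 2 + y * I) := by
      apply Complex.ext <;> norm_num
    have hs : sin (Real.pi * (1 / 2 + y * I)) = (Real.cosh (Real.pi * y) : ℂ) := by
      rw [mul_add, show (Real.pi : ℂ) * (1 / 2) = Real.pi / 2 by ring, add_comm, sin_add_pi_div_two,
        ← mul_assoc, cos_mul_I]
      push_cast; rfl
    rw [hc, Gamma_conj, mul_conj, hs, normSq_eq_norm_sq] at h
    have hne : Real.cosh (Real.pi * y) ≠ 0 := (Real.cosh_pos _).ne'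
    rw [← ofReal_div] at h
    have h' := ofReal_injective h
    rw [h']
    field_simp
  have h2 : Real.exp (Real.pi * |y|) / 2 ≤ Real.cosh (Real.pi * y) := by
    rw [← Real.cosh_abs, abs_mul, abs_of_pos Real.pi_pos, Real.cosh_eq]
    have := Real.exp_pos (-(Real.pi * |y|))
    linarith
  refine le_of_sq_le_sq ?_ (by positivity)
  rw [mul_pow, Real.sq_sqrt (by positivity), ← Real.exp_nat_mul]
  have h3 : Real.exp ((2 : ℕ) * (-(Real.pi / 2) * |y|)) = (Real.exp (Real.pi * |y|))⁻¹ := by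
    rw [← Real.exp_neg]; congr 1; push_cast; ring
  rw [h3, ← div_eq_mul_inv, le_div_iff₀ (Real.exp_pos _)]
  have := mul_le_mul_of_nonneg_left h2 (sq_nonneg ‖Gamma (1 / 2 + y * I)‖)
  linarith

/-- **Stirling's formula** on vertical strips. -/
lemma stripDecay_Gamma : StripDecay Gamma (Real.pi / 2) := by
  -- the lines `re s = N + 1/2`
  have key : ∀ (N : ℕ) (κ' : ℝ), κ' < Real.pi / 2 → ∀ᶠ t : ℝ in atTop, ∀ y : ℝ, |y| = t →
      ‖Gamma (((N : ℝ) + 1 / 2 : ℝ) + y * I)‖ ≤ Real.exp (-κ' * t) := by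
    intro N
    induction N with
    | zero =>
      intro κ' hκ
      have e1 : Tendsto (fun t : ℝ => Real.exp ((Real.pi / 2 - κ') * t)) atTop atTop :=
        Real.tendsto_exp_atTop.comp (tendsto_id.const_mul_atTop (by linarith))
      filter_upwards [e1.eventually_ge_atTop (√(2 * Real.pi))] with t ht y hy
      have := norm_Gamma_half_add_le y
      simp only [CharP.cast_eq_zero, zero_add, ofReal_div, ofReal_one, ofReal_ofNat]
      refine this.trans ?_
      rw [hy]
      calc _ ≤ Real.exp ((Real.pi / 2 - κ') * t) * Real.exp (-(Real.pi / 2) * t) := by gcongr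
        _ = _ := by rw [← Real.exp_add]; congr 1; ring
    | succ N ih =>
      intro κ' hκ
      obtain ⟨κ₁, h1, h2⟩ := exists_between hκ
      have e1 := (isLittleO_pow_exp_pos_mul_atTop (b := κ₁ - κ') (k := 1) (by linarith)).bound
        (c := 1 / 2) (by norm_num)
      have e2 : Tendsto (fun t : ℝ => Real.exp ((κ₁ - κ') * t)) atTop atTop :=
        Real.tendsto_exp_atTop.comp (tendsto_id.const_mul_atTop (by linarith))
      filter_upwards [ih κ₁ h2, e1, e2.eventually_ge_atTop (2 * (N + 1 / 2)), eventually_gt_atTop 0]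
        with t ht1 ht2 ht3 ht0 y hy
      have hs : (((N + 1 : ℕ) : ℝ) + 1 / 2 : ℝ) + (y : ℂ) * I
          = ((((N : ℝ) + 1 / 2 : ℝ) : ℂ) + y * I) + 1 := by push_cast; ring
      have hne : ((((N : ℝ) + 1 / 2 : ℝ) : ℂ) + y * I) ≠ 0 := by
        intro h
        have := congrArg Complex.re h
        simp only [add_re, ofReal_re, mul_re, I_re, mul_zero, ofReal_im, I_im, mul_one, sub_self,
          add_zero, zero_re] at this
        have hN : (0 : ℝ) ≤ N := N.cast_nonneg
        linarith
      rw [hs, Gamma_add_one _ hne, norm_mul]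
      have hn : ‖((((N : ℝ) + 1 / 2 : ℝ) : ℂ) + y * I)‖ ≤ Real.exp ((κ₁ - κ') * t) := by
        refine (norm_add_le _ _).trans ?_
        rw [norm_mul, norm_I, mul_one, norm_real, norm_real, Real.norm_of_nonneg (by positivity),
          Real.norm_eq_abs, hy]
        rw [Real.norm_of_nonneg (by positivity), Real.norm_of_nonneg (Real.exp_pos _).le,
          pow_one] at ht2
        linarith
      calc _ ≤ Real.exp ((κ₁ - κ') * t) * Real.exp (-κ₁ * t) := by
            gcongr
            exact ht1 y hy
        _ = _ := by rw [← Real.exp_add]; congr 1; ring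
  -- the strips `1 ≤ re s ≤ N + 1/2`
  have key2 : ∀ (X κ' : ℝ), κ' < Real.pi / 2 → ∀ᶠ t : ℝ in atTop, ∀ x ∈ Icc 1 X, ∀ y : ℝ, |y| = t →
      ‖Gamma (x + y * I)‖ ≤ Real.exp (-κ' * t) := by
    intro X κ' hκ
    obtain ⟨κ₁, h1, h2⟩ := exists_between hκ
    obtain ⟨N, hN⟩ := exists_nat_ge (max X 2)
    have hX : (0 : ℝ) < N + 1 / 2 := by positivity
    obtain ⟨C, hC⟩ := (isCompact_Icc (a := 1) (b := X)).exists_bound_of_continuousOn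
      (f := Real.Gamma) fun x hx => (Real.differentiableAt_Gamma fun m => by
        have : (0 : ℝ) ≤ m := m.cast_nonneg
        linarith [hx.1]).continuousAt.continuousWithinAt
    have e2 : Tendsto (fun t : ℝ => Real.exp ((κ₁ - κ') * t)) atTop atTop :=
      Real.tendsto_exp_atTop.comp (tendsto_id.const_mul_atTop (by linarith))
    filter_upwards [key N κ₁ h2, e2.eventually_ge_atTop (C / Real.Gamma (N + 1 / 2))]
      with t ht1 ht2 x hx y hy
    have h3 := norm_Gamma_mul_Gamma_le (x := x) (X := N + 1 / 2) (by linarith [hx.1])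
      (by linarith [hx.2, le_max_left X 2]) y
    have hG := Real.Gamma_pos_of_pos hX
    have hCx : Real.Gamma x ≤ C := (le_abs_self _).trans (hC x hx)
    have hC0 : 0 ≤ C := (norm_nonneg _).trans (hC x hx)
    rw [← le_div_iff₀ hG] at h3
    calc ‖Gamma (x + y * I)‖
        ≤ ‖Gamma (((N : ℝ) + 1 / 2 : ℝ) + y * I)‖ * Real.Gamma x / Real.Gamma (N + 1 / 2) := h3
      _ ≤ Real.exp (-κ₁ * t) * C / Real.Gamma (N + 1 / 2) := by
        gcongr
        · exact (Real.Gamma_pos_of_pos (by linarith [hx.1])).le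
        · exact ht1 y hy
      _ = Real.exp (-κ₁ * t) * (C / Real.Gamma (N + 1 / 2)) := by ring
      _ ≤ Real.exp (-κ₁ * t) * Real.exp ((κ₁ - κ') * t) := by gcongr
      _ = _ := by rw [← Real.exp_add]; congr 1; ring
  -- shifts to the right
  have key3 : ∀ (K : ℕ) (x₁ x₂ κ' : ℝ), κ' < Real.pi / 2 → 1 ≤ x₁ + K → ∀ᶠ t : ℝ in atTop,
      ∀ x ∈ Icc x₁ x₂, ∀ y : ℝ, |y| = t → ‖Gamma (x + y * I)‖ ≤ Real.exp (-κ' * t) := by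
    intro K
    induction K with
    | zero =>
      intro x₁ x₂ κ' hκ h1
      filter_upwards [key2 x₂ κ' hκ] with t ht x hx y hy
      simp only [CharP.cast_eq_zero, add_zero] at h1
      exact ht x ⟨h1.trans hx.1, hx.2⟩ y hy
    | succ K ih =>
      intro x₁ x₂ κ' hκ h1
      filter_upwards [ih (x₁ + 1) (x₂ + 1) κ' hκ (by push_cast at h1; linarith),
        eventually_ge_atTop 1] with t ht ht1 x hx y hy
      have h2 := ht (x + 1) ⟨by linarith [hx.1], by linarith [hx.2]⟩ y hy
      have him : 1 ≤ ‖(x + y * I : ℂ)‖ := by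
        refine le_trans ?_ (abs_im_le_norm _)
        simpa [hy] using ht1
      have hne : (x + y * I : ℂ) ≠ 0 := norm_pos_iff.1 (by linarith)
      have hs : ((x + 1 : ℝ) : ℂ) + y * I = (x + y * I) + 1 := by push_cast; ring
      rw [hs, Gamma_add_one _ hne, norm_mul] at h2
      exact (le_mul_of_one_le_left (norm_nonneg _) him).trans h2
  intro x₁ x₂ κ' hκ
  obtain ⟨K, hK⟩ := exists_nat_ge (1 - x₁)
  exact key3 K x₁ x₂ κ' hκ (by linarith)

lemma stripDecay_sin : StripDecay sin (-1) := by
  intro x₁ x₂ κ' hκ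
  filter_upwards [eventually_ge_atTop 0] with t ht x _ y hy
  refine (norm_sin_le_exp _).trans (Real.exp_le_exp.2 ?_)
  simp only [add_im, ofReal_im, mul_im, ofReal_re, I_im, mul_one, I_re, mul_zero, add_zero,
    zero_add, hy]
  nlinarith

lemma sin_pi_mul_ne_zero_of_im_ne_zero {s : ℂ} (hs : s.im ≠ 0) : sin (Real.pi * s) ≠ 0 := by
  rw [Ne, sin_eq_zero_iff]
  rintro ⟨k, hk⟩
  have := congrArg Complex.im hk
  simp at this
  exact hs this

lemma Gamma_inv_eq {s : ℂ} (hs : sin (Real.pi * s) ≠ 0) :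
    (Gamma s)⁻¹ = Gamma (1 - s) * sin (Real.pi * s) * (Real.pi : ℂ)⁻¹ := by
  have h := Gamma_mul_Gamma_one_sub s
  have hpi : (Real.pi : ℂ) ≠ 0 := by exact_mod_cast Real.pi_ne_zero
  have hG : Gamma s ≠ 0 := by
    intro h0
    rw [h0, zero_mul] at h
    exact div_ne_zero hpi hs h.symm
  field_simp
  rw [h]
  field_simp

lemma stripDecay_Gamma_inv : StripDecay (fun s => (Gamma s)⁻¹) (-(Real.pi / 2)) := by
  have h1 : StripDecay (fun s => Gamma (1 + (-1 : ℝ) * s)) (|(-1 : ℝ)| * (Real.pi / 2)) :=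
    stripDecay_Gamma.comp_affine 1 (by norm_num)
  have h2 : StripDecay (fun s => sin (0 + Real.pi * s)) (|Real.pi| * (-1)) :=
    stripDecay_sin.comp_affine 0 Real.pi_ne_zero
  have h3 : StripDecay (fun _ => (Real.pi : ℂ)⁻¹) 0 := stripDecay_of_bound fun _ => le_rfl
  have h4 := (h1.mul h2).mul h3
  rw [abs_neg, abs_one, one_mul, abs_of_pos Real.pi_pos] at h4
  have h5 : Real.pi / 2 + Real.pi * -1 + 0 = -(Real.pi / 2) := by ring
  rw [h5] at h4
  refine h4.congr fun s hs => ?_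
  rw [Gamma_inv_eq (sin_pi_mul_ne_zero_of_im_ne_zero hs)]
  simp only [ofReal_neg, ofReal_one, zero_add, neg_mul, one_mul, ← sub_eq_add_neg]

/-! ### Growth of the Gamma function on half-strips -/

/-- Stirling's formula along an arithmetic progression. -/
lemma eventually_abs_log_Gamma_affine_sub_le (a : ℝ) {A : ℝ} (hA : 0 < A) {ε : ℝ} (hε : 0 < ε) :
    ∀ᶠ x : ℝ in atTop, |Real.log (Real.Gamma (a + A * x)) -
      (A * (x * Real.log x) + (A * Real.log A - A) * x)| ≤ ε * x := by
  obtain ⟨K, hK⟩ := exists_abs_log_Gamma_sub_le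
  have hinv : Tendsto (fun x : ℝ => a / x) atTop (𝓝 0) := tendsto_const_nhds.div_atTop tendsto_id
  have hlog : Tendsto (fun x : ℝ => Real.log x / x) atTop (𝓝 0) :=
    Real.isLittleO_log_id_atTop.tendsto_div_nhds_zero
  have hAx : Tendsto (fun x : ℝ => A + a / x) atTop (𝓝 A) := by
    simpa using hinv.const_add A
  have hAlog : Tendsto (fun x : ℝ => Real.log (A + a / x)) atTop (𝓝 (Real.log A)) :=
    (Real.continuousAt_log hA.ne').tendsto.comp hAx
  have t1 : Tendsto (fun x : ℝ => a * (Real.log x / x) + ((A + a / x) * Real.log (A + a / x)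
      - A * Real.log A) - a / x) atTop (𝓝 0) := by
    simpa using ((hlog.const_mul a).add ((hAx.mul hAlog).sub_const (A * Real.log A))).sub hinv
  have t2 : Tendsto (fun x : ℝ => 2 * (Real.log x / x) + 2 * Real.log (A + a / x) / x + K / x)
      atTop (𝓝 0) := by
    simpa using ((hlog.const_mul 2).add ((hAlog.const_mul 2).div_atTop tendsto_id)).add
      (tendsto_const_nhds (x := K).div_atTop tendsto_id)
  have hu : Tendsto (fun x : ℝ => a + A * x) atTop atTop :=
    tendsto_atTop_add_const_left _ _ (tendsto_id.const_mul_atTop hA)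
  filter_upwards [eventually_gt_atTop 0, hu.eventually_ge_atTop 2,
    t1.eventually (Metric.ball_mem_nhds 0 (half_pos hε)),
    t2.eventually (Metric.ball_mem_nhds 0 (half_pos hε))] with x hx h2 h3 h4
  rw [dist_zero_right, Real.norm_eq_abs] at h3 h4
  have h5 := hK _ h2
  have hux : a + A * x = x * (A + a / x) := by field_simp; ring
  have hpos : 0 < A + a / x := by
    by_contra hneg
    have := mul_nonpos_of_nonneg_of_nonpos hx.le (not_lt.1 hneg)
    linarith
  have hlu : Real.log (a + A * x) = Real.log x + Real.log (A + a / x) := by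
    rw [hux, Real.log_mul hx.ne' hpos.ne']
  have e1 : (a + A * x) * Real.log (a + A * x) - (a + A * x)
      - (A * (x * Real.log x) + (A * Real.log A - A) * x)
      = x * (a * (Real.log x / x) + ((A + a / x) * Real.log (A + a / x)
      - A * Real.log A) - a / x) := by
    rw [hlu]; field_simp; ring
  have e2 : 2 * Real.log (a + A * x) + K
      = x * (2 * (Real.log x / x) + 2 * Real.log (A + a / x) / x + K / x) := by
    rw [hlu]; field_simp
  set T1 := a * (Real.log x / x) + ((A + a / x) * Real.log (A + a / x)
      - A * Real.log A) - a / x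
  set T2 := 2 * (Real.log x / x) + 2 * Real.log (A + a / x) / x + K / x
  rw [abs_lt] at h3 h4
  rw [e2] at h5
  rw [abs_le] at h5 ⊢
  have m1 := mul_lt_mul_of_pos_left h3.1 hx
  have m2 := mul_lt_mul_of_pos_left h3.2 hx
  have m3 := mul_lt_mul_of_pos_left h4.2 hx
  constructor <;> linarith

lemma norm_Gamma_le_Gamma_re {s : ℂ} (hs : 0 < s.re) : ‖Gamma s‖ ≤ Real.Gamma s.re := by
  rw [Gamma_eq_integral hs, Real.Gamma_eq_integral hs, GammaIntegral]
  refine (norm_integral_le_integral_norm _).trans (le_of_eq ?_)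
  refine setIntegral_congr_fun measurableSet_Ioi fun x hx => ?_
  rw [norm_mul, norm_real, Real.norm_of_nonneg (Real.exp_pos _).le,
    norm_cpow_eq_rpow_re_of_pos hx]
  simp

lemma add_mul_eq_re_add_im (b : ℂ) (A x y : ℝ) :
    b + A * (x + y * I) = ((b.re + A * x : ℝ) : ℂ) + ((b.im + A * y : ℝ) : ℂ) * I := by
  apply Complex.ext <;> simp

lemma horizontalGrowth_Gamma (Y : Set ℝ) (b : ℂ) {A : ℝ} (hA : 0 < A) :
    HorizontalGrowth Y (fun s => Gamma (b + A * s)) (-A) (A * Real.log A - A) := by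
  intro κ' hκ
  have hu : Tendsto (fun x : ℝ => b.re + A * x) atTop atTop :=
    tendsto_atTop_add_const_left _ _ (tendsto_id.const_mul_atTop hA)
  filter_upwards [eventually_abs_log_Gamma_affine_sub_le b.re hA (sub_pos.2 hκ),
    hu.eventually_gt_atTop 0] with x h1 h2 y _
  have h3 : (b + A * (x + y * I)).re = b.re + A * x := by simp
  refine (norm_Gamma_le_Gamma_re (h3 ▸ h2)).trans ?_
  rw [h3, ← Real.log_le_iff_le_exp (Real.Gamma_pos_of_pos h2)]
  linarith [(abs_le.1 h1).2]

lemma exists_pos_le_norm_Gamma_one_add {Y : Set ℝ} (hY : IsCompact Y) :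
    ∃ c : ℝ, 0 < c ∧ ∀ y ∈ Y, c ≤ ‖Gamma (1 + y * I)‖ := by
  rcases Y.eq_empty_or_nonempty with rfl | hne
  · exact ⟨1, one_pos, by simp⟩
  have hpos : ∀ y : ℝ, 0 < (1 + y * I : ℂ).re := by simp
  have hc : Continuous fun y : ℝ => ‖Gamma (1 + y * I)‖ := by
    refine Continuous.norm (continuous_iff_continuousAt.2 fun y => ?_)
    refine ContinuousAt.comp (f := fun y : ℝ => (1 + y * I : ℂ)) (g := Gamma) ?_ (by fun_prop)
    refine (differentiableAt_Gamma _ fun m h => ?_).continuousAt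
    have h1 := congrArg Complex.re h
    have h2 : (0 : ℝ) ≤ m := m.cast_nonneg
    simp at h1
    linarith
  obtain ⟨y₀, -, hy₀⟩ := hY.exists_isMinOn hne hc.continuousOn
  exact ⟨_, norm_pos_iff.2 (Gamma_ne_zero_of_re_pos (hpos y₀)), fun y hy => hy₀ hy⟩

lemma horizontalGrowth_Gamma_inv {Y : Set ℝ} (hY : IsCompact Y) (b : ℂ) {A : ℝ} (hA : 0 < A) :
    HorizontalGrowth Y (fun s => (Gamma (b + A * s))⁻¹) A (A - A * Real.log A) := by
  intro κ' hκ
  obtain ⟨c, hc, hcY⟩ := exists_pos_le_norm_Gamma_one_add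
    (hY.image (f := fun y => b.im + A * y) (by fun_prop))
  have hu : Tendsto (fun x : ℝ => b.re + A * x) atTop atTop :=
    tendsto_atTop_add_const_left _ _ (tendsto_id.const_mul_atTop hA)
  have hε : 0 < (κ' - (A - A * Real.log A)) / 2 := by linarith
  have he : Tendsto (fun x : ℝ => (κ' - (A - A * Real.log A)) / 2 * x) atTop atTop :=
    tendsto_id.const_mul_atTop hε
  filter_upwards [eventually_abs_log_Gamma_affine_sub_le b.re hA hε,
    hu.eventually_ge_atTop 1, he.eventually_ge_atTop (-Real.log c)] with x h1 h2 h3 y hy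
  have hGp := Real.Gamma_pos_of_pos (zero_lt_one.trans_le h2)
  have h4 := norm_Gamma_mul_Gamma_le one_pos h2 (b.im + A * y)
  have h5 : c ≤ ‖Gamma ((1 : ℝ) + ((b.im + A * y : ℝ) : ℂ) * I)‖ := by
    simpa using hcY _ ⟨y, hy, rfl⟩
  rw [Real.Gamma_one, mul_one, ← add_mul_eq_re_add_im] at h4
  have h6 : c * Real.Gamma (b.re + A * x) ≤ ‖Gamma (b + A * (x + y * I))‖ :=
    (mul_le_mul_of_nonneg_right h5 hGp.le).trans h4
  have h7 : 0 < c * Real.Gamma (b.re + A * x) := by positivity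
  rw [norm_inv]
  refine (inv_anti₀ h7 h6).trans ?_
  rw [← Real.log_le_iff_le_exp (by positivity), Real.log_inv, Real.log_mul hc.ne' hGp.ne']
  linarith [(abs_le.1 h1).1]

lemma Gamma_inv_eq_of_re_lt_one {s : ℂ} (hs : s.re < 1) :
    (Gamma s)⁻¹ = Gamma (1 - s) * (sin (Real.pi * s) * (Real.pi : ℂ)⁻¹) := by
  by_cases h : sin (Real.pi * s) = 0
  · have h1 := Gamma_mul_Gamma_one_sub s
    rw [h, div_zero, mul_eq_zero] at h1
    have h2 : Gamma (1 - s) ≠ 0 := Gamma_ne_zero_of_re_pos (by simpa using hs)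
    rw [h1.resolve_right h2, h]
    simp
  · rw [Gamma_inv_eq h, mul_assoc]

lemma horizontalGrowth_Gamma_neg_inv {Y : Set ℝ} (hY : IsCompact Y) (b : ℂ) {A : ℝ} (hA : 0 < A) :
    HorizontalGrowth Y (fun s => (Gamma (b - A * s))⁻¹) (-A) (A * Real.log A - A) := by
  obtain ⟨C, hC⟩ := hY.exists_bound_of_continuousOn
    (f := fun y : ℝ => Real.exp |Real.pi * (b.im - A * y)|) (by fun_prop)
  have h1 := (horizontalGrowth_Gamma Y (1 - b) hA).mul (horizontalGrowth_of_bound (Y := Y)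
    (f := fun s => sin (Real.pi * (b - A * s)) * (Real.pi : ℂ)⁻¹)
    (C := C * ‖(Real.pi : ℂ)⁻¹‖) (Eventually.of_forall fun x y hy => ?_))
  · rw [add_zero, add_zero] at h1
    have hu : Tendsto (fun x : ℝ => (1 - b).re + A * x) atTop atTop :=
      tendsto_atTop_add_const_left _ _ (tendsto_id.const_mul_atTop hA)
    refine h1.congr ?_
    filter_upwards [hu.eventually_gt_atTop 0] with x hx y _
    have hre : (b - A * (x + y * I)).re < 1 := by
      simp at hx ⊢
      linarith
    rw [Gamma_inv_eq_of_re_lt_one hre]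
    congr 2; ring
  · rw [norm_mul]
    gcongr
    refine (norm_sin_le_exp _).trans ?_
    have h2 : (Real.pi * (b - A * (x + y * I)) : ℂ).im = Real.pi * (b.im - A * y) := by simp
    rw [h2]
    exact (le_abs_self _).trans (hC y hy)

lemma horizontalGrowth_Gamma_neg {Y : Set ℝ} (hY : IsCompact Y) (b : ℂ) {B : ℝ} (hB : 0 < B)
    (hbY : ∀ y ∈ Y, b.im - B * y ≠ 0) :
    HorizontalGrowth Y (fun s => Gamma (b - B * s)) B (B - B * Real.log B) := by
  have hne : ∀ y ∈ Y, |Real.sinh (Real.pi * (b.im - B * y))| ≠ 0 := fun y hy =>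
    abs_ne_zero.2 (Real.sinh_eq_zero.not.2 (mul_ne_zero Real.pi_ne_zero (hbY y hy)))
  obtain ⟨C, hC⟩ := hY.exists_bound_of_continuousOn
    (f := fun y : ℝ => |Real.sinh (Real.pi * (b.im - B * y))|⁻¹)
    (ContinuousOn.inv₀ (by fun_prop) hne)
  have him : ∀ x y : ℝ, (Real.pi * (b - B * (x + y * I)) : ℂ).im = Real.pi * (b.im - B * y) := by
    intro x y; simp
  have h1 := (horizontalGrowth_Gamma_inv hY (1 - b) hB).mul (horizontalGrowth_of_bound (Y := Y)
    (f := fun s => Real.pi * (sin (Real.pi * (b - B * s)))⁻¹)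
    (C := ‖(Real.pi : ℂ)‖ * C) (Eventually.of_forall fun x y hy => ?_))
  · rw [add_zero, add_zero] at h1
    refine h1.congr (Eventually.of_forall fun x y hy => ?_)
    have h2 : sin (Real.pi * (b - B * (x + y * I))) ≠ 0 := by
      rw [← norm_ne_zero_iff]
      refine ne_of_gt (lt_of_lt_of_le ?_ (abs_sinh_im_le_norm_sin _))
      rw [him]
      exact lt_of_le_of_ne (abs_nonneg _) (hne y hy).symm
    have h3 := congrArg Inv.inv (Gamma_inv_eq h2)
    rw [inv_inv, mul_inv, mul_inv, inv_inv] at h3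
    rw [h3]
    rw [show 1 - (b - B * (x + y * I)) = 1 - b + B * (x + y * I) by ring]
    ring
  · rw [norm_mul, norm_inv]
    gcongr
    have h2 := abs_sinh_im_le_norm_sin (Real.pi * (b - B * (x + y * I)))
    rw [him] at h2
    have h3 := hC y hy
    rw [Real.norm_of_nonneg (by positivity)] at h3
    exact (inv_anti₀ (lt_of_le_of_ne (abs_nonneg _) (hne y hy).symm) h2).trans h3

/-! ### The poles and the growth of the integrand -/

lemma stripDecay_const_cpow {z : ℂ} (hz : z ≠ 0) : StripDecay (fun s => z ^ s) (-|z.arg|) := by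
  intro x₁ x₂ κ' hκ
  obtain ⟨C, hC⟩ := (isCompact_Icc (a := x₁) (b := x₂)).exists_bound_of_continuousOn
    (f := fun x : ℝ => Real.exp (Real.log ‖z‖ * x)) (by fun_prop)
  have e2 : Tendsto (fun t : ℝ => Real.exp ((-|z.arg| - κ') * t)) atTop atTop :=
    Real.tendsto_exp_atTop.comp (tendsto_id.const_mul_atTop (by linarith))
  filter_upwards [e2.eventually_ge_atTop C] with t ht x hx y hy
  rw [cpow_def_of_ne_zero hz, norm_exp]
  have h1 : (log z * (x + y * I)).re = Real.log ‖z‖ * x + -(z.arg * y) := by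
    simp [log_re, log_im]; ring
  have h2 : -(z.arg * y) ≤ |z.arg| * t := by
    rw [← hy, ← abs_mul]
    exact neg_le_abs _
  rw [h1, Real.exp_add]
  calc _ ≤ Real.exp ((-|z.arg| - κ') * t) * Real.exp (|z.arg| * t) := by
        refine mul_le_mul ?_ (Real.exp_le_exp.2 h2) (Real.exp_pos _).le (Real.exp_pos _).le
        exact ((le_abs_self _).trans (hC x hx)).trans ht
    _ = _ := by rw [← Real.exp_add]; congr 1; ring

lemma horizontalGrowth_const_cpow {Y : Set ℝ} (hY : IsCompact Y) {z : ℂ} (hz : z ≠ 0) :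
    HorizontalGrowth Y (fun s => z ^ s) 0 (Real.log ‖z‖) := by
  intro κ' hκ
  obtain ⟨C, hC⟩ := hY.exists_bound_of_continuousOn
    (f := fun y : ℝ => Real.exp (-(z.arg * y))) (by fun_prop)
  have e2 : Tendsto (fun t : ℝ => Real.exp ((κ' - Real.log ‖z‖) * t)) atTop atTop :=
    Real.tendsto_exp_atTop.comp (tendsto_id.const_mul_atTop (by linarith))
  filter_upwards [e2.eventually_ge_atTop C] with x hx y hy
  rw [cpow_def_of_ne_zero hz, norm_exp]
  have h1 : (log z * (x + y * I)).re = Real.log ‖z‖ * x + -(z.arg * y) := by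
    simp [log_re, log_im]; ring
  rw [h1, Real.exp_add]
  calc _ ≤ Real.exp (Real.log ‖z‖ * x) * Real.exp ((κ' - Real.log ‖z‖) * x) := by
        refine mul_le_mul_of_nonneg_left ?_ (Real.exp_pos _).le
        exact ((le_abs_self _).trans (hC y hy)).trans hx
    _ = _ := by rw [← Real.exp_add]; congr 1; ring

namespace FoxParams

variable {m n p q : ℕ} {P : FoxParams m n p q}

lemma stripDecay_theta (hP : P.Valid) : StripDecay P.theta (Real.pi * P.Omega / 2) := by
  have hB : ∀ j ∈ (Finset.univ : Finset (Fin q)), StripDecay (fun s => if (j : ℕ) < m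
      then Gamma (P.b j - P.B j * s) else (Gamma (1 - P.b j + P.B j * s))⁻¹)
      (if (j : ℕ) < m then P.B j * (Real.pi / 2) else -(P.B j * (Real.pi / 2))) := by
    intro j _
    have hj := hP.B_pos j
    split_ifs
    · have := stripDecay_Gamma.comp_affine (P.b j) (B := -P.B j) (by linarith)
      rw [abs_neg, abs_of_pos hj] at this
      simpa only [ofReal_neg, neg_mul, ← sub_eq_add_neg] using this
    · have := stripDecay_Gamma_inv.comp_affine (1 - P.b j) (B := P.B j) hj.ne'
      rw [abs_of_pos hj] at this
      simpa only [mul_neg] using this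
  have hA : ∀ i ∈ (Finset.univ : Finset (Fin p)), StripDecay (fun s => if (i : ℕ) < n
      then Gamma (1 - P.a i + P.A i * s) else (Gamma (P.a i - P.A i * s))⁻¹)
      (if (i : ℕ) < n then P.A i * (Real.pi / 2) else -(P.A i * (Real.pi / 2))) := by
    intro i _
    have hi := hP.A_pos i
    split_ifs
    · have := stripDecay_Gamma.comp_affine (1 - P.a i) (B := P.A i) hi.ne'
      rwa [abs_of_pos hi] at this
    · have := stripDecay_Gamma_inv.comp_affine (P.a i) (B := -P.A i) (by linarith)
      rw [abs_neg, abs_of_pos hi] at this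
      simpa only [ofReal_neg, neg_mul, mul_neg, ← sub_eq_add_neg] using this
  have h := (StripDecay.prod Finset.univ hB).mul (StripDecay.prod Finset.univ hA)
  have hO : Real.pi * P.Omega / 2 =
      (∑ j : Fin q, if (j : ℕ) < m then P.B j * (Real.pi / 2) else -(P.B j * (Real.pi / 2))) +
      ∑ i : Fin p, if (i : ℕ) < n then P.A i * (Real.pi / 2) else -(P.A i * (Real.pi / 2)) := by
    have h1 : ∀ x : ℝ, Real.pi * x / 2 = x * (Real.pi / 2) := fun x => by ring
    rw [h1, Omega, add_comm, add_mul, Finset.sum_mul, Finset.sum_mul]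
    simp only [ite_mul, neg_mul]
  rw [hO]
  exact h

lemma horizontalGrowth_theta (hP : P.Valid) {Y : Set ℝ} (hY : IsCompact Y)
    (hbY : ∀ j : Fin q, (j : ℕ) < m → ∀ y ∈ Y, (P.b j).im - P.B j * y ≠ 0) :
    HorizontalGrowth Y P.theta P.Delta (P.Delta - Real.log P.delta) := by
  have hB : ∀ j ∈ (Finset.univ : Finset (Fin q)), HorizontalGrowth Y (fun s => if (j : ℕ) < m
      then Gamma (P.b j - P.B j * s) else (Gamma (1 - P.b j + P.B j * s))⁻¹)
      (P.B j) (P.B j - P.B j * Real.log (P.B j)) := by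
    intro j _
    split_ifs with hj
    · exact horizontalGrowth_Gamma_neg hY _ (hP.B_pos j) (hbY j hj)
    · exact horizontalGrowth_Gamma_inv hY _ (hP.B_pos j)
  have hA : ∀ i ∈ (Finset.univ : Finset (Fin p)), HorizontalGrowth Y (fun s => if (i : ℕ) < n
      then Gamma (1 - P.a i + P.A i * s) else (Gamma (P.a i - P.A i * s))⁻¹)
      (-P.A i) (P.A i * Real.log (P.A i) - P.A i) := by
    intro i _
    split_ifs
    · exact horizontalGrowth_Gamma Y _ (hP.A_pos i)
    · exact horizontalGrowth_Gamma_neg_inv hY _ (hP.A_pos i)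
  have h := (HorizontalGrowth.prod Finset.univ hB).mul (HorizontalGrowth.prod Finset.univ hA)
  have hD : P.Delta = (∑ j, P.B j) + ∑ i, -P.A i := by
    rw [Delta, Finset.sum_neg_distrib, sub_eq_add_neg]
  have hd : Real.log P.delta = -(∑ i, P.A i * Real.log (P.A i)) + ∑ j, P.B j * Real.log (P.B j) := by
    have h1 : ∀ i, 0 < P.A i ^ (-P.A i) := fun i => Real.rpow_pos_of_pos (hP.A_pos i) _
    have h2 : ∀ j, 0 < P.B j ^ P.B j := fun j => Real.rpow_pos_of_pos (hP.B_pos j) _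
    rw [delta, Real.log_mul (Finset.prod_ne_zero_iff.2 fun i _ => (h1 i).ne')
      (Finset.prod_ne_zero_iff.2 fun i _ => (h2 i).ne'), Real.log_prod fun i _ => (h1 i).ne',
      Real.log_prod fun i _ => (h2 i).ne', ← Finset.sum_neg_distrib]
    congr 1
    · exact Finset.sum_congr rfl fun i _ => by rw [Real.log_rpow (hP.A_pos i)]; ring
    · exact Finset.sum_congr rfl fun i _ => by rw [Real.log_rpow (hP.B_pos i)]
  rw [← hD] at h
  have hκ : P.Delta - Real.log P.delta = (∑ j, (P.B j - P.B j * Real.log (P.B j))) +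
      ∑ i, (P.A i * Real.log (P.A i) - P.A i) := by
    rw [hd, Delta, Finset.sum_sub_distrib, Finset.sum_sub_distrib]; ring
  rw [hκ]
  exact h

variable (P) in
/-- The integrand of the Mellin-Barnes integral. -/
noncomputable def integrand (z s : ℂ) : ℂ := P.theta s * z ^ s

lemma LineCase.exists_stripDecay (hP : P.Valid) {z : ℂ} (hz : z ≠ 0) (h : P.LineCase z) :
    ∃ κ, 0 < κ ∧ StripDecay (P.integrand z) κ :=
  ⟨_, by linarith [h.2], (stripDecay_theta hP).mul (stripDecay_const_cpow hz)⟩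

lemma LoopCase.exists_decay (hP : P.Valid) {z : ℂ} (hz : z ≠ 0) (h : P.LoopCase z) {Y : Set ℝ}
    (hY : IsCompact Y)
    (hbY : ∀ j : Fin q, (j : ℕ) < m → ∀ y ∈ Y, (P.b j).im - P.B j * y ≠ 0) :
    ∃ κ, 0 < κ ∧ ∀ᶠ x : ℝ in atTop, ∀ y ∈ Y, ‖P.integrand z (x + y * I)‖ ≤ Real.exp (-κ * x) := by
  have hg := (horizontalGrowth_theta hP hY hbY).mul (horizontalGrowth_const_cpow hY hz)
  rw [add_zero] at hg
  set κ₀ := P.Delta - Real.log P.delta + Real.log ‖z‖ with hκ₀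
  rcases h with h | ⟨h, hzd⟩
  · refine ⟨1, one_pos, ?_⟩
    have hl : Tendsto (fun x : ℝ => P.Delta * Real.log x) atTop atTop :=
      Real.tendsto_log_atTop.const_mul_atTop h
    filter_upwards [hg (κ₀ + 1) (by linarith), hl.eventually_ge_atTop (κ₀ + 2),
      eventually_ge_atTop 0] with x h1 h2 h3 y hy
    refine (h1 y hy).trans (Real.exp_le_exp.2 ?_)
    nlinarith
  · have hlog : Real.log ‖z‖ < Real.log P.delta := Real.log_lt_log (norm_pos_iff.2 hz) hzd
    rw [h, zero_sub] at hκ₀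
    refine ⟨-κ₀ / 2, by linarith, ?_⟩
    filter_upwards [hg (κ₀ / 2) (by linarith)] with x h1 y hy
    refine (h1 y hy).trans (Real.exp_le_exp.2 (le_of_eq ?_))
    rw [h]; ring

lemma meromorphic_theta : Meromorphic P.theta := by
  intro s
  have hG : ∀ g : ℂ → ℂ, AnalyticAt ℂ g s → MeromorphicAt (fun s => Gamma (g s)) s := fun g hg =>
    (Meromorphic.Gamma (g s)).comp_analyticAt hg
  refine MeromorphicAt.mul (MeromorphicAt.fun_prod fun j _ => ?_)
    (MeromorphicAt.fun_prod fun i _ => ?_)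
  · split_ifs
    · exact hG _ (by fun_prop)
    · exact (hG _ (by fun_prop)).inv
  · split_ifs
    · exact hG _ (by fun_prop)
    · exact (hG _ (by fun_prop)).inv

lemma differentiableAt_theta (hP : P.Valid) {s : ℂ} (hl : s ∉ P.leftPoles) (hr : s ∉ P.rightPoles) :
    DifferentiableAt ℂ P.theta s := by
  refine DifferentiableAt.mul (DifferentiableAt.fun_finsetProd fun j _ => ?_)
    (DifferentiableAt.fun_finsetProd fun i _ => ?_)
  · split_ifs with hj
    · refine DifferentiableAt.comp (f := fun s => P.b j - P.B j * s) s (differentiableAt_Gamma _ ?_)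
        (by fun_prop)
      intro k hk
      refine hr ⟨j, hj, k, ?_⟩
      have hB : (P.B j : ℂ) ≠ 0 := by exact_mod_cast (hP.B_pos j).ne'
      rw [eq_div_iff hB]
      linear_combination -hk
    · exact DifferentiableAt.comp (f := fun s => 1 - P.b j + P.B j * s) s
        differentiable_one_div_Gamma.differentiableAt (by fun_prop)
  · split_ifs with hi
    · refine DifferentiableAt.comp (f := fun s => 1 - P.a i + P.A i * s) s
        (differentiableAt_Gamma _ ?_) (by fun_prop)
      intro k hk
      refine hl ⟨i, hi, k, ?_⟩
      have hA : (P.A i : ℂ) ≠ 0 := by exact_mod_cast (hP.A_pos i).ne'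
      rw [eq_div_iff hA]
      linear_combination hk
    · exact DifferentiableAt.comp (f := fun s => P.a i - P.A i * s) s
        differentiable_one_div_Gamma.differentiableAt (by fun_prop)

lemma differentiableAt_integrand (hP : P.Valid) {z s : ℂ} (hz : z ≠ 0) (hl : s ∉ P.leftPoles)
    (hr : s ∉ P.rightPoles) : DifferentiableAt ℂ (P.integrand z) s :=
  (differentiableAt_theta hP hl hr).mul (differentiableAt_id.const_cpow (Or.inl hz))

lemma meromorphic_integrand {z : ℂ} (hz : z ≠ 0) : Meromorphic (P.integrand z) := fun s =>
  (meromorphic_theta s).mul (analyticAt_iff_eventually_differentiableAt.2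
    (Eventually.of_forall fun _ => differentiableAt_id.const_cpow (Or.inl hz))).meromorphicAt

lemma finite_leftPoles (hP : P.Valid) (c : ℝ) : {s ∈ P.leftPoles | c ≤ s.re}.Finite := by
  have : {s ∈ P.leftPoles | c ≤ s.re} ⊆ ⋃ i : Fin p, (fun k : ℕ => (P.a i - 1 - k) / (P.A i : ℂ)) ''
      Iic ⌊(P.a i).re - 1 - c * P.A i⌋₊ := by
    rintro s ⟨⟨i, -, k, rfl⟩, hc⟩
    refine mem_iUnion.2 ⟨i, k, Nat.le_floor ?_, rfl⟩
    rw [div_ofReal_re, le_div_iff₀ (hP.A_pos i)] at hc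
    simp at hc
    linarith
  exact (finite_iUnion fun i => (finite_Iic _).image _).subset this

lemma finite_rightPoles (hP : P.Valid) (c : ℝ) : {s ∈ P.rightPoles | s.re ≤ c}.Finite := by
  have : {s ∈ P.rightPoles | s.re ≤ c} ⊆ ⋃ j : Fin q, (fun k : ℕ => (P.b j + k) / (P.B j : ℂ)) ''
      Iic ⌊c * P.B j - (P.b j).re⌋₊ := by
    rintro s ⟨⟨j, -, k, rfl⟩, hc⟩
    refine mem_iUnion.2 ⟨j, k, Nat.le_floor ?_, rfl⟩
    rw [div_ofReal_re, div_le_iff₀ (hP.B_pos j)] at hc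
    simp at hc
    linarith
  exact (finite_iUnion fun i => (finite_Iic _).image _).subset this

lemma finite_im_leftPoles : (Complex.im '' P.leftPoles).Finite := by
  refine (finite_range fun i => (P.a i / (P.A i : ℂ)).im).subset ?_
  rintro _ ⟨s, ⟨i, -, k, rfl⟩, rfl⟩
  exact ⟨i, by simp [div_ofReal_im]⟩

lemma finite_im_rightPoles : (Complex.im '' P.rightPoles).Finite := by
  refine (finite_range fun j => (P.b j / (P.B j : ℂ)).im).subset ?_
  rintro _ ⟨s, ⟨j, -, k, rfl⟩, rfl⟩
  exact ⟨j, by simp [div_ofReal_im]⟩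

lemma exists_re_leftPoles_le (hP : P.Valid) : ∃ R : ℝ, ∀ s ∈ P.leftPoles, s.re ≤ R := by
  obtain ⟨R, hR⟩ := (finite_range fun i => ((P.a i).re - 1) / P.A i).bddAbove
  refine ⟨R, ?_⟩
  rintro s ⟨i, -, k, rfl⟩
  refine le_trans ?_ (hR ⟨i, rfl⟩)
  rw [div_ofReal_re]
  exact div_le_div_of_nonneg_right (by simp) (hP.A_pos i).le

lemma disjoint_poles (hP : P.Valid) : Disjoint P.leftPoles P.rightPoles := by
  rw [Set.disjoint_left]
  rintro s ⟨i, hi, k, rfl⟩ ⟨j, hj, l, h⟩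
  have hA : (P.A i : ℂ) ≠ 0 := by exact_mod_cast (hP.A_pos i).ne'
  have hB : (P.B j : ℂ) ≠ 0 := by exact_mod_cast (hP.B_pos j).ne'
  rw [div_eq_div_iff hA hB] at h
  refine hP.poles_ne i hi j hj l k ?_
  linear_combination -h

end FoxParams

/-! ### Independence of the contour -/

/-- `f` decays exponentially as `re s → +∞`, uniformly for `im s ∈ Y`. -/
def HorizontalDecay (Y : Set ℝ) (f : ℂ → ℂ) (κ : ℝ) : Prop :=
  ∀ᶠ x : ℝ in atTop, ∀ y ∈ Y, ‖f (x + y * I)‖ ≤ Real.exp (-κ * x)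

lemma HorizontalDecay.mono {Y Z : Set ℝ} {f : ℂ → ℂ} {κ : ℝ} (h : HorizontalDecay Y f κ)
    (hZ : Z ⊆ Y) : HorizontalDecay Z f κ :=
  Eventually.mono h fun _ hx y hy => hx y (hZ hy)

lemma continuousAt_comp_vertical {f : ℂ → ℂ} {c y : ℝ} (hf : ContinuousAt f (c + y * I)) :
    ContinuousAt (fun y : ℝ => f (c + y * I)) y :=
  ContinuousAt.comp (f := fun y : ℝ => (c + y * I : ℂ)) hf (by fun_prop)

lemma continuousAt_comp_horizontal {f : ℂ → ℂ} {x h : ℝ} (hf : ContinuousAt f (x + h * I)) :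
    ContinuousAt (fun x : ℝ => f (x + h * I)) x :=
  ContinuousAt.comp (f := fun x : ℝ => (x + h * I : ℂ)) hf (by fun_prop)

lemma StripDecay.integrable {f : ℂ → ℂ} {κ : ℝ} (hf : StripDecay f κ) (hκ : 0 < κ) {c : ℝ}
    (hc : ∀ y : ℝ, ContinuousAt f (c + y * I)) : Integrable fun y : ℝ => f (c + y * I) := by
  have hcont : Continuous fun y : ℝ => f (c + y * I) :=
    continuous_iff_continuousAt.2 fun y => continuousAt_comp_vertical (hc y)
  have hd := hf c c (κ / 2) (by linarith)
  refine hcont.locallyIntegrable.integrable_of_isBigO_atBot_atTop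
    (g := fun y => Real.exp (κ / 2 * y)) (g' := fun y => Real.exp (-(κ / 2) * y)) ?_
    ⟨Iic 0, Iic_mem_atBot 0, integrableOn_exp_mul_Iic (by linarith) 0⟩ ?_
    ⟨Ioi 0, Ioi_mem_atTop 0, integrableOn_exp_mul_Ioi (by linarith) 0⟩
  · refine Asymptotics.IsBigO.of_bound 1 ?_
    filter_upwards [tendsto_neg_atBot_atTop.eventually hd, eventually_lt_atBot 0] with y h1 h2
    rw [one_mul, Real.norm_of_nonneg (Real.exp_pos _).le]
    refine (h1 c ⟨le_rfl, le_rfl⟩ y (abs_of_neg h2)).trans (le_of_eq ?_)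
    congr 1; ring
  · refine Asymptotics.IsBigO.of_bound 1 ?_
    filter_upwards [hd, eventually_gt_atTop 0] with y h1 h2
    rw [one_mul, Real.norm_of_nonneg (Real.exp_pos _).le]
    exact h1 c ⟨le_rfl, le_rfl⟩ y (abs_of_pos h2)

lemma HorizontalDecay.integrableOn {f : ℂ → ℂ} {κ h : ℝ} (hf : HorizontalDecay {h} f κ)
    (hκ : 0 < κ) {c : ℝ} (hc : ∀ x : ℝ, c ≤ x → ContinuousAt f (x + h * I)) :
    IntegrableOn (fun x : ℝ => f (x + h * I)) (Ioi c) := by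
  have hcont : ContinuousOn (fun x : ℝ => f (x + h * I)) (Ici c) := fun x hx =>
    (continuousAt_comp_horizontal (hc x hx)).continuousWithinAt
  refine (hcont.locallyIntegrableOn measurableSet_Ici).integrableOn_of_isBigO_atTop
    (g := fun y => Real.exp (-κ * y)) ?_
    ⟨Ioi 0, Ioi_mem_atTop 0, integrableOn_exp_mul_Ioi (by linarith) 0⟩ |>.mono_set
    Ioi_subset_Ici_self
  refine Asymptotics.IsBigO.of_bound 1 ?_
  filter_upwards [hf] with x hx
  rw [one_mul, Real.norm_of_nonneg (Real.exp_pos _).le]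
  exact hx h rfl

lemma tendsto_zero_of_norm_le_exp {g : ℝ → ℂ} {C κ : ℝ} (hκ : 0 < κ)
    (h : ∀ᶠ x : ℝ in atTop, ‖g x‖ ≤ Real.exp (-κ * x) * C) : Tendsto g atTop (𝓝 0) := by
  refine squeeze_zero_norm' h ?_
  have h1 : Tendsto (fun x : ℝ => -κ * x) atTop atBot := tendsto_id.const_mul_atTop_of_neg (by linarith)
  simpa using (Real.tendsto_exp_atBot.comp h1).mul_const C

/-- The limit of integrals along the boundary of a tall rectangle. -/
lemma tendsto_rectIntegral_vertical {f : ℂ → ℂ} {κ c c' : ℝ} (hf : StripDecay f κ) (hκ : 0 < κ)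
    (hcc : c ≤ c') (hc : ∀ y : ℝ, ContinuousAt f (c + y * I))
    (hc' : ∀ y : ℝ, ContinuousAt f (c' + y * I)) :
    Tendsto (fun T : ℝ => rectIntegral f c c' (-T) T) atTop
      (𝓝 ((∫ y : ℝ, f (c' + y * I) * I) - ∫ y : ℝ, f (c + y * I) * I)) := by
  have hd := hf c c' (κ / 2) (by linarith)
  have h1 : Tendsto (fun T : ℝ => ∫ x : ℝ in c..c', f (x + (-T : ℝ) * I)) atTop (𝓝 0) := by
    refine tendsto_zero_of_norm_le_exp (C := |c' - c|) (half_pos hκ) ?_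
    filter_upwards [hd, eventually_gt_atTop 0] with T hT hT0
    refine intervalIntegral.norm_integral_le_of_norm_le_const fun x hx => ?_
    rw [uIoc_of_le hcc] at hx
    exact hT x ⟨hx.1.le, hx.2⟩ (-T) (by rw [abs_neg, abs_of_pos hT0])
  have h2 : Tendsto (fun T : ℝ => ∫ x : ℝ in c..c', f (x + T * I)) atTop (𝓝 0) := by
    refine tendsto_zero_of_norm_le_exp (C := |c' - c|) (half_pos hκ) ?_
    filter_upwards [hd, eventually_gt_atTop 0] with T hT hT0
    refine intervalIntegral.norm_integral_le_of_norm_le_const fun x hx => ?_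
    rw [uIoc_of_le hcc] at hx
    exact hT x ⟨hx.1.le, hx.2⟩ T (abs_of_pos hT0)
  have h3 := intervalIntegral_tendsto_integral ((hf.integrable hκ hc).mul_const I)
    tendsto_neg_atTop_atBot tendsto_id
  have h4 := intervalIntegral_tendsto_integral ((hf.integrable hκ hc').mul_const I)
    tendsto_neg_atTop_atBot tendsto_id
  simpa [rectIntegral] using ((h1.add h4).sub h2).sub h3

/-- The limit of integrals along the boundary of a long rectangle. -/
lemma tendsto_rectIntegral_horizontal {f : ℂ → ℂ} {κ c h h' : ℝ} (hhh : h ≤ h')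
    (hf : HorizontalDecay (Icc h h') f κ) (hκ : 0 < κ)
    (hc : ∀ x : ℝ, c ≤ x → ContinuousAt f (x + h * I))
    (hc' : ∀ x : ℝ, c ≤ x → ContinuousAt f (x + h' * I)) :
    Tendsto (fun X : ℝ => rectIntegral f c X h h') atTop
      (𝓝 ((∫ x : ℝ in Ioi c, f (x + h * I)) - (∫ x : ℝ in Ioi c, f (x + h' * I))
        - ∫ y : ℝ in h..h', f (c + y * I) * I)) := by
  have h1 : Tendsto (fun X : ℝ => ∫ y : ℝ in h..h', f (X + y * I) * I) atTop (𝓝 0) := by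
    refine tendsto_zero_of_norm_le_exp (C := |h' - h|) hκ ?_
    filter_upwards [hf] with X hX
    refine intervalIntegral.norm_integral_le_of_norm_le_const fun y hy => ?_
    rw [uIoc_of_le hhh] at hy
    rw [norm_mul, norm_I, mul_one]
    exact hX y ⟨hy.1.le, hy.2⟩
  have h2 := intervalIntegral_tendsto_integral_Ioi c
    ((hf.mono (Z := {h}) (by simpa using hhh)).integrableOn hκ hc) tendsto_id
  have h3 := intervalIntegral_tendsto_integral_Ioi c
    ((hf.mono (Z := {h'}) (by simpa using hhh)).integrableOn hκ hc') tendsto_id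
  simpa [rectIntegral] using ((h2.add h1).sub h3).sub_const (∫ y : ℝ in h..h', f (c + y * I) * I)

namespace MBBase

lemma isOpen_right (b : MBBase) : IsOpen b.right := by
  cases b with
  | line c => exact isOpen_lt continuous_const continuous_re
  | loop c h₁ h₂ =>
    exact (isOpen_lt continuous_const continuous_re).inter
      ((isOpen_lt continuous_const continuous_im).inter (isOpen_lt continuous_im continuous_const))

/-- The real part of the leftmost points of the curve. -/
def minRe : MBBase → ℝ
  | line c => c
  | loop c _ _ => c

lemma minRe_lt_of_mem_right {b : MBBase} {s : ℂ} (hs : s ∈ b.right) : b.minRe < s.re := by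
  cases b with
  | line c => exact hs
  | loop c h₁ h₂ => exact hs.1

end MBBase

namespace FoxParams

variable {m n p q : ℕ} {P : FoxParams m n p q}

lemma finite_leftPoles_inter_right (hP : P.Valid) (b : MBBase) :
    (P.leftPoles ∩ b.right).Finite :=
  (finite_leftPoles hP b.minRe).subset fun _ hs => ⟨hs.1, (MBBase.minRe_lt_of_mem_right hs.2).le⟩

lemma eventually_notMem_poles (hP : P.Valid) (s : ℂ) :
    ∀ᶠ u in 𝓝[≠] s, u ∉ P.leftPoles ∧ u ∉ P.rightPoles := by
  have hfin := ((finite_leftPoles hP (s.re - 1)).union (finite_rightPoles hP (s.re + 1))).subset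
    (sdiff_subset (t := {s}))
  have h1 : ∀ᶠ u : ℂ in 𝓝 s, s.re - 1 < u.re ∧ u.re < s.re + 1 :=
    (continuous_re.continuousAt.eventually_const_lt (by linarith)).and
      (continuous_re.continuousAt.eventually_lt_const (by linarith))
  have h2 := hfin.isClosed.compl_mem_nhds (x := s) (by simp)
  rw [eventually_nhdsWithin_iff]
  filter_upwards [h1, h2] with u hu1 hu2 hus
  rw [mem_compl_iff, Set.mem_sdiff, not_and_not_right] at hu2
  constructor
  · exact fun h => hus (hu2 (Or.inl ⟨h, hu1.1.le⟩))
  · exact fun h => hus (hu2 (Or.inr ⟨h, hu1.2.le⟩))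

/-- The closed disc of radius `r` about `s` contains no pole except possibly `s`. -/
def IsolatingRadius (P : FoxParams m n p q) (s : ℂ) (r : ℝ) : Prop :=
  0 < r ∧ ∀ u ∈ Metric.closedBall s r, u ≠ s → u ∉ P.leftPoles ∧ u ∉ P.rightPoles

lemma eventually_isolatingRadius (hP : P.Valid) (s : ℂ) :
    ∀ᶠ r in 𝓝[>] 0, P.IsolatingRadius s r := by
  have h := eventually_nhdsWithin_iff.1 (eventually_notMem_poles hP s)
  filter_upwards [nhdsWithin_le_nhds (eventually_closedBall_subset h), self_mem_nhdsWithin]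
    with r hr hr0
  exact ⟨hr0, fun u hu hus => hr hu hus⟩

lemma exists_isolatingRadius (hP : P.Valid) (s : ℂ) : ∃ r, P.IsolatingRadius s r :=
  (eventually_isolatingRadius hP s).exists

lemma Separates.isolatingRadius {L : MBContour} (hL : P.Separates L) {s : ℂ} (hs : s ∈ L.indent) :
    P.IsolatingRadius s L.r :=
  ⟨hL.r_pos, fun u hu hus => ⟨fun h => hus (hL.disc_left s hs u h hu),
    fun h => hL.disc_right s hs u h hu⟩⟩

lemma circleIntegral_integrand_eq (hP : P.Valid) {z s : ℂ} (hz : z ≠ 0) {r r' : ℝ}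
    (hr : P.IsolatingRadius s r) (hr' : P.IsolatingRadius s r') :
    (∮ u in C(s, r), P.integrand z u) = ∮ u in C(s, r'), P.integrand z u := by
  wlog h : r' ≤ r generalizing r r'
  · exact (this hr' hr (le_of_not_ge h)).symm
  have hd : ∀ u ∈ Metric.closedBall s r \ Metric.ball s r', DifferentiableAt ℂ (P.integrand z) u := by
    rintro u ⟨h1, h2⟩
    have := hr.2 u h1 (fun h => h2 (h ▸ Metric.mem_ball_self hr'.1))
    exact differentiableAt_integrand hP hz this.1 this.2
  refine circleIntegral_eq_of_differentiable_on_annulus_off_countable hr'.1 h countable_empty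
    (fun u hu => (hd u hu).continuousAt.continuousWithinAt) fun u hu => hd u ?_
  exact ⟨Metric.ball_subset_closedBall hu.1.1, fun h => hu.1.2 (Metric.ball_subset_closedBall h)⟩

/-- `R s` is `2πi` times the residue of the integrand at `s`, for all `s`. -/
def IsResidue (P : FoxParams m n p q) (z : ℂ) (R : ℂ → ℂ) : Prop :=
  ∀ s r, P.IsolatingRadius s r → (∮ u in C(s, r), P.integrand z u) = R s

lemma exists_isResidue (hP : P.Valid) {z : ℂ} (hz : z ≠ 0) : ∃ R, P.IsResidue z R := by
  choose ρ hρ using exists_isolatingRadius hP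
  exact ⟨fun s => ∮ u in C(s, ρ s), P.integrand z u, fun s r hr =>
    circleIntegral_integrand_eq hP hz hr (hρ s)⟩

/-- The residue theorem for the integrand and a rectangle that contains no right pole. -/
lemma rectIntegral_integrand (hP : P.Valid) {z : ℂ} (hz : z ≠ 0) {R : ℂ → ℂ}
    (hR : P.IsResidue z R) {x₀ x₁ y₀ y₁ : ℝ} (hx : x₀ ≤ x₁) (hy : y₀ ≤ y₁)
    (hl : ∀ s ∈ P.leftPoles, s.re ∈ Icc x₀ x₁ → s.im ∈ Icc y₀ y₁ →
      (x₀ < s.re ∧ s.re < x₁) ∧ y₀ < s.im ∧ s.im < y₁)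
    (hr : ∀ s ∈ P.rightPoles, s.re ∈ Icc x₀ x₁ → s.im ∉ Icc y₀ y₁) :
    rectIntegral (P.integrand z) x₀ x₁ y₀ y₁ =
      ∑ᶠ s ∈ {s ∈ P.leftPoles | (x₀ < s.re ∧ s.re < x₁) ∧ y₀ < s.im ∧ s.im < y₁}, R s := by
  choose ρ hρ using exists_isolatingRadius hP
  have hfin : {s ∈ P.leftPoles | (x₀ < s.re ∧ s.re < x₁) ∧ y₀ < s.im ∧ s.im < y₁}.Finite :=
    (finite_leftPoles hP x₀).subset fun s hs => ⟨hs.1, hs.2.1.1.le⟩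
  rw [finsum_mem_eq_finite_toFinset_sum _ hfin,
    rectIntegral_eq_sum_circleIntegral hx hy ρ hfin.toFinset]
  · exact Finset.sum_congr rfl fun s _ => hR s _ (hρ s)
  · intro s hs
    rw [Finite.mem_toFinset] at hs
    exact hs.2
  · intro s h1 h2 hs
    rw [Finite.mem_toFinset] at hs
    exact differentiableAt_integrand hP hz (fun h => hs ⟨h, hl s h h1 h2⟩) fun h => hr s h h1 h2
  · exact fun s _ => meromorphic_integrand hz s
  · exact fun s _ => (hρ s).1
  · intro s _ u hu hus
    have h := (hρ s).2 u hu hus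
    refine ⟨fun h' => ?_, differentiableAt_integrand hP hz h.1 h.2⟩
    rw [Finite.mem_toFinset] at h'
    exact h.1 h'.1

/-- All right poles lie to the right of the curve `b`, and no left pole lies on it. -/
def GoodBase (P : FoxParams m n p q) (b : MBBase) : Prop :=
  (∀ s ∈ P.rightPoles, s ∈ b.right) ∧ ∀ s ∈ P.leftPoles, s ∈ b.right ∨ s ∉ b.closedRight

lemma Separates.goodBase {L : MBContour} (hL : P.Separates L) : P.GoodBase L.base :=
  ⟨hL.right_mem, hL.left_off⟩

lemma GoodBase.exists_separates (hP : P.Valid) {b : MBBase} (hb : P.GoodBase b) :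
    ∃ L : MBContour, L.base = b ∧ P.Separates L := by
  have hfin := finite_leftPoles_inter_right hP b
  have h1 : ∀ᶠ r in 𝓝[>] (0 : ℝ), ∀ s ∈ hfin.toFinset,
      P.IsolatingRadius s r ∧ Metric.closedBall s r ⊆ b.right := by
    rw [Filter.eventually_all_finset]
    intro s hs
    rw [Finite.mem_toFinset] at hs
    exact (eventually_isolatingRadius hP s).and
      (nhdsWithin_le_nhds (eventually_closedBall_subset (b.isOpen_right.mem_nhds hs.2)))
  obtain ⟨r, hr, hr0⟩ := (h1.and self_mem_nhdsWithin).exists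
  refine ⟨⟨b, hfin.toFinset, r⟩, rfl, hr0, hb.1, hb.2, fun s => hfin.mem_toFinset,
    fun s hs => (hr s hs).2, fun s hs u hu hus => ?_, fun s hs u hu hus => ?_⟩
  · by_contra hne
    exact ((hr s hs).1.2 u hus hne).1 hu
  · have hsl := (hfin.mem_toFinset.1 hs).1
    exact ((hr s hs).1.2 u hus
      fun h => Set.disjoint_left.1 (disjoint_poles hP) hsl (h ▸ hu)).2 hu

/-- The integral along the curve `b`, corrected by the residues at the left poles to the right of
`b`. -/
noncomputable def contourValue (P : FoxParams m n p q) (z : ℂ) (R : ℂ → ℂ) (b : MBBase) : ℂ :=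
  b.integral (P.integrand z) + ∑ᶠ s ∈ P.leftPoles ∩ b.right, R s

lemma Separates.integral_eq_contourValue {z : ℂ} {R : ℂ → ℂ}
    (hR : P.IsResidue z R) {L : MBContour} (hL : P.Separates L) :
    L.integral (P.integrand z) = P.contourValue z R L.base := by
  have : P.leftPoles ∩ L.base.right = (L.indent : Set ℂ) := by
    ext s
    exact (hL.mem_indent s).symm
  rw [MBContour.integral, contourValue, this, finsum_mem_coe_finset]
  congr 1
  exact Finset.sum_congr rfl fun s hs => hR s _ (hL.isolatingRadius hs)

lemma contourValue_eq_of_subset (hP : P.Valid) {z : ℂ} {R : ℂ → ℂ} {b b' : MBBase} {D : Set ℂ}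
    (hD : P.leftPoles ∩ b.right = (P.leftPoles ∩ b'.right) ∪ D)
    (hdisj : ∀ s ∈ D, s ∉ b'.right)
    (h : b'.integral (P.integrand z) - b.integral (P.integrand z) = ∑ᶠ s ∈ D, R s) :
    P.contourValue z R b = P.contourValue z R b' := by
  have hfin := finite_leftPoles_inter_right hP b
  rw [hD] at hfin
  rw [contourValue, contourValue, hD, finsum_mem_union
    (Set.disjoint_left.2 fun s hs hsD => hdisj s hsD hs.2) (hfin.subset subset_union_left)
    (hfin.subset subset_union_right), ← h]
  ring

lemma continuousAt_integrand_of_goodBase (hP : P.Valid) {z : ℂ} (hz : z ≠ 0) {b : MBBase}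
    (hb : P.GoodBase b) {s : ℂ} (hs : s ∈ b.closedRight) (hs' : s ∉ b.right) :
    ContinuousAt (P.integrand z) s := by
  refine (differentiableAt_integrand hP hz (fun h => ?_) fun h => hs' (hb.1 s h)).continuousAt
  exact (hb.2 s h).elim hs' fun h' => h' hs

lemma contourValue_line_eq (hP : P.Valid) {z : ℂ} (hz : z ≠ 0) (hzl : P.LineCase z) {R : ℂ → ℂ}
    (hR : P.IsResidue z R) {c c' : ℝ} (hc : P.GoodBase (.line c)) (hc' : P.GoodBase (.line c')) :
    P.contourValue z R (.line c) = P.contourValue z R (.line c') := by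
  wlog hcc : c < c' generalizing c c'
  · rcases (not_lt.1 hcc).eq_or_lt with rfl | h
    · rfl
    · exact (this hc' hc h).symm
  obtain ⟨κ, hκ, hdecay⟩ := hzl.exists_stripDecay hP hz
  refine contourValue_eq_of_subset hP (D := {s ∈ P.leftPoles | c < s.re ∧ s.re < c'}) ?_ ?_ ?_
  · ext s
    simp only [MBBase.right, mem_inter_iff, mem_ofPred_eq, mem_union]
    constructor
    · rintro ⟨h1, h2⟩
      rcases lt_trichotomy s.re c' with h | h | h
      · exact Or.inr ⟨h1, h2, h⟩
      · rcases hc'.2 s h1 with h3 | h3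
        · exact Or.inl ⟨h1, h3⟩
        · exact absurd h.ge h3
      · exact Or.inl ⟨h1, h⟩
    · rintro (⟨h1, h2⟩ | ⟨h1, h2, -⟩)
      · exact ⟨h1, hcc.trans h2⟩
      · exact ⟨h1, h2⟩
  · exact fun s hs h => lt_asymm hs.2.2 h
  have hcont : ∀ {c : ℝ}, P.GoodBase (.line c) → ∀ y : ℝ,
      ContinuousAt (P.integrand z) (c + y * I) := fun hc y =>
    continuousAt_integrand_of_goodBase hP hz hc (by simp [MBBase.closedRight])
      (by simp [MBBase.right])
  have h1 := tendsto_rectIntegral_vertical hdecay hκ hcc.le (hcont hc) (hcont hc')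
  obtain ⟨T₀, hT₀⟩ := (finite_im_leftPoles (P := P)).bddAbove
  obtain ⟨T₁, hT₁⟩ := (finite_im_leftPoles (P := P)).bddBelow
  refine tendsto_nhds_unique h1 (tendsto_const_nhds.congr' ?_)
  filter_upwards [eventually_gt_atTop T₀, eventually_gt_atTop (-T₁), eventually_gt_atTop 0]
    with T hT1 hT2 hT3
  have him : ∀ s ∈ P.leftPoles, -T < s.im ∧ s.im < T := fun s hs =>
    ⟨by linarith [hT₁ ⟨s, hs, rfl⟩], by linarith [hT₀ ⟨s, hs, rfl⟩]⟩
  rw [rectIntegral_integrand hP hz hR hcc.le (by linarith)]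
  · refine finsum_mem_congr ?_ fun _ _ => rfl
    ext s
    simp only [mem_ofPred_eq]
    exact ⟨fun h => ⟨h.1, h.2, him s h.1⟩, fun h => ⟨h.1, h.2.1⟩⟩
  · intro s hs h1 _
    refine ⟨⟨lt_of_le_of_ne h1.1 fun h => ?_, lt_of_le_of_ne h1.2 fun h => ?_⟩, him s hs⟩
    · exact (hc.2 s hs).elim (fun h' => h'.ne h) fun h' => h' h.le
    · exact (hc'.2 s hs).elim (fun h' => h'.ne h.symm) fun h' => h' h.ge
  · intro s hs h1 _
    exact absurd (hc'.1 s hs) (not_lt.2 h1.2)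

end FoxParams

/-! ### Independence of the loop -/

namespace FoxParams

variable {m n p q : ℕ} {P : FoxParams m n p q}

lemma LoopCase.exists_horizontalDecay (hP : P.Valid) {z : ℂ} (hz : z ≠ 0) (h : P.LoopCase z)
    {Y : Set ℝ} (hY : IsCompact Y) (hr : ∀ s ∈ P.rightPoles, s.im ∉ Y) :
    ∃ κ, 0 < κ ∧ HorizontalDecay Y (P.integrand z) κ := by
  refine h.exists_decay hP hz hY fun j hj y hy h0 => hr ((P.b j + (0 : ℕ)) / P.B j) ⟨j, hj, 0, rfl⟩ ?_
  have : (P.b j).im / P.B j = y := by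
    rw [div_eq_iff (hP.B_pos j).ne']; linarith
  simpa [div_ofReal_im, this] using hy

lemma contourValue_loop_eq_of_left (hP : P.Valid) {z : ℂ} (hz : z ≠ 0) (hzl : P.LoopCase z)
    {R : ℂ → ℂ} (hR : P.IsResidue z R) {c c₁ h₁ h₂ : ℝ} (hh : h₁ < h₂) (hcc : c₁ < c)
    (hg : P.GoodBase (.loop c h₁ h₂)) (hg' : P.GoodBase (.loop c₁ h₁ h₂)) :
    P.contourValue z R (.loop c₁ h₁ h₂) = P.contourValue z R (.loop c h₁ h₂) := by
  have key : ∀ s ∈ P.leftPoles, s.re ∈ Icc c₁ c → s.im ∈ Icc h₁ h₂ →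
      (c₁ < s.re ∧ s.re < c) ∧ h₁ < s.im ∧ s.im < h₂ := by
    intro s hs h1 h2
    have h3 : s ∈ (MBBase.loop c₁ h₁ h₂).right :=
      (hg'.2 s hs).resolve_right fun h => h ⟨h1.1, h2⟩
    refine ⟨⟨h3.1, lt_of_le_of_ne h1.2 fun h => ?_⟩, h3.2⟩
    exact (hg.2 s hs).elim (fun h' => h'.1.ne' h) fun h' => h' ⟨h.ge, h2⟩
  refine contourValue_eq_of_subset hP
    (D := {s ∈ P.leftPoles | (c₁ < s.re ∧ s.re < c) ∧ h₁ < s.im ∧ s.im < h₂}) ?_ ?_ ?_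
  · ext s
    simp only [MBBase.right, mem_inter_iff, mem_ofPred_eq, mem_union]
    constructor
    · rintro ⟨hs, h1, h2⟩
      rcases le_or_gt s.re c with h | h
      · exact Or.inr ⟨hs, key s hs ⟨h1.le, h⟩ ⟨h2.1.le, h2.2.le⟩⟩
      · exact Or.inl ⟨hs, h, h2⟩
    · rintro (⟨hs, h1, h2⟩ | ⟨hs, h1, h2⟩)
      · exact ⟨hs, hcc.trans h1, h2⟩
      · exact ⟨hs, h1.1, h2⟩
  · exact fun s hs h => lt_asymm hs.2.1.2 h.1
  rw [← rectIntegral_integrand hP hz hR hcc.le hh.le key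
    fun s hs h1 _ => absurd (hg.1 s hs).1 (not_lt.2 h1.2)]
  have hray : ∀ h : ℝ, h = h₁ ∨ h = h₂ →
      IntegrableOn (fun x : ℝ => P.integrand z (x + h * I)) (Ioi c₁) := by
    intro h hh'
    obtain ⟨κ, hκ, hd⟩ := hzl.exists_horizontalDecay hP hz (Y := {h}) isCompact_singleton
      fun s hs hs' => by
        have := (hg'.1 s hs).2
        rw [mem_singleton_iff] at hs'
        rcases hh' with rfl | rfl <;> rw [hs'] at this <;> linarith [this.1, this.2]
    refine hd.integrableOn hκ fun x hx => continuousAt_integrand_of_goodBase hP hz hg' ?_ ?_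
    · rcases hh' with rfl | rfl <;> simp [MBBase.closedRight, hx, hh.le]
    · rcases hh' with rfl | rfl <;> simp [MBBase.right]
  have hsplit : ∀ h : ℝ, h = h₁ ∨ h = h₂ → (∫ x : ℝ in Ioi c₁, P.integrand z (x + h * I)) =
      (∫ x : ℝ in c₁..c, P.integrand z (x + h * I)) + ∫ x : ℝ in Ioi c, P.integrand z (x + h * I) := by
    intro h hh'
    have hi := hray h hh'
    rw [intervalIntegral.integral_of_le hcc.le, ← setIntegral_union (Ioc_disjoint_Ioi le_rfl)
      measurableSet_Ioi (hi.mono_set Ioc_subset_Ioi_self) (hi.mono_set (Ioi_subset_Ioi hcc.le)),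
      Ioc_union_Ioi_eq_Ioi hcc.le]
  rw [MBBase.integral, MBBase.integral, hsplit h₁ (Or.inl rfl), hsplit h₂ (Or.inr rfl), rectIntegral]
  ring

/-- The residue theorem for a half-strip to the right. -/
lemma halfStrip_integral_eq (hP : P.Valid) {z : ℂ} (hz : z ≠ 0) (hzl : P.LoopCase z)
    {R : ℂ → ℂ} (hR : P.IsResidue z R) {c h h' : ℝ} (hh : h ≤ h')
    (hl : ∀ s ∈ P.leftPoles, c ≤ s.re → s.im ∈ Icc h h' → c < s.re ∧ h < s.im ∧ s.im < h')
    (hr : ∀ s ∈ P.rightPoles, s.im ∉ Icc h h') :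
    (∫ x : ℝ in Ioi c, P.integrand z (x + h * I)) - (∫ x : ℝ in Ioi c, P.integrand z (x + h' * I))
        - ∫ y : ℝ in h..h', P.integrand z (c + y * I) * I =
      ∑ᶠ s ∈ {s ∈ P.leftPoles | c < s.re ∧ h < s.im ∧ s.im < h'}, R s := by
  obtain ⟨κ, hκ, hd⟩ := hzl.exists_horizontalDecay hP hz isCompact_Icc hr
  have hcont : ∀ k : ℝ, k = h ∨ k = h' → ∀ x : ℝ, c ≤ x →
      ContinuousAt (P.integrand z) (x + k * I) := by
    intro k hk x hx
    refine (differentiableAt_integrand hP hz (fun hs => ?_) fun hs => ?_).continuousAt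
    · have := (hl _ hs (by simpa using hx) (by rcases hk with rfl | rfl <;> simpa using hh)).2
      rcases hk with rfl | rfl <;> simp at this
    · exact hr _ hs (by rcases hk with rfl | rfl <;> simpa using hh)
  obtain ⟨X₀, hX₀⟩ := exists_re_leftPoles_le hP
  refine tendsto_nhds_unique (tendsto_rectIntegral_horizontal hh hd hκ (hcont h (Or.inl rfl))
    (hcont h' (Or.inr rfl))) (tendsto_const_nhds.congr' ?_)
  filter_upwards [eventually_gt_atTop X₀, eventually_gt_atTop c] with X hX hXc
  rw [rectIntegral_integrand hP hz hR hXc.le hh]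
  · refine finsum_mem_congr ?_ fun _ _ => rfl
    ext s
    simp only [mem_ofPred_eq]
    exact ⟨fun hs => ⟨hs.1, ⟨hs.2.1, (hX₀ s hs.1).trans_lt hX⟩, hs.2.2⟩,
      fun hs => ⟨hs.1, hs.2.1.1, hs.2.2⟩⟩
  · intro s hs h1 h2
    have h3 := hl s hs h1.1 h2
    exact ⟨⟨h3.1, (hX₀ s hs).trans_lt hX⟩, h3.2⟩
  · exact fun s hs _ => hr s hs

lemma intervalIntegrable_integrand_of_goodBase (hP : P.Valid) {z : ℂ} (hz : z ≠ 0) {c h₁ h₂ : ℝ}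
    (hg : P.GoodBase (.loop c h₁ h₂)) {k l : ℝ} (hk : k ∈ Icc h₁ h₂) (hl : l ∈ Icc h₁ h₂) :
    IntervalIntegrable (fun y : ℝ => P.integrand z (c + y * I) * I) volume k l := by
  refine intervalIntegrable_vertical fun y hy => ?_
  have hy' : y ∈ Icc h₁ h₂ := uIcc_subset_Icc hk hl hy
  exact continuousAt_integrand_of_goodBase hP hz hg (by simpa [MBBase.closedRight] using hy')
    (by simp [MBBase.right])

lemma contourValue_loop_eq_of_top (hP : P.Valid) {z : ℂ} (hz : z ≠ 0) (hzl : P.LoopCase z)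
    {R : ℂ → ℂ} (hR : P.IsResidue z R) {c h₁ h₂ h₂' : ℝ} (hh : h₁ < h₂) (hhh : h₂ < h₂')
    (hg : P.GoodBase (.loop c h₁ h₂)) (hg' : P.GoodBase (.loop c h₁ h₂')) :
    P.contourValue z R (.loop c h₁ h₂') = P.contourValue z R (.loop c h₁ h₂) := by
  have key : ∀ s ∈ P.leftPoles, c ≤ s.re → s.im ∈ Icc h₂ h₂' →
      c < s.re ∧ h₂ < s.im ∧ s.im < h₂' := by
    intro s hs h1 h2
    have h3 : s ∈ (MBBase.loop c h₁ h₂').right :=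
      (hg'.2 s hs).resolve_right fun h => h ⟨h1, hh.le.trans h2.1, h2.2⟩
    refine ⟨h3.1, lt_of_le_of_ne h2.1 fun h => ?_, h3.2.2⟩
    exact (hg.2 s hs).elim (fun h' => h'.2.2.ne' h) fun h' => h' ⟨h1, by rw [← h]; exact hh.le, h.ge⟩
  refine contourValue_eq_of_subset hP
    (D := {s ∈ P.leftPoles | c < s.re ∧ h₂ < s.im ∧ s.im < h₂'}) ?_ ?_ ?_
  · ext s
    simp only [MBBase.right, mem_inter_iff, mem_ofPred_eq, mem_union]
    constructor
    · rintro ⟨hs, h1, h2, h3⟩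
      rcases lt_or_ge s.im h₂ with h | h
      · exact Or.inl ⟨hs, h1, h2, h⟩
      · exact Or.inr ⟨hs, key s hs h1.le ⟨h, h3.le⟩⟩
    · rintro (⟨hs, h1, h2, h3⟩ | ⟨hs, h1, h2, h3⟩)
      · exact ⟨hs, h1, h2, h3.trans hhh⟩
      · exact ⟨hs, h1, hh.trans h2, h3⟩
  · exact fun s hs h => lt_asymm hs.2.2.1 h.2.2
  rw [← halfStrip_integral_eq hP hz hzl hR hhh.le key
    fun s hs h => absurd (hg.1 s hs).2.2 (not_lt.2 h.1)]
  have hsplit := intervalIntegral.integral_add_adjacent_intervals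
    (intervalIntegrable_integrand_of_goodBase hP hz hg' (k := h₁) (l := h₂)
      ⟨le_rfl, (hh.trans hhh).le⟩ ⟨hh.le, hhh.le⟩)
    (intervalIntegrable_integrand_of_goodBase hP hz hg' (k := h₂) (l := h₂')
      ⟨hh.le, hhh.le⟩ ⟨(hh.trans hhh).le, le_rfl⟩)
  rw [MBBase.integral, MBBase.integral, ← hsplit]
  ring

lemma contourValue_loop_eq_of_bottom (hP : P.Valid) {z : ℂ} (hz : z ≠ 0) (hzl : P.LoopCase z)
    {R : ℂ → ℂ} (hR : P.IsResidue z R) {c h₁ h₁' h₂ : ℝ} (hh : h₁ < h₂) (hhh : h₁' < h₁)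
    (hg : P.GoodBase (.loop c h₁ h₂)) (hg' : P.GoodBase (.loop c h₁' h₂)) :
    P.contourValue z R (.loop c h₁' h₂) = P.contourValue z R (.loop c h₁ h₂) := by
  have key : ∀ s ∈ P.leftPoles, c ≤ s.re → s.im ∈ Icc h₁' h₁ →
      c < s.re ∧ h₁' < s.im ∧ s.im < h₁ := by
    intro s hs h1 h2
    have h3 : s ∈ (MBBase.loop c h₁' h₂).right :=
      (hg'.2 s hs).resolve_right fun h => h ⟨h1, h2.1, h2.2.trans hh.le⟩
    refine ⟨h3.1, h3.2.1, lt_of_le_of_ne h2.2 fun h => ?_⟩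
    exact (hg.2 s hs).elim (fun h' => h'.2.1.ne' h) fun h' => h' ⟨h1, h.ge, by rw [h]; exact hh.le⟩
  refine contourValue_eq_of_subset hP
    (D := {s ∈ P.leftPoles | c < s.re ∧ h₁' < s.im ∧ s.im < h₁}) ?_ ?_ ?_
  · ext s
    simp only [MBBase.right, mem_inter_iff, mem_ofPred_eq, mem_union]
    constructor
    · rintro ⟨hs, h1, h2, h3⟩
      rcases lt_or_ge h₁ s.im with h | h
      · exact Or.inl ⟨hs, h1, h, h3⟩
      · exact Or.inr ⟨hs, key s hs h1.le ⟨h2.le, h⟩⟩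
    · rintro (⟨hs, h1, h2, h3⟩ | ⟨hs, h1, h2, h3⟩)
      · exact ⟨hs, h1, hhh.trans h2, h3⟩
      · exact ⟨hs, h1, h2, h3.trans hh⟩
  · exact fun s hs h => lt_asymm hs.2.2.2 h.2.1
  rw [← halfStrip_integral_eq hP hz hzl hR hhh.le key
    fun s hs h => absurd (hg.1 s hs).2.1 (not_lt.2 h.2)]
  have hsplit := intervalIntegral.integral_add_adjacent_intervals
    (intervalIntegrable_integrand_of_goodBase hP hz hg' (k := h₁') (l := h₁)
      ⟨le_rfl, (hhh.trans hh).le⟩ ⟨hhh.le, hh.le⟩)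
    (intervalIntegrable_integrand_of_goodBase hP hz hg' (k := h₁) (l := h₂)
      ⟨hhh.le, hh.le⟩ ⟨(hhh.trans hh).le, le_rfl⟩)
  rw [MBBase.integral, MBBase.integral, ← hsplit]
  ring

lemma GoodBase.loop_of_generic {c h₁ h₂ c' h₁' h₂' : ℝ} (hg : P.GoodBase (.loop c h₁ h₂))
    (hc : c' ≤ c) (h1 : h₁' ≤ h₁) (h2 : h₂ ≤ h₂')
    (h : ∀ s ∈ P.leftPoles, s ∈ (MBBase.loop c' h₁' h₂').closedRight →
      s.re ≠ c' ∧ s.im ≠ h₁' ∧ s.im ≠ h₂') : P.GoodBase (.loop c' h₁' h₂') := by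
  refine ⟨fun s hs => ?_, fun s hs => ?_⟩
  · have := hg.1 s hs
    exact ⟨hc.trans_lt this.1, h1.trans_lt this.2.1, this.2.2.trans_le h2⟩
  · by_cases hs' : s ∈ (MBBase.loop c' h₁' h₂').closedRight
    · obtain ⟨h3, h4, h5⟩ := h s hs hs'
      exact Or.inl ⟨lt_of_le_of_ne hs'.1 h3.symm, lt_of_le_of_ne hs'.2.1 h4.symm,
        lt_of_le_of_ne hs'.2.2 h5⟩
    · exact Or.inr hs'

/-- A loop may be replaced by a larger loop in general position. The edges of the given loop are
first moved off the finitely many horizontal lines that contain left poles, so that the corners of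
the intermediate loops are no poles. -/
lemma contourValue_loop_eq_of_generic (hP : P.Valid) {z : ℂ} (hz : z ≠ 0) (hzl : P.LoopCase z)
    {R : ℂ → ℂ} (hR : P.IsResidue z R) {c h₁ h₂ c' h₁' h₂' : ℝ} (hh : h₁ < h₂)
    (hg : P.GoodBase (.loop c h₁ h₂)) (hcc : c' < c) (hh1 : h₁' < h₁) (hh2 : h₂ < h₂')
    (hc' : ∀ s ∈ P.leftPoles, s.re ≠ c') (h1' : ∀ s ∈ P.leftPoles, s.im ≠ h₁')
    (h2' : ∀ s ∈ P.leftPoles, s.im ≠ h₂') :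
    P.contourValue z R (.loop c h₁ h₂) = P.contourValue z R (.loop c' h₁' h₂') := by
  have hfin := finite_im_leftPoles (P := P)
  obtain ⟨k₂, hk2, hk2', hV2⟩ : ∃ k, h₂ < k ∧ k < h₂' ∧ ∀ s ∈ P.leftPoles, s.im ∉ Ioc h₂ k := by
    have hev := (hfin.subset (sdiff_subset (t := {h₂}))).isClosed.compl_mem_nhds (x := h₂) (by simp)
    obtain ⟨u, hu, hsub⟩ := exists_Ico_subset_of_mem_nhds (mem_nhds_iff.2 (mem_nhds_iff.1 hev))
      ⟨h₂', hh2⟩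
    obtain ⟨k, hk1, hk2⟩ := exists_between (lt_min hu hh2)
    refine ⟨k, hk1, hk2.trans_le (min_le_right _ _), fun s hs hsk => ?_⟩
    exact hsub ⟨hsk.1.le, hsk.2.trans_lt (hk2.trans_le (min_le_left _ _))⟩
      ⟨⟨s, hs, rfl⟩, hsk.1.ne'⟩
  obtain ⟨k₁, hk1, hk1', hV1⟩ : ∃ k, k < h₁ ∧ h₁' < k ∧ ∀ s ∈ P.leftPoles, s.im ∉ Ico k h₁ := by
    have hev := (hfin.subset (sdiff_subset (t := {h₁}))).isClosed.compl_mem_nhds (x := h₁) (by simp)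
    obtain ⟨u, hu, hsub⟩ := exists_Ioc_subset_of_mem_nhds (mem_nhds_iff.2 (mem_nhds_iff.1 hev))
      ⟨h₁', hh1⟩
    obtain ⟨k, hk1, hk2⟩ := exists_between (max_lt hu hh1)
    refine ⟨k, hk2, (le_max_right _ _).trans_lt hk1, fun s hs hsk => ?_⟩
    exact hsub ⟨((le_max_left _ _).trans_lt hk1).trans_le hsk.1, hsk.2.le⟩
      ⟨⟨s, hs, rfl⟩, hsk.2.ne⟩
  have hk1ne : ∀ s ∈ P.leftPoles, s.im ≠ k₁ := fun s hs h => hV1 s hs ⟨h.ge, by rw [h]; exact hk1⟩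
  have hk2ne : ∀ s ∈ P.leftPoles, s.im ≠ k₂ := fun s hs h => hV2 s hs ⟨by rw [h]; exact hk2, h.le⟩
  have hg1 : P.GoodBase (.loop c h₁ k₂) := by
    refine hg.loop_of_generic le_rfl le_rfl hk2.le fun s hs hsc => ?_
    have h3 : s.im ≤ h₂ := not_lt.1 fun h => hV2 s hs ⟨h, hsc.2.2⟩
    have h4 := (hg.2 s hs).resolve_right fun h => h ⟨hsc.1, hsc.2.1, h3⟩
    exact ⟨h4.1.ne', h4.2.1.ne', hk2ne s hs⟩
  have hg2 : P.GoodBase (.loop c k₁ k₂) := by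
    refine hg1.loop_of_generic le_rfl hk1.le le_rfl fun s hs hsc => ?_
    have h3 : h₁ ≤ s.im := not_lt.1 fun h => hV1 s hs ⟨hsc.2.1, h⟩
    have h4 := (hg1.2 s hs).resolve_right fun h => h ⟨hsc.1, h3, hsc.2.2⟩
    exact ⟨h4.1.ne', hk1ne s hs, hk2ne s hs⟩
  have hg3 : P.GoodBase (.loop c' k₁ k₂) :=
    hg2.loop_of_generic hcc.le le_rfl le_rfl fun s hs _ => ⟨hc' s hs, hk1ne s hs, hk2ne s hs⟩
  have hg4 : P.GoodBase (.loop c' k₁ h₂') :=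
    hg3.loop_of_generic le_rfl le_rfl hk2'.le fun s hs _ => ⟨hc' s hs, hk1ne s hs, h2' s hs⟩
  have hg5 : P.GoodBase (.loop c' h₁' h₂') :=
    hg4.loop_of_generic le_rfl hk1'.le le_rfl fun s hs _ => ⟨hc' s hs, h1' s hs, h2' s hs⟩
  rw [contourValue_loop_eq_of_bottom hP hz hzl hR (by linarith) hk1' hg4 hg5,
    contourValue_loop_eq_of_top hP hz hzl hR (by linarith) hk2' hg3 hg4,
    contourValue_loop_eq_of_left hP hz hzl hR (by linarith) hcc hg2 hg3,
    contourValue_loop_eq_of_bottom hP hz hzl hR (by linarith) hk1 hg1 hg2,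
    contourValue_loop_eq_of_top hP hz hzl hR hh hk2 hg hg1]

lemma exists_lt_forall_re_ne (hP : P.Valid) (c d : ℝ) (h : c < d) :
    ∃ x ∈ Ioo c d, ∀ s ∈ P.leftPoles, s.re ≠ x := by
  have hfin := ((finite_leftPoles hP c).image Complex.re)
  obtain ⟨x, hx, hx'⟩ := (Ioo_infinite h).exists_notMem_finite hfin
  exact ⟨x, hx, fun s hs hsx => hx' ⟨s, ⟨hs, hsx ▸ hx.1.le⟩, hsx⟩⟩

lemma contourValue_loop_eq (hP : P.Valid) {z : ℂ} (hz : z ≠ 0) (hzl : P.LoopCase z)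
    {R : ℂ → ℂ} (hR : P.IsResidue z R) {c h₁ h₂ c' h₁' h₂' : ℝ} (hh : h₁ < h₂) (hh' : h₁' < h₂')
    (hg : P.GoodBase (.loop c h₁ h₂)) (hg' : P.GoodBase (.loop c' h₁' h₂')) :
    P.contourValue z R (.loop c h₁ h₂) = P.contourValue z R (.loop c' h₁' h₂') := by
  obtain ⟨d, hd, hdne⟩ := exists_lt_forall_re_ne hP (min c c' - 1) (min c c') (by linarith)
  obtain ⟨k₁, hk1, hk1ne⟩ := (Iio_infinite (min h₁ h₁')).exists_notMem_finite
    (finite_im_leftPoles (P := P))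
  obtain ⟨k₂, hk2, hk2ne⟩ := (Ioi_infinite (max h₂ h₂')).exists_notMem_finite
    (finite_im_leftPoles (P := P))
  rw [mem_Iio, lt_min_iff] at hk1
  rw [mem_Ioi, max_lt_iff] at hk2
  have hd' := lt_min_iff.1 hd.2
  have h1 : ∀ s ∈ P.leftPoles, s.im ≠ k₁ := fun s hs h => hk1ne ⟨s, hs, h⟩
  have h2 : ∀ s ∈ P.leftPoles, s.im ≠ k₂ := fun s hs h => hk2ne ⟨s, hs, h⟩
  rw [contourValue_loop_eq_of_generic hP hz hzl hR hh hg hd'.1 hk1.1 hk2.1 hdne h1 h2,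
    contourValue_loop_eq_of_generic hP hz hzl hR hh' hg' hd'.2 hk1.2 hk2.2 hdne h1 h2]

/-- The Mellin-Barnes integral is the same for all lines that separate the poles. -/
theorem mellinBarnes_eq_of_isLine (hP : P.Valid) {z : ℂ} (hz : z ≠ 0) (hzl : P.LineCase z)
    {L L' : MBContour} (hL : L.base.IsLine) (hL' : L'.base.IsLine) (hs : P.Separates L)
    (hs' : P.Separates L') : P.mellinBarnes L z = P.mellinBarnes L' z := by
  obtain ⟨R, hR⟩ := exists_isResidue hP hz
  have h1 := hs.integral_eq_contourValue hR
  have h2 := hs'.integral_eq_contourValue hR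
  have hg := hs.goodBase
  have hg' := hs'.goodBase
  unfold integrand at h1 h2
  rw [mellinBarnes, mellinBarnes, h1, h2]
  rcases h : L.base with c | ⟨c, h₁, h₂⟩
  · rcases h' : L'.base with c' | ⟨c', h₁', h₂'⟩
    · rw [h] at hg
      rw [h'] at hg'
      rw [contourValue_line_eq hP hz hzl hR hg hg']
    · rw [h'] at hL'
      exact hL'.elim
  · rw [h] at hL
    exact hL.elim

/-- The Mellin-Barnes integral is the same for all loops that separate the poles. -/
theorem mellinBarnes_eq_of_isLoop (hP : P.Valid) {z : ℂ} (hz : z ≠ 0) (hzl : P.LoopCase z)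
    {L L' : MBContour} (hL : L.base.IsLoop) (hL' : L'.base.IsLoop) (hs : P.Separates L)
    (hs' : P.Separates L') : P.mellinBarnes L z = P.mellinBarnes L' z := by
  obtain ⟨R, hR⟩ := exists_isResidue hP hz
  have h1 := hs.integral_eq_contourValue hR
  have h2 := hs'.integral_eq_contourValue hR
  have hg := hs.goodBase
  have hg' := hs'.goodBase
  unfold integrand at h1 h2
  rw [mellinBarnes, mellinBarnes, h1, h2]
  rcases h : L.base with c | ⟨c, h₁, h₂⟩
  · rw [h] at hL
    exact hL.elim
  · rcases h' : L'.base with c' | ⟨c', h₁', h₂'⟩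
    · rw [h'] at hL'
      exact hL'.elim
    · rw [h] at hg hL
      rw [h'] at hg' hL'
      rw [contourValue_loop_eq hP hz hzl hR hL hL' hg hg']

lemma foxH_eq_of_lineCase (hP : P.Valid) {z : ℂ} (hz : z ≠ 0) (hzl : P.LineCase z)
    {L : MBContour} (hL : L.base.IsLine) (hs : P.Separates L) : P.foxH z = P.mellinBarnes L z := by
  have h := Classical.epsilon_spec (p := fun L : MBContour => L.base.IsLine ∧ P.Separates L) ⟨L, hL, hs⟩
  rw [foxH, if_pos hzl]
  exact mellinBarnes_eq_of_isLine hP hz hzl h.1 hL h.2 hs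

lemma foxH_eq_of_loopCase (hP : P.Valid) {z : ℂ} (hz : z ≠ 0) (hzl : ¬P.LineCase z)
    (hzl' : P.LoopCase z) {L : MBContour} (hL : L.base.IsLoop) (hs : P.Separates L) :
    P.foxH z = P.mellinBarnes L z := by
  have h := Classical.epsilon_spec (p := fun L : MBContour => L.base.IsLoop ∧ P.Separates L) ⟨L, hL, hs⟩
  rw [foxH, if_neg hzl, if_pos hzl']
  exact mellinBarnes_eq_of_isLoop hP hz hzl' h.1 hL h.2 hs

end FoxParams

/-! ### The raised parameters -/

namespace FoxParams

variable {m n p q : ℕ} {P : FoxParams m n p q} {α : ℝ} {β μ : ℂ}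

/-- The parameter `1 - β - N + μ` occurs on both sides and contributes the last factor, which is `1`
where `β + N - μ + α s` is no pole of `Γ`, and `0` at the poles. -/
lemma raise_theta (hmq : m ≤ q) (s : ℂ) :
    (P.raise α β μ).theta s = P.theta s * (Gamma (β + α * s) * (Gamma (β - μ + α * s))⁻¹) *
      (Gamma (β + (⌊μ.re⌋₊ + 1 : ℕ) - μ + α * s) *
        (Gamma (β + (⌊μ.re⌋₊ + 1 : ℕ) - μ + α * s))⁻¹) := by
  unfold theta
  rw [Fin.prod_univ_castSucc, Fin.prod_univ_castSucc, Fin.prod_univ_succ, Fin.prod_univ_succ]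
  have h1 : ¬ (q < m) := not_lt.2 hmq
  have h2 : ¬ (q + 1 < m) := by omega
  have h3 : 1 - (1 - β - ((⌊μ.re⌋₊ + 1 : ℕ) : ℂ) + μ) + α * s
      = β + (⌊μ.re⌋₊ + 1 : ℕ) - μ + α * s := by ring
  have h4 : 1 - (1 - β + μ) + α * s = β - μ + α * s := by ring
  have h5 : 1 - (1 - β) + α * s = β + α * s := by ring
  simp only [raise, Fin.snoc_castSucc, Fin.snoc_last, Fin.val_castSucc, Fin.val_last, h1, h2,
    if_false, Matrix.cons_val_zero, Matrix.cons_val_succ, Fin.val_zero, Fin.val_succ, h3, h4, h5]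
  simp only [Nat.zero_lt_succ, if_true, Nat.add_lt_add_iff_right, zero_add,
    show 1 < n + 2 from by omega, add_assoc, one_add_one_eq_two]
  ring

lemma raise_Omega (hmq : m ≤ q) : (P.raise α β μ).Omega = P.Omega := by
  unfold Omega
  rw [Fin.sum_univ_succ, Fin.sum_univ_succ, Fin.sum_univ_castSucc, Fin.sum_univ_castSucc]
  have h1 : ¬ (q < m) := not_lt.2 hmq
  have h2 : ¬ (q + 1 < m) := by omega
  simp only [raise, Fin.snoc_castSucc, Fin.snoc_last, Fin.val_castSucc, Fin.val_last, h1, h2,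
    if_false, Matrix.cons_val_zero, Matrix.cons_val_succ, Fin.val_zero, Fin.val_succ]
  simp only [Nat.zero_lt_succ, if_true, Nat.add_lt_add_iff_right, zero_add,
    show 1 < n + 2 from by omega, add_assoc, one_add_one_eq_two]
  ring

lemma raise_Delta : (P.raise α β μ).Delta = P.Delta := by
  unfold Delta
  rw [Fin.sum_univ_castSucc, Fin.sum_univ_castSucc, Fin.sum_univ_succ, Fin.sum_univ_succ]
  simp only [raise, Fin.snoc_castSucc, Fin.snoc_last, Matrix.cons_val_zero, Matrix.cons_val_succ]
  ring

lemma raise_delta (hα : 0 < α) : (P.raise α β μ).delta = P.delta := by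
  unfold delta
  rw [Fin.prod_univ_succ, Fin.prod_univ_succ, Fin.prod_univ_castSucc, Fin.prod_univ_castSucc]
  simp only [raise, Fin.snoc_castSucc, Fin.snoc_last, Matrix.cons_val_zero, Matrix.cons_val_succ]
  have h := Real.rpow_pos_of_pos hα α
  rw [Real.rpow_neg hα.le]
  field_simp

lemma raise_lineCase (hmq : m ≤ q) (z : ℂ) : (P.raise α β μ).LineCase z ↔ P.LineCase z := by
  rw [LineCase, LineCase, raise_Omega hmq]

lemma raise_loopCase (hα : 0 < α) (z : ℂ) : (P.raise α β μ).LoopCase z ↔ P.LoopCase z := by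
  rw [LoopCase, LoopCase, raise_Delta, raise_delta hα]

lemma raise_rightPoles (hmq : m ≤ q) : (P.raise α β μ).rightPoles = P.rightPoles := by
  ext s
  constructor
  · rintro ⟨j, hj, k, rfl⟩
    obtain ⟨j, rfl⟩ : ∃ j' : Fin q, j = j'.castSucc.castSucc := ⟨⟨j, by omega⟩, rfl⟩
    exact ⟨j, hj, k, by simp only [raise, Fin.snoc_castSucc]⟩
  · rintro ⟨j, hj, k, rfl⟩
    refine ⟨j.castSucc.castSucc, hj, k, ?_⟩
    simp only [raise, Fin.snoc_castSucc]

lemma leftPoles_subset_raise : P.leftPoles ⊆ (P.raise α β μ).leftPoles := by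
  rintro s ⟨i, hi, k, rfl⟩
  refine ⟨i.succ.succ, by simpa using hi, k, ?_⟩
  simp [raise]

lemma mem_leftPoles_of_mem_raise (hα : 0 < α) {s : ℂ} (hs : s ∈ (P.raise α β μ).leftPoles)
    (h1 : 0 < β.re + α * s.re) (h2 : 0 < (β - μ).re + α * s.re) : s ∈ P.leftPoles := by
  obtain ⟨i, hi, k, rfl⟩ := hs
  refine Fin.cases (fun hi h1 h2 => ?_) (fun i => ?_) i hi h1 h2
  · exfalso
    simp only [raise, Matrix.cons_val_zero] at h1
    rw [div_ofReal_re, mul_div_cancel₀ _ hα.ne'] at h1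
    have hk : (0 : ℝ) ≤ k := k.cast_nonneg
    simp at h1
    linarith
  · refine Fin.cases (fun hi h1 h2 => ?_) (fun i hi h1 h2 => ?_) i
    · exfalso
      simp only [raise, Matrix.cons_val_zero, Matrix.cons_val_succ] at h2
      rw [div_ofReal_re, mul_div_cancel₀ _ hα.ne'] at h2
      have hk : (0 : ℝ) ≤ k := k.cast_nonneg
      have hN : (0 : ℝ) ≤ ⌊μ.re⌋₊ := Nat.cast_nonneg _
      simp at h2
      linarith
    · refine ⟨i, by simpa using hi, k, ?_⟩
      simp [raise]

/-- The left poles that the passage to the raised parameters adds lie to the left of all right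
poles. -/
lemma raise_valid (hmq : m ≤ q) (hP : P.Valid) (hα : 0 < α)
    (hβb : ∀ j : Fin q, (j : ℕ) < m → 0 < β.re + ((α : ℂ) * P.b j / (P.B j : ℂ)).re)
    (hβμb : ∀ j : Fin q, (j : ℕ) < m → 0 < (β - μ).re + ((α : ℂ) * P.b j / (P.B j : ℂ)).re) :
    (P.raise α β μ).Valid := by
  have hA : ∀ i, 0 < (P.raise α β μ).A i := by
    intro i
    refine Fin.cases ?_ (fun i => Fin.cases ?_ (fun i => ?_) i) i
    · simpa [raise] using hα
    · simpa [raise] using hα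
    · simpa [raise] using hP.A_pos i
  have hB : ∀ j, 0 < (P.raise α β μ).B j := by
    intro j
    refine Fin.lastCases ?_ (fun j => Fin.lastCases ?_ (fun j => ?_) j) j
    · simpa [raise] using hα
    · simpa [raise] using hα
    · simpa [raise] using hP.B_pos j
  refine ⟨hA, hB, fun i hi j hj k l h => ?_⟩
  have hA' : ((P.raise α β μ).A i : ℂ) ≠ 0 := by exact_mod_cast (hA i).ne'
  have hB' : ((P.raise α β μ).B j : ℂ) ≠ 0 := by exact_mod_cast (hB j).ne'
  set s : ℂ := ((P.raise α β μ).b j + k) / ((P.raise α β μ).B j : ℂ) with hs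
  have hsr : s ∈ P.rightPoles := by
    rw [← raise_rightPoles (α := α) (β := β) (μ := μ) hmq]
    exact ⟨j, hj, k, rfl⟩
  have hsl : s ∈ (P.raise α β μ).leftPoles := by
    refine ⟨i, hi, l, ?_⟩
    rw [hs, div_eq_div_iff hB' hA']
    linear_combination h
  obtain ⟨j', hj', k', hs'⟩ := hsr
  have hre : ((α : ℂ) * P.b j' / (P.B j' : ℂ)).re ≤ α * s.re := by
    rw [hs', div_ofReal_re, div_ofReal_re, re_ofReal_mul, mul_div_assoc]
    refine mul_le_mul_of_nonneg_left (div_le_div_of_nonneg_right (by simp) (hP.B_pos j').le) hα.le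
  have := mem_leftPoles_of_mem_raise hα hsl (by linarith [hβb j' hj']) (by linarith [hβμb j' hj'])
  exact Set.disjoint_left.1 (disjoint_poles hP) this ⟨j', hj', k', hs'⟩

/-- A contour that separates the raised poles also separates the original ones, provided it lies
to the right of the added left poles. -/
lemma Separates.of_raise (hmq : m ≤ q) (hα : 0 < α) {L : MBContour}
    (hL : (P.raise α β μ).Separates L) (h1 : 0 < β.re + α * L.base.minRe)
    (h2 : 0 < (β - μ).re + α * L.base.minRe) : P.Separates L where
  r_pos := hL.r_pos
  right_mem s hs := hL.right_mem s (by rwa [raise_rightPoles hmq])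
  left_off s hs := hL.left_off s (leftPoles_subset_raise hs)
  mem_indent s := by
    rw [hL.mem_indent]
    refine ⟨fun h => ⟨?_, h.2⟩, fun h => ⟨leftPoles_subset_raise h.1, h.2⟩⟩
    have := mul_lt_mul_of_pos_left (MBBase.minRe_lt_of_mem_right h.2) hα
    exact mem_leftPoles_of_mem_raise hα h.1 (by linarith) (by linarith)
  disc_subset := hL.disc_subset
  disc_left s hs u hu := hL.disc_left s hs u (leftPoles_subset_raise hu)
  disc_right s hs u hu := hL.disc_right s hs u (by rwa [raise_rightPoles hmq])

/-- There is room for a contour between the added left poles and the right poles. -/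
lemma exists_abscissa (hP : P.Valid) (hα : 0 < α)
    (hβb : ∀ j : Fin q, (j : ℕ) < m → 0 < β.re + ((α : ℂ) * P.b j / (P.B j : ℂ)).re)
    (hβμb : ∀ j : Fin q, (j : ℕ) < m → 0 < (β - μ).re + ((α : ℂ) * P.b j / (P.B j : ℂ)).re) :
    ∃ c d : ℝ, c < d ∧ 0 < β.re + α * c ∧ 0 < (β - μ).re + α * c ∧
      ∀ s ∈ P.rightPoles, d < s.re := by
  set e := max (-β.re / α) (-(β - μ).re / α) with he
  have hlt : ∀ j : Fin q, (j : ℕ) < m → e < (P.b j).re / P.B j := by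
    intro j hj
    have h1 := hβb j hj
    have h2 := hβμb j hj
    rw [div_ofReal_re, re_ofReal_mul, mul_div_assoc] at h1 h2
    rw [he, max_lt_iff, div_lt_iff₀ hα, div_lt_iff₀ hα]
    constructor <;> linarith
  have hev : ∀ᶠ d in 𝓝[>] e, ∀ j : Fin q, (j : ℕ) < m → d < (P.b j).re / P.B j := by
    rw [eventually_all]
    intro j
    by_cases hj : (j : ℕ) < m
    · filter_upwards [nhdsWithin_le_nhds (eventually_lt_nhds (hlt j hj))] with d hd _ using hd
    · exact Eventually.of_forall fun d h => absurd h hj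
  obtain ⟨d, hd, hed⟩ := (hev.and self_mem_nhdsWithin).exists
  obtain ⟨c, hc1, hc2⟩ := exists_between (show e < d from hed)
  rw [he, max_lt_iff, div_lt_iff₀ hα, div_lt_iff₀ hα] at hc1
  refine ⟨c, d, hc2, by linarith [hc1.1], by linarith [hc1.2], ?_⟩
  rintro s ⟨j, hj, k, rfl⟩
  refine (hd j hj).trans_le ?_
  rw [div_ofReal_re]
  exact div_le_div_of_nonneg_right (by simp) (hP.B_pos j).le

lemma exists_line_separates (hP : P.Valid) {c d : ℝ} (hcd : c < d)
    (hr : ∀ s ∈ P.rightPoles, d < s.re) :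
    ∃ L : MBContour, L.base.IsLine ∧ P.Separates L ∧ c < L.base.minRe := by
  obtain ⟨x, hx, hxne⟩ := exists_lt_forall_re_ne hP c d hcd
  have hg : P.GoodBase (.line x) := by
    refine ⟨fun s hs => hx.2.trans (hr s hs), fun s hs => ?_⟩
    rcases lt_or_gt_of_ne (hxne s hs) with h | h
    · exact Or.inr (not_le.2 h)
    · exact Or.inl h
  obtain ⟨L, hL, hs⟩ := hg.exists_separates hP
  refine ⟨L, ?_, hs, ?_⟩
  · rw [hL]; trivial
  · rw [hL]; exact hx.1

lemma exists_loop_separates (hP : P.Valid) {c d : ℝ} (hcd : c < d)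
    (hr : ∀ s ∈ P.rightPoles, d < s.re) :
    ∃ L : MBContour, L.base.IsLoop ∧ P.Separates L ∧ c < L.base.minRe := by
  obtain ⟨x, hx, hxne⟩ := exists_lt_forall_re_ne hP c d hcd
  obtain ⟨H, hH⟩ := ((finite_im_leftPoles (P := P)).union (finite_im_rightPoles (P := P))).bddAbove
  obtain ⟨h, hh⟩ := ((finite_im_leftPoles (P := P)).union (finite_im_rightPoles (P := P))).bddBelow
  have him : ∀ s, s ∈ P.leftPoles ∨ s ∈ P.rightPoles →
      min h H - 1 < s.im ∧ s.im < max h H + 1 := by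
    intro s hs
    have hs' : s.im ∈ Complex.im '' P.leftPoles ∪ Complex.im '' P.rightPoles :=
      hs.imp (fun h => ⟨s, h, rfl⟩) fun h => ⟨s, h, rfl⟩
    have h1 := hH hs'
    have h2 := hh hs'
    constructor
    · linarith [min_le_left h H]
    · linarith [le_max_right h H]
  have hg : P.GoodBase (.loop x (min h H - 1) (max h H + 1)) := by
    refine ⟨fun s hs => ⟨hx.2.trans (hr s hs), him s (Or.inr hs)⟩, fun s hs => ?_⟩
    rcases lt_or_gt_of_ne (hxne s hs) with h | h
    · exact Or.inr fun h' => not_le.2 h h'.1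
    · exact Or.inl ⟨h, him s (Or.inl hs)⟩
  obtain ⟨L, hL, hs⟩ := hg.exists_separates hP
  refine ⟨L, ?_, hs, ?_⟩
  · rw [hL]
    have := min_le_max (a := h) (b := H)
    show min h H - 1 < max h H + 1
    linarith
  · rw [hL]; exact hx.1

end FoxParams

/-! ### Fractional integrals of superpositions of powers -/

/-- The convolution kernel `u ^ (ν - 1) / Γ ν` of the Riemann-Liouville integral of order `ν`. -/
noncomputable def rlKernel (ν : ℂ) (u : ℝ) : ℂ := (u : ℂ) ^ (ν - 1) / Gamma ν

lemma measurable_rlKernel (ν : ℂ) : Measurable (rlKernel ν) :=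
  (measurable_ofReal.pow_const _).div_const _

lemma norm_rlKernel (ν : ℂ) {u : ℝ} (hu : 0 < u) :
    ‖rlKernel ν u‖ = ‖Gamma ν‖⁻¹ * u ^ (ν.re - 1) := by
  rw [rlKernel, norm_div, norm_cpow_eq_rpow_re_of_pos hu, sub_re, one_re, div_eq_inv_mul]

lemma intervalIntegrable_cpow_mul_cpow {a b : ℂ} (ha : 0 < a.re) (hb : 0 < b.re) {u : ℝ}
    (hu : 0 < u) : IntervalIntegrable
      (fun t : ℝ => (t : ℂ) ^ (a - 1) * ((u : ℂ) - t) ^ (b - 1)) volume 0 u := by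
  -- the Beta integral is not zero, so it is not the junk value of a divergent integral
  refine intervalIntegral.intervalIntegrable_of_integral_ne_zero ?_
  rw [betaIntegral_scaled _ _ hu, betaIntegral_eq_Gamma_mul_div _ _ ha hb]
  refine mul_ne_zero ?_ (div_ne_zero (mul_ne_zero (Gamma_ne_zero_of_re_pos ha)
    (Gamma_ne_zero_of_re_pos hb)) (Gamma_ne_zero_of_re_pos (by simp; linarith)))
  rw [Ne, cpow_eq_zero_iff, ofReal_eq_zero]
  exact fun h => hu.ne' h.1

lemma integrableOn_rpow_mul_rpow {a b : ℝ} (ha : 0 < a) (hb : 0 < b) {u : ℝ} (hu : 0 < u) :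
    IntegrableOn (fun t : ℝ => t ^ (a - 1) * (u - t) ^ (b - 1)) (Ioo 0 u) := by
  have h := (intervalIntegrable_cpow_mul_cpow (a := a) (b := b) (by simpa) (by simpa) hu).norm
  rw [intervalIntegrable_iff_integrableOn_Ioo_of_le hu.le] at h
  refine h.congr_fun (fun t ht => ?_) measurableSet_Ioo
  simp only
  rw [norm_mul, ← ofReal_sub, norm_cpow_eq_rpow_re_of_pos ht.1,
    norm_cpow_eq_rpow_re_of_pos (sub_pos.2 ht.2)]
  simp

lemma integral_rpow_mul_rpow (a b : ℝ) :
    ∃ B : ℝ, 0 ≤ B ∧ ∀ u : ℝ, 0 < u →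
      ∫ t in Ioo 0 u, t ^ (a - 1) * (u - t) ^ (b - 1) = u ^ (a + b - 1) * B := by
  refine ⟨∫ t in Ioo (0 : ℝ) 1, t ^ (a - 1) * (1 - t) ^ (b - 1), ?_, fun u hu => ?_⟩
  · exact setIntegral_nonneg measurableSet_Ioo fun t ht => mul_nonneg
      (Real.rpow_nonneg ht.1.le _) (Real.rpow_nonneg (sub_pos.2 ht.2).le _)
  have key : ∀ u : ℝ, 0 < u → ((∫ t in Ioo 0 u, t ^ (a - 1) * (u - t) ^ (b - 1) : ℝ) : ℂ) =
      ∫ t in (0 : ℝ)..u, (t : ℂ) ^ ((a : ℂ) - 1) * ((u : ℂ) - t) ^ ((b : ℂ) - 1) := by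
    intro u hu
    rw [intervalIntegral.integral_of_le hu.le, integral_Ioc_eq_integral_Ioo, ← integral_complex_ofReal]
    refine setIntegral_congr_fun measurableSet_Ioo fun t ht => ?_
    simp only [ofReal_mul]
    rw [ofReal_cpow ht.1.le, ofReal_cpow (sub_pos.2 ht.2).le]
    push_cast
    rfl
  rw [← ofReal_inj, key u hu, betaIntegral_scaled _ _ hu, ofReal_mul, key 1 one_pos,
    betaIntegral_scaled _ _ one_pos, ofReal_cpow hu.le]
  simp

lemma integral_rlKernel_mul_cpow {l ν : ℂ} (hl : 0 < l.re) (hν : 0 < ν.re) {u : ℝ} (hu : 0 < u) :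
    ∫ t in (0 : ℝ)..u, rlKernel ν (u - t) * (t : ℂ) ^ (l - 1) =
      Gamma l / Gamma (l + ν) * (u : ℂ) ^ (l + ν - 1) := by
  have h := betaIntegral_scaled l ν hu
  rw [betaIntegral_eq_Gamma_mul_div _ _ hl hν] at h
  have h2 : ∀ t : ℝ, rlKernel ν (u - t) * (t : ℂ) ^ (l - 1) =
      (Gamma ν)⁻¹ * ((t : ℂ) ^ (l - 1) * ((u : ℂ) - t) ^ (ν - 1)) := by
    intro t
    rw [rlKernel]
    push_cast
    ring
  simp_rw [h2]
  rw [intervalIntegral.integral_const_mul, h]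
  have := Gamma_ne_zero_of_re_pos hν
  field_simp

section PowerIntegral

variable {X : Type*} [MeasurableSpace X] {η : Measure X} {g l : X → ℂ} {R r : ℝ}

/-- A superposition of the powers `u ^ (l x - 1)` with weights `g x`. -/
noncomputable def powIntegral (η : Measure X) (g l : X → ℂ) (u : ℝ) : ℂ :=
  ∫ x, g x * (u : ℂ) ^ (l x - 1) ∂η

lemma rpow_sub_one_le {u R r s : ℝ} (hu : 0 < u) (huR : u ≤ R) (hrs : r ≤ s) :
    u ^ (s - 1) ≤ R ^ (s - r) * u ^ (r - 1) := by
  rw [show s - 1 = (s - r) + (r - 1) by ring, Real.rpow_add hu]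
  exact mul_le_mul_of_nonneg_right (Real.rpow_le_rpow hu.le huR (by linarith))
    (Real.rpow_nonneg hu.le _)

lemma norm_mul_cpow_sub_one_le {u : ℝ} {g l : ℂ} (hu : 0 < u) (huR : u ≤ R) (hl : r ≤ l.re) :
    ‖g * (u : ℂ) ^ (l - 1)‖ ≤ R ^ (-r) * u ^ (r - 1) * (‖g‖ * R ^ l.re) := by
  have hR := hu.trans_le huR
  rw [norm_mul, norm_cpow_eq_rpow_re_of_pos hu, sub_re, one_re]
  refine (mul_le_mul_of_nonneg_left (rpow_sub_one_le hu huR hl) (norm_nonneg _)).trans_eq ?_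
  rw [sub_eq_add_neg, Real.rpow_add hR]
  ring

lemma norm_powIntegral_le (hl : ∀ᵐ x ∂η, r ≤ (l x).re)
    (hg : Integrable (fun x => ‖g x‖ * R ^ (l x).re) η) {u : ℝ} (hu : 0 < u) (huR : u ≤ R) :
    ‖powIntegral η g l u‖ ≤ (R ^ (-r) * ∫ x, ‖g x‖ * R ^ (l x).re ∂η) * u ^ (r - 1) := by
  refine (norm_integral_le_of_norm_le (hg.const_mul (R ^ (-r) * u ^ (r - 1))) ?_).trans_eq ?_
  · filter_upwards [hl] with x hx
    exact norm_mul_cpow_sub_one_le hu huR hx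
  · rw [integral_const_mul]
    ring

lemma continuousOn_powIntegral (hgm : Measurable g) (hlm : Measurable l)
    (hl : ∀ᵐ x ∂η, r ≤ (l x).re) (hg : Integrable (fun x => ‖g x‖ * R ^ (l x).re) η) :
    ContinuousOn (powIntegral η g l) (Ioo 0 R) := by
  intro u hu
  refine (continuousAt_of_dominated (bound := fun x =>
    R ^ (-r) * (u ^ (r - 1) + 1) * (‖g x‖ * R ^ (l x).re)) ?_ ?_ (hg.const_mul _)
    ?_).continuousWithinAt
  · exact Eventually.of_forall fun v =>
      (hgm.mul (measurable_const.pow (hlm.sub_const 1))).aestronglyMeasurable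
  · have h1 : ∀ᶠ v in 𝓝 u, v ^ (r - 1) < u ^ (r - 1) + 1 :=
      (Real.continuousAt_rpow_const u (r - 1) (Or.inl hu.1.ne')).eventually_lt_const (by linarith)
    have hR := hu.1.trans hu.2
    filter_upwards [h1, Ioo_mem_nhds hu.1 hu.2] with v hv hv'
    filter_upwards [hl] with x hx
    refine (norm_mul_cpow_sub_one_le hv'.1 hv'.2.le hx).trans ?_
    gcongr
  · refine Eventually.of_forall fun x => continuousAt_const.mul ?_
    exact ContinuousAt.cpow continuous_ofReal.continuousAt continuousAt_const
      (ofReal_mem_slitPlane.2 hu.1)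

variable [SFinite η]

/-- The fractional integral of a superposition of powers is a superposition of powers. -/
lemma integral_rlKernel_mul_powIntegral (hgm : Measurable g) (hlm : Measurable l) (hr : 0 < r)
    (hl : ∀ᵐ x ∂η, r ≤ (l x).re) (hg : Integrable (fun x => ‖g x‖ * R ^ (l x).re) η) {ν : ℂ}
    (hν : 0 < ν.re) {u : ℝ} (hu : 0 < u) (huR : u ≤ R) :
    ∫ t in (0 : ℝ)..u, rlKernel ν (u - t) * powIntegral η g l t =
      powIntegral η (fun x => g x * (Gamma (l x) / Gamma (l x + ν))) (fun x => l x + ν) u := by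
  have hR := hu.trans_le huR
  have hint : Integrable (Function.uncurry fun (t : ℝ) (x : X) =>
      rlKernel ν (u - t) * (g x * (t : ℂ) ^ (l x - 1))) ((volume.restrict (Ioo 0 u)).prod η) := by
    have h1 : IntegrableOn (fun t : ℝ => ‖Gamma ν‖⁻¹ * R ^ (-r) *
        (t ^ (r - 1) * (u - t) ^ (ν.re - 1))) (Ioo 0 u) :=
      (integrableOn_rpow_mul_rpow hr hν hu).const_mul _
    refine (Integrable.mul_prod h1 hg).mono' ?_ ?_
    · refine Measurable.aestronglyMeasurable ?_
      refine ((measurable_rlKernel ν).comp (measurable_const.sub measurable_fst)).mul ?_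
      refine (hgm.comp measurable_snd).mul ?_
      exact (measurable_ofReal.comp measurable_fst).pow ((hlm.comp measurable_snd).sub_const 1)
    · have h2 : ∀ᵐ z : ℝ × X ∂((volume.restrict (Ioo 0 u)).prod η), r ≤ (l z.2).re :=
        Measure.quasiMeasurePreserving_snd.ae hl
      have h3 : ∀ᵐ z : ℝ × X ∂((volume.restrict (Ioo 0 u)).prod η), z.1 ∈ Ioo 0 u :=
        Measure.quasiMeasurePreserving_fst.ae (ae_restrict_mem measurableSet_Ioo)
      filter_upwards [h2, h3] with z hz hz'
      simp only [Function.uncurry]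
      rw [norm_mul, norm_rlKernel ν (sub_pos.2 hz'.2)]
      refine (mul_le_mul_of_nonneg_left (norm_mul_cpow_sub_one_le (R := R) hz'.1
        (hz'.2.le.trans huR) hz) (mul_nonneg (inv_nonneg.2 (norm_nonneg _))
        (Real.rpow_nonneg (sub_pos.2 hz'.2).le _))).trans_eq ?_
      ring
  rw [intervalIntegral.integral_of_le hu.le, integral_Ioc_eq_integral_Ioo]
  simp only [powIntegral, ← integral_const_mul]
  rw [integral_integral_swap hint]
  refine integral_congr_ae ?_
  filter_upwards [hl] with x hx
  rw [← integral_Ioc_eq_integral_Ioo, ← intervalIntegral.integral_of_le hu.le, mul_assoc,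
    ← integral_rlKernel_mul_cpow (hr.trans_le hx) hν hu, ← intervalIntegral.integral_const_mul]
  congr 1
  ext t
  ring

end PowerIntegral

/-- On `(0, R)`, the functions `K` and `K'` are continuous, dominated by `u ^ (ρ - 1)` and
`u ^ (σ - 1)`, and the Riemann-Liouville integral of order `ν` of `K` is that of order `ν'`
of `K'`. -/
structure RLPair (R ρ σ : ℝ) (ν ν' : ℂ) (K K' : ℝ → ℂ) : Prop where
  continuousOn_left : ContinuousOn K (Ioo 0 R)
  continuousOn_right : ContinuousOn K' (Ioo 0 R)
  bound_left : ∃ C, ∀ u ∈ Ioo 0 R, ‖K u‖ ≤ C * u ^ (ρ - 1)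
  bound_right : ∃ C, ∀ u ∈ Ioo 0 R, ‖K' u‖ ≤ C * u ^ (σ - 1)
  integral_eq : ∀ u ∈ Ioo 0 R,
    ∫ t in (0 : ℝ)..u, rlKernel ν (u - t) * K t = ∫ t in (0 : ℝ)..u, rlKernel ν' (u - t) * K' t

/-- A function dominated by `u ^ (ρ - 1)` near `0` has fractional integrals. -/
lemma intervalIntegrable_rlKernel_mul {K : ℝ → ℂ} {R ρ C : ℝ} {ν : ℂ} (hρ : 0 < ρ) (hν : 0 < ν.re)
    (hK : ContinuousOn K (Ioo 0 R))
    (hC : ∀ u ∈ Ioo 0 R, ‖K u‖ ≤ C * u ^ (ρ - 1)) {u : ℝ} (hu : u ∈ Ioo 0 R) :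
    IntervalIntegrable (fun t => rlKernel ν (u - t) * K t) volume 0 u := by
  rw [intervalIntegrable_iff_integrableOn_Ioo_of_le hu.1.le]
  have h1 := (integrableOn_rpow_mul_rpow hρ hν hu.1).const_mul (‖Gamma ν‖⁻¹ * C)
  refine Integrable.mono' h1 ?_ ?_
  · refine AEStronglyMeasurable.mul ?_ ((hK.mono (Ioo_subset_Ioo_right
      hu.2.le)).aestronglyMeasurable measurableSet_Ioo)
    exact ((measurable_rlKernel ν).comp (measurable_const.sub measurable_id)).aestronglyMeasurable
  · filter_upwards [ae_restrict_mem measurableSet_Ioo] with t ht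
    rw [norm_mul, norm_rlKernel ν (sub_pos.2 ht.2)]
    refine (mul_le_mul_of_nonneg_left (hC t ⟨ht.1, ht.2.trans hu.2⟩) (mul_nonneg
      (inv_nonneg.2 (norm_nonneg _)) (Real.rpow_nonneg (sub_pos.2 ht.2).le _))).trans_eq ?_
    ring

namespace RLPair

variable {R ρ σ : ℝ} {ν ν' : ℂ} {K K' J J' : ℝ → ℂ}

lemma congr (h : RLPair R ρ σ ν ν' K K') (hJ : ∀ u ∈ Ioo 0 R, K u = J u)
    (hJ' : ∀ u ∈ Ioo 0 R, K' u = J' u) : RLPair R ρ σ ν ν' J J' where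
  continuousOn_left := h.continuousOn_left.congr fun u hu => (hJ u hu).symm
  continuousOn_right := h.continuousOn_right.congr fun u hu => (hJ' u hu).symm
  bound_left := h.bound_left.imp fun C hC u hu => hJ u hu ▸ hC u hu
  bound_right := h.bound_right.imp fun C hC u hu => hJ' u hu ▸ hC u hu
  integral_eq u hu := by
    have h1 := h.integral_eq u hu
    rw [intervalIntegral.integral_of_le hu.1.le, intervalIntegral.integral_of_le hu.1.le,
      integral_Ioc_eq_integral_Ioo, integral_Ioc_eq_integral_Ioo] at h1 ⊢
    rw [setIntegral_congr_fun measurableSet_Ioo fun t ht => ?_, h1,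
      setIntegral_congr_fun measurableSet_Ioo fun t ht => ?_]
    · simp only [hJ' t ⟨ht.1, ht.2.trans hu.2⟩]
    · simp only [hJ t ⟨ht.1, ht.2.trans hu.2⟩]

lemma const_mul (h : RLPair R ρ σ ν ν' K K') (c : ℂ) :
    RLPair R ρ σ ν ν' (fun u => c * K u) (fun u => c * K' u) where
  continuousOn_left := continuousOn_const.mul h.continuousOn_left
  continuousOn_right := continuousOn_const.mul h.continuousOn_right
  bound_left := by
    obtain ⟨C, hC⟩ := h.bound_left
    refine ⟨‖c‖ * C, fun u hu => ?_⟩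
    rw [norm_mul, mul_assoc]
    exact mul_le_mul_of_nonneg_left (hC u hu) (norm_nonneg _)
  bound_right := by
    obtain ⟨C, hC⟩ := h.bound_right
    refine ⟨‖c‖ * C, fun u hu => ?_⟩
    rw [norm_mul, mul_assoc]
    exact mul_le_mul_of_nonneg_left (hC u hu) (norm_nonneg _)
  integral_eq u hu := by
    simp only [mul_left_comm _ c, intervalIntegral.integral_const_mul, h.integral_eq u hu]

lemma add (hρ : 0 < ρ) (hσ : 0 < σ) (hν : 0 < ν.re) (hν' : 0 < ν'.re)
    (h : RLPair R ρ σ ν ν' K K') (h' : RLPair R ρ σ ν ν' J J') :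
    RLPair R ρ σ ν ν' (fun u => K u + J u) (fun u => K' u + J' u) := by
  obtain ⟨C, hC⟩ := h.bound_left
  obtain ⟨D, hD⟩ := h.bound_right
  obtain ⟨C', hC'⟩ := h'.bound_left
  obtain ⟨D', hD'⟩ := h'.bound_right
  refine ⟨h.continuousOn_left.add h'.continuousOn_left,
    h.continuousOn_right.add h'.continuousOn_right, ⟨C + C', fun u hu => ?_⟩,
    ⟨D + D', fun u hu => ?_⟩, fun u hu => ?_⟩
  · rw [add_mul]
    exact (norm_add_le _ _).trans (add_le_add (hC u hu) (hC' u hu))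
  · rw [add_mul]
    exact (norm_add_le _ _).trans (add_le_add (hD u hu) (hD' u hu))
  · simp only [mul_add]
    rw [intervalIntegral.integral_add (intervalIntegrable_rlKernel_mul hρ hν h.continuousOn_left hC hu)
        (intervalIntegrable_rlKernel_mul hρ hν h'.continuousOn_left hC' hu),
      intervalIntegral.integral_add (intervalIntegrable_rlKernel_mul hσ hν' h.continuousOn_right hD hu)
        (intervalIntegrable_rlKernel_mul hσ hν' h'.continuousOn_right hD' hu),
      h.integral_eq u hu, h'.integral_eq u hu]

lemma zero : RLPair R ρ σ ν ν' (fun _ => 0) (fun _ => 0) :=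
  ⟨continuousOn_const, continuousOn_const, ⟨0, by simp⟩, ⟨0, by simp⟩, by simp⟩

lemma sum (hρ : 0 < ρ) (hσ : 0 < σ) (hν : 0 < ν.re) (hν' : 0 < ν'.re) {ι : Type*} {s : Finset ι}
    {K K' : ι → ℝ → ℂ} (h : ∀ i ∈ s, RLPair R ρ σ ν ν' (K i) (K' i)) :
    RLPair R ρ σ ν ν' (fun u => ∑ i ∈ s, K i u) (fun u => ∑ i ∈ s, K' i u) := by
  classical
  induction s using Finset.induction_on with
  | empty => simpa using zero
  | insert i s hi ih =>
    simp only [Finset.sum_insert hi]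
    exact (h i (Finset.mem_insert_self i s)).add hρ hσ hν hν'
      (ih fun j hj => h j (Finset.mem_insert_of_mem hj))

/-- Superpositions of powers whose weights differ by the quotient of Gamma functions that a
fractional integration produces. -/
lemma powIntegral {X : Type*} [MeasurableSpace X] {η : Measure X} [SFinite η] {g g' l l' : X → ℂ}
    (hρ : 0 < ρ) (hσ : 0 < σ) (hν : 0 < ν.re) (hν' : 0 < ν'.re)
    (hgm : Measurable g) (hgm' : Measurable g') (hlm : Measurable l) (hlm' : Measurable l')
    (hl : ∀ᵐ x ∂η, ρ ≤ (l x).re) (hl' : ∀ᵐ x ∂η, σ ≤ (l' x).re)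
    (hg : Integrable (fun x => ‖g x‖ * R ^ (l x).re) η)
    (hg' : Integrable (fun x => ‖g' x‖ * R ^ (l' x).re) η)
    (hll' : ∀ x, l x + ν = l' x + ν')
    (hgg' : ∀ᵐ x ∂η, g x * Gamma (l x) = g' x * Gamma (l' x)) :
    RLPair R ρ σ ν ν' (powIntegral η g l) (powIntegral η g' l') where
  continuousOn_left := continuousOn_powIntegral hgm hlm hl hg
  continuousOn_right := continuousOn_powIntegral hgm' hlm' hl' hg'
  bound_left := ⟨_, fun _ hu => norm_powIntegral_le hl hg hu.1 hu.2.le⟩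
  bound_right := ⟨_, fun _ hu => norm_powIntegral_le hl' hg' hu.1 hu.2.le⟩
  integral_eq u hu := by
    rw [integral_rlKernel_mul_powIntegral hgm hlm hρ hl hg hν hu.1 hu.2.le,
      integral_rlKernel_mul_powIntegral hgm' hlm' hσ hl' hg' hν' hu.1 hu.2.le]
    refine integral_congr_ae ?_
    filter_upwards [hgg'] with x hx
    rw [hll', mul_div_assoc', hx, mul_div_assoc']

end RLPair

/-! ### The kernels of the two operators -/

lemma cpow_mul_ofReal_rpow {w : ℂ} (hw : w ≠ 0) {u : ℝ} (hu : 0 < u) (α : ℝ) (s : ℂ) :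
    (w * ((u ^ α : ℝ) : ℂ)) ^ s = w ^ s * (u : ℂ) ^ (α * s) := by
  have h := Real.rpow_pos_of_pos hu α
  have hu' : (u : ℂ) ≠ 0 := by exact_mod_cast hu.ne'
  rw [cpow_def_of_ne_zero (mul_ne_zero hw (by exact_mod_cast h.ne')), log_mul_ofReal _ h _ hw,
    cpow_def_of_ne_zero hw, cpow_def_of_ne_zero hu', ← Complex.exp_add, Real.log_rpow hu,
    ← ofReal_log hu.le]
  congr 1
  push_cast
  ring

namespace FoxParams

variable {m n p q : ℕ} {P : FoxParams m n p q} {α : ℝ} {β μ w z : ℂ} {L : MBContour}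

/-! ### Integrability along the parts of a contour -/

lemma integrable_line (hP : P.Valid) (hz : z ≠ 0) (hzl : P.LineCase z) {c : ℝ}
    (hb : P.GoodBase (.line c)) : Integrable fun y : ℝ => P.integrand z (c + y * I) := by
  obtain ⟨κ, hκ, hd⟩ := hzl.exists_stripDecay hP hz
  exact hd.integrable hκ fun y => continuousAt_integrand_of_goodBase hP hz hb
    (by simp [MBBase.closedRight]) (by simp [MBBase.right])

lemma integrableOn_ray (hP : P.Valid) (hz : z ≠ 0) (hzl : P.LoopCase z) {c h₁ h₂ h : ℝ}
    (hh : h₁ < h₂) (hb : P.GoodBase (.loop c h₁ h₂)) (hh' : h = h₁ ∨ h = h₂) :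
    IntegrableOn (fun x : ℝ => P.integrand z (x + h * I)) (Ioi c) := by
  obtain ⟨κ, hκ, hd⟩ := hzl.exists_horizontalDecay hP hz (Y := {h}) isCompact_singleton
    fun s hs hs' => by
      have := (hb.1 s hs).2
      rw [mem_singleton_iff] at hs'
      rcases hh' with rfl | rfl <;> rw [hs'] at this <;> linarith [this.1, this.2]
  refine hd.integrableOn hκ fun x hx => continuousAt_integrand_of_goodBase hP hz hb ?_ ?_
  · rcases hh' with rfl | rfl <;> simp [MBBase.closedRight, hx, hh.le]
  · rcases hh' with rfl | rfl <;> simp [MBBase.right]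

lemma integrableOn_segment (hP : P.Valid) (hz : z ≠ 0) {c h₁ h₂ : ℝ}
    (hb : P.GoodBase (.loop c h₁ h₂)) :
    IntegrableOn (fun y : ℝ => P.integrand z (c + y * I)) (Ioc h₁ h₂) := by
  refine (ContinuousOn.integrableOn_Icc fun y hy => ?_).mono_set Ioc_subset_Icc_self
  refine (continuousAt_comp_vertical (continuousAt_integrand_of_goodBase hP hz hb
    ?_ ?_)).continuousWithinAt
  · simpa [MBBase.closedRight] using hy
  · simp [MBBase.right]

lemma Separates.integrableOn_circle (hP : P.Valid) (hz : z ≠ 0) (hL : P.Separates L) {s : ℂ}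
    (hs : s ∈ L.indent) : IntegrableOn
      (fun t : ℝ => P.integrand z (circleMap s L.r t) * deriv (circleMap s L.r) t)
      (Ioc 0 (2 * Real.pi)) := by
  refine (ContinuousOn.integrableOn_Icc fun y hy => ?_).mono_set Ioc_subset_Icc_self
  have hr := hL.isolatingRadius hs
  have h := hr.2 (circleMap s L.r y) (circleMap_mem_closedBall s hr.1.le y)
    (circleMap_ne_center hr.1.ne')
  refine ContinuousAt.continuousWithinAt (ContinuousAt.mul ?_ ?_)
  · exact ContinuousAt.comp (f := circleMap s L.r)
      (differentiableAt_integrand hP hz h.1 h.2).continuousAt (continuous_circleMap s L.r).continuousAt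
  · simp_rw [funext (deriv_circleMap s L.r)]
    fun_prop

lemma norm_integrand_mul (hw : w ≠ 0) {u : ℝ} (hu : 0 < u) (s v : ℂ) :
    ‖P.integrand (w * ((u ^ α : ℝ) : ℂ)) s * v‖ = ‖P.theta s * w ^ s * v‖ * u ^ (α * s.re) := by
  rw [integrand, cpow_mul_ofReal_rpow hw hu, ← mul_assoc, norm_mul, norm_mul _ ((u : ℂ) ^ _),
    norm_cpow_eq_rpow_re_of_pos hu, re_ofReal_mul, norm_mul (_ * _) v]
  ring

lemma integrand_eq_powIntegral (hw : w ≠ 0) {u : ℝ} (hu : 0 < u) (γ ω : ℝ → ℂ) (S : Set ℝ) :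
    powIntegral (volume.restrict S) (fun t => P.theta (γ t) * w ^ γ t * ω t)
        (fun t => β + α * γ t) u =
      (u : ℂ) ^ (β - 1) * ∫ t in S, P.integrand (w * ((u ^ α : ℝ) : ℂ)) (γ t) * ω t := by
  have hu' : (u : ℂ) ≠ 0 := by exact_mod_cast hu.ne'
  rw [powIntegral, ← integral_const_mul]
  congr 1
  ext t
  rw [integrand, cpow_mul_ofReal_rpow hw hu, add_sub_right_comm, cpow_add _ _ hu']
  ring

/-- The contributions of a part of the contour, parametrized by `γ` with speed `ω`, to the two
kernels. The integrands differ by the factor `Γ (β + α s) / Γ (β - μ + α s)`, which is what the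
two fractional integrations produce. -/
lemma rlPair_part (hmq : m ≤ q) (hα : 0 < α) (hw : w ≠ 0) {R c : ℝ} (hR : 0 < R)
    (h1 : 0 < β.re + α * c) (h2 : 0 < (β - μ).re + α * c) {γ ω : ℝ → ℂ} {S : Set ℝ}
    (hS : MeasurableSet S) (hγ : Measurable γ) (hω : Measurable ω) (hre : ∀ t ∈ S, c ≤ (γ t).re)
    (hint : IntegrableOn (fun t => P.integrand (w * ((R ^ α : ℝ) : ℂ)) (γ t) * ω t) S)
    (hint' : IntegrableOn
      (fun t => (P.raise α β μ).integrand (w * ((R ^ α : ℝ) : ℂ)) (γ t) * ω t) S) :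
    RLPair R (β.re + α * c) ((β - μ).re + α * c) (((⌊μ.re⌋₊ + 1 : ℕ) : ℂ) - μ)
      ((⌊μ.re⌋₊ + 1 : ℕ) : ℂ)
      (fun u => (u : ℂ) ^ (β - 1) * ∫ t in S, P.integrand (w * ((u ^ α : ℝ) : ℂ)) (γ t) * ω t)
      (fun u => (u : ℂ) ^ (β - μ - 1) *
        ∫ t in S, (P.raise α β μ).integrand (w * ((u ^ α : ℝ) : ℂ)) (γ t) * ω t) := by
  have hν : 0 < ((((⌊μ.re⌋₊ + 1 : ℕ) : ℂ)) - μ).re := by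
    rw [sub_re, natCast_re]
    push_cast
    linarith [Nat.lt_floor_add_one μ.re]
  have hae : ∀ᵐ t ∂volume.restrict S, c ≤ (γ t).re := ae_restrict_of_forall_mem hS hre
  have hmeas : ∀ {m n p q : ℕ} (Q : FoxParams m n p q),
      Measurable fun t => Q.theta (γ t) * w ^ γ t * ω t := fun Q =>
    ((Q.meromorphic_theta.measurable.comp hγ).mul (measurable_const.pow hγ)).mul hω
  have hintg : ∀ {m n p q : ℕ} (Q : FoxParams m n p q) (l : ℂ),
      IntegrableOn (fun t => Q.integrand (w * ((R ^ α : ℝ) : ℂ)) (γ t) * ω t) S →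
      Integrable (fun t => ‖Q.theta (γ t) * w ^ γ t * ω t‖ * R ^ (l + α * γ t).re)
        (volume.restrict S) := by
    intro m n p q Q l h
    refine (h.norm.const_mul (R ^ l.re)).congr (Eventually.of_forall fun t => ?_)
    simp only
    rw [norm_integrand_mul hw hR, add_re, re_ofReal_mul, Real.rpow_add hR]
    ring
  refine (RLPair.powIntegral (η := volume.restrict S)
    (g := fun t => P.theta (γ t) * w ^ γ t * ω t)
    (g' := fun t => (P.raise α β μ).theta (γ t) * w ^ γ t * ω t) (l := fun t => β + α * γ t)
    (l' := fun t => β - μ + α * γ t) h1 h2 hν ?_ (hmeas _) (hmeas _)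
    (measurable_const.add (measurable_const.mul hγ))
    (measurable_const.add (measurable_const.mul hγ)) ?_ ?_ (hintg _ _ hint) (hintg _ _ hint') ?_
    ?_).congr (fun u hu => integrand_eq_powIntegral hw hu.1 γ ω S)
    (fun u hu => integrand_eq_powIntegral hw hu.1 γ ω S)
  · rw [natCast_re]
    positivity
  · filter_upwards [hae] with t ht
    rw [add_re, re_ofReal_mul]
    gcongr
  · filter_upwards [hae] with t ht
    rw [add_re (β - μ), re_ofReal_mul]
    gcongr
  · intro t
    ring
  · filter_upwards [hae] with t ht
    have h3 := mul_le_mul_of_nonneg_left ht hα.le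
    have h4 : Gamma (β - μ + α * γ t) ≠ 0 := Gamma_ne_zero_of_re_pos (by
      rw [add_re (β - μ), re_ofReal_mul]
      linarith)
    have h5 : Gamma (β + (⌊μ.re⌋₊ + 1 : ℕ) - μ + α * γ t) ≠ 0 := Gamma_ne_zero_of_re_pos (by
      rw [add_re _ (α * γ t), re_ofReal_mul, add_sub_assoc, add_re β]
      linarith)
    rw [raise_theta hmq, mul_inv_cancel₀ h5, mul_one]
    field_simp

lemma rlPair_mellinBarnes (hmq : m ≤ q) (hα : 0 < α) (hw : w ≠ 0) (hP : P.Valid)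
    (hP' : (P.raise α β μ).Valid) {R : ℝ} (hR : 0 < R)
    (h1 : 0 < β.re + α * L.base.minRe) (h2 : 0 < (β - μ).re + α * L.base.minRe)
    (hL' : (P.raise α β μ).Separates L)
    (hcase : L.base.IsLine ∧ P.LineCase (w * ((R ^ α : ℝ) : ℂ)) ∨
      L.base.IsLoop ∧ P.LoopCase (w * ((R ^ α : ℝ) : ℂ))) :
    RLPair R (β.re + α * L.base.minRe) ((β - μ).re + α * L.base.minRe)
      (((⌊μ.re⌋₊ + 1 : ℕ) : ℂ) - μ) ((⌊μ.re⌋₊ + 1 : ℕ) : ℂ)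
      (fun u => (u : ℂ) ^ (β - 1) * P.mellinBarnes L (w * ((u ^ α : ℝ) : ℂ)))
      (fun u => (u : ℂ) ^ (β - μ - 1) *
        (P.raise α β μ).mellinBarnes L (w * ((u ^ α : ℝ) : ℂ))) := by
  have hL := hL'.of_raise hmq hα h1 h2
  have hz : w * ((R ^ α : ℝ) : ℂ) ≠ 0 :=
    mul_ne_zero hw (by exact_mod_cast (Real.rpow_pos_of_pos hR α).ne')
  have hν : 0 < ((((⌊μ.re⌋₊ + 1 : ℕ) : ℂ)) - μ).re := by
    rw [sub_re, natCast_re]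
    push_cast
    linarith [Nat.lt_floor_add_one μ.re]
  have hν' : 0 < (((⌊μ.re⌋₊ + 1 : ℕ) : ℂ)).re := by
    rw [natCast_re]
    positivity
  have hcirc := RLPair.sum h1 h2 hν hν' (s := L.indent) fun s hs =>
    rlPair_part (P := P) hmq hα hw hR h1 h2 (γ := circleMap s L.r) (ω := deriv (circleMap s L.r))
      measurableSet_Ioc (continuous_circleMap s L.r).measurable (measurable_deriv _)
      (fun t _ => (MBBase.minRe_lt_of_mem_right (hL.disc_subset s hs
        (circleMap_mem_closedBall s hL.r_pos.le t))).le)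
      (hL.integrableOn_circle hP hz hs) (hL'.integrableOn_circle hP' hz hs)
  have hbase : RLPair R (β.re + α * L.base.minRe) ((β - μ).re + α * L.base.minRe)
      (((⌊μ.re⌋₊ + 1 : ℕ) : ℂ) - μ) ((⌊μ.re⌋₊ + 1 : ℕ) : ℂ)
      (fun u => (u : ℂ) ^ (β - 1) * L.base.integral (P.integrand (w * ((u ^ α : ℝ) : ℂ))))
      (fun u => (u : ℂ) ^ (β - μ - 1) *
        L.base.integral ((P.raise α β μ).integrand (w * ((u ^ α : ℝ) : ℂ)))) := by
    have hg := hL.goodBase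
    have hg' := hL'.goodBase
    obtain ⟨b, T, r⟩ := L
    simp only at hg hg' hcase h1 h2 ⊢
    cases b with
    | line c =>
      have hl := (hcase.resolve_right fun h => h.1).2
      have hl' := (raise_lineCase (α := α) (β := β) (μ := μ) hmq _).2 hl
      refine (rlPair_part (P := P) hmq hα hw hR h1 h2 (γ := fun y => c + y * I) (ω := fun _ => I)
        MeasurableSet.univ (by fun_prop) measurable_const (fun t _ => by simp [MBBase.minRe]) ?_
        ?_).congr (fun u _ => ?_) (fun u _ => ?_)
      · exact ((integrable_line hP hz hl hg).mul_const I).integrableOn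
      · exact ((integrable_line hP' hz hl' hg').mul_const I).integrableOn
      · simp only [MBBase.integral, setIntegral_univ]
      · simp only [MBBase.integral, setIntegral_univ]
    | loop c h₁ h₂ =>
      obtain ⟨hh, hl⟩ := hcase.resolve_left fun h => h.1
      have hl' := (raise_loopCase (β := β) (μ := μ) hα _).2 hl
      have hh' : h₁ < h₂ := hh
      have ha := rlPair_part (P := P) hmq hα hw hR h1 h2 (γ := fun x => x + h₁ * I)
        (ω := fun _ => -1) measurableSet_Ioi (by fun_prop) measurable_const
        (fun t ht => by simpa [MBBase.minRe] using ht.le)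
        ((integrableOn_ray hP hz hl hh hg (Or.inl rfl)).mul_const _)
        ((integrableOn_ray hP' hz hl' hh hg' (Or.inl rfl)).mul_const _)
      have hb := rlPair_part (P := P) hmq hα hw hR h1 h2 (γ := fun y => c + y * I)
        (ω := fun _ => I) measurableSet_Ioc (by fun_prop) measurable_const
        (fun t _ => by simp [MBBase.minRe])
        ((integrableOn_segment hP hz hg).mul_const _)
        ((integrableOn_segment hP' hz hg').mul_const _)
      have hc := rlPair_part (P := P) hmq hα hw hR h1 h2 (γ := fun x => x + h₂ * I)
        (ω := fun _ => 1) measurableSet_Ioi (by fun_prop) measurable_const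
        (fun t ht => by simpa [MBBase.minRe] using ht.le)
        ((integrableOn_ray hP hz hl hh hg (Or.inr rfl)).mul_const _)
        ((integrableOn_ray hP' hz hl' hh hg' (Or.inr rfl)).mul_const _)
      refine ((ha.add h1 h2 hν hν' hb).add h1 h2 hν hν' hc).congr (fun u _ => ?_) fun u _ => ?_
      · simp only [MBBase.integral, mul_neg, mul_one, integral_neg,
          intervalIntegral.integral_of_le hh'.le]
        ring
      · simp only [MBBase.integral, mul_neg, mul_one, integral_neg,
          intervalIntegral.integral_of_le hh'.le]
        ring
  have hring : ∀ {m n p q : ℕ} (Q : FoxParams m n p q) (v z : ℂ),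
      (2 * Real.pi * I)⁻¹ * (v * L.base.integral (Q.integrand z) + ∑ s ∈ L.indent, v *
        ∫ t in Ioc 0 (2 * Real.pi), Q.integrand z (circleMap s L.r t) * deriv (circleMap s L.r) t) =
      v * Q.mellinBarnes L z := by
    intro m n p q Q v z
    have h3 : ∀ s, (∮ t in C(s, L.r), Q.integrand z t) = ∫ t in Ioc 0 (2 * Real.pi),
        Q.integrand z (circleMap s L.r t) * deriv (circleMap s L.r) t := by
      intro s
      rw [circleIntegral, intervalIntegral.integral_of_le Real.two_pi_pos.le]
      simp only [smul_eq_mul, mul_comm]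
    rw [mellinBarnes, MBContour.integral, ← Finset.mul_sum, ← mul_add, mul_left_comm]
    simp only [← h3]
    rfl
  exact ((hbase.add h1 h2 hν hν' hcirc).const_mul ((2 * Real.pi * I)⁻¹)).congr
    (fun u _ => hring P _ _) (fun u _ => hring (P.raise α β μ) _ _)

/-- The convolution kernel `u ^ (β - 1) H[w u ^ α]` of the integral operator. -/
noncomputable def opKernel (P : FoxParams m n p q) (α : ℝ) (β w : ℂ) (u : ℝ) : ℂ :=
  (u : ℂ) ^ (β - 1) * P.foxH (w * ((u ^ α : ℝ) : ℂ))

/-- The kernels of the two operators form a pair of functions with a common fractional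
integral. -/
lemma exists_rlPair (hmq : m ≤ q) (hα : 0 < α) (hw : w ≠ 0) (hP : P.Valid) {R : ℝ} (hR : 0 < R)
    (hH : (0 < P.Omega ∧ |w.arg| < Real.pi * P.Omega / 2) ∨ 0 < P.Delta ∨
      (P.Delta = 0 ∧ ‖w‖ * R ^ α < P.delta))
    (hβb : ∀ j : Fin q, (j : ℕ) < m → 0 < β.re + ((α : ℂ) * P.b j / (P.B j : ℂ)).re)
    (hβμb : ∀ j : Fin q, (j : ℕ) < m → 0 < (β - μ).re + ((α : ℂ) * P.b j / (P.B j : ℂ)).re) :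
    ∃ c : ℝ, 0 < β.re + α * c ∧ 0 < (β - μ).re + α * c ∧
      RLPair R (β.re + α * c) ((β - μ).re + α * c)
        (((⌊μ.re⌋₊ + 1 : ℕ) : ℂ) - μ) ((⌊μ.re⌋₊ + 1 : ℕ) : ℂ)
        (P.opKernel α β w) ((P.raise α β μ).opKernel α (β - μ) w) := by
  have hP' := raise_valid hmq hP hα hβb hβμb
  obtain ⟨c, d, hcd, hc1, hc2, hd⟩ := exists_abscissa hP hα hβb hβμb
  have hd' : ∀ s ∈ (P.raise α β μ).rightPoles, d < s.re := by rwa [raise_rightPoles hmq]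
  have hz : ∀ u : ℝ, 0 < u → w * ((u ^ α : ℝ) : ℂ) ≠ 0 := fun u hu =>
    mul_ne_zero hw (by exact_mod_cast (Real.rpow_pos_of_pos hu α).ne')
  have hpos : ∀ {x : ℝ}, c < x → 0 < β.re + α * x ∧ 0 < (β - μ).re + α * x := fun hx => by
    have := mul_lt_mul_of_pos_left hx hα
    constructor <;> linarith
  have hlinec : ∀ u : ℝ, 0 < u → (P.LineCase (w * ((u ^ α : ℝ) : ℂ)) ↔ P.LineCase w) := by
    intro u hu
    rw [LineCase, LineCase, arg_mul_real (Real.rpow_pos_of_pos hu α)]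
  by_cases hline : P.LineCase w
  · obtain ⟨L, hLl, hL', hLc⟩ := exists_line_separates hP' hcd hd'
    obtain ⟨h1, h2⟩ := hpos hLc
    refine ⟨L.base.minRe, h1, h2, (rlPair_mellinBarnes hmq hα hw hP hP' hR h1 h2 hL'
      (Or.inl ⟨hLl, (hlinec R hR).2 hline⟩)).congr (fun u hu => ?_) fun u hu => ?_⟩
    · rw [opKernel, foxH_eq_of_lineCase hP (hz u hu.1) ((hlinec u hu.1).2 hline) hLl
        (hL'.of_raise hmq hα h1 h2)]
    · rw [opKernel, foxH_eq_of_lineCase hP' (hz u hu.1)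
        ((raise_lineCase hmq _).2 ((hlinec u hu.1).2 hline)) hLl hL']
  · have hloop : ∀ u : ℝ, 0 < u → u ≤ R → P.LoopCase (w * ((u ^ α : ℝ) : ℂ)) := by
      intro u hu huR
      refine (hH.resolve_left hline).imp_right fun h => ⟨h.1, lt_of_le_of_lt ?_ h.2⟩
      rw [norm_mul, norm_real, Real.norm_of_nonneg (Real.rpow_nonneg hu.le _)]
      exact mul_le_mul_of_nonneg_left (Real.rpow_le_rpow hu.le huR hα.le) (norm_nonneg _)
    obtain ⟨L, hLl, hL', hLc⟩ := exists_loop_separates hP' hcd hd'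
    obtain ⟨h1, h2⟩ := hpos hLc
    refine ⟨L.base.minRe, h1, h2, (rlPair_mellinBarnes hmq hα hw hP hP' hR h1 h2 hL'
      (Or.inr ⟨hLl, hloop R hR le_rfl⟩)).congr (fun u hu => ?_) fun u hu => ?_⟩
    · rw [opKernel, foxH_eq_of_loopCase hP (hz u hu.1) (fun h => hline ((hlinec u hu.1).1 h))
        (hloop u hu.1 hu.2.le) hLl (hL'.of_raise hmq hα h1 h2)]
    · rw [opKernel, foxH_eq_of_loopCase hP' (hz u hu.1)
        (fun h => hline ((hlinec u hu.1).1 ((raise_lineCase hmq _).1 h)))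
        ((raise_loopCase hα _).2 (hloop u hu.1 hu.2.le)) hLl hL']

end FoxParams

/-! ### Volterra operators with weakly singular kernels -/

section

/-- The Volterra operator with convolution kernel `K`, applied to `φ` at `x`. -/
noncomputable def volterra (a : ℝ) (K φ : ℝ → ℂ) (x : ℝ) : ℂ := ∫ t in a..x, K (x - t) * φ t

/-- `K` is continuous on `(0, R)` and dominated there by a multiple of `u ^ (ρ - 1)`. -/
def IsWeaklySingular (R ρ : ℝ) (K : ℝ → ℂ) : Prop :=
  ContinuousOn K (Ioo 0 R) ∧ ∃ C, ∀ u ∈ Ioo 0 R, ‖K u‖ ≤ C * u ^ (ρ - 1)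

variable {a b y R ρ : ℝ} {ν : ℂ} {K φ : ℝ → ℂ}

lemma IsWeaklySingular.exists_nonneg (hK : IsWeaklySingular R ρ K) :
    ∃ C, 0 ≤ C ∧ ∀ u ∈ Ioo 0 R, ‖K u‖ ≤ C * u ^ (ρ - 1) := by
  obtain ⟨C, hC⟩ := hK.2
  exact ⟨|C|, abs_nonneg C, fun u hu => (hC u hu).trans
    (mul_le_mul_of_nonneg_right (le_abs_self C) (Real.rpow_nonneg hu.1.le _))⟩

lemma isWeaklySingular_rlKernel {ν : ℂ} : IsWeaklySingular R ν.re (rlKernel ν) := by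
  refine ⟨fun u hu => ContinuousAt.continuousWithinAt (ContinuousAt.div_const ?_ _),
    ‖Gamma ν‖⁻¹, fun u hu => (norm_rlKernel ν hu.1).le⟩
  exact ContinuousAt.cpow continuous_ofReal.continuousAt continuousAt_const
    (ofReal_mem_slitPlane.2 hu.1)

lemma rlKernel_one (u : ℝ) : rlKernel 1 u = 1 := by simp [rlKernel]

lemma indicator_sub_mul {x t : ℝ} (hx : x < y) (hyR : y - a ≤ R) (ht : a < t) :
    indicator (Ioo 0 R) K (x - t) * φ t =
      indicator (Ioo a x) (fun t => K (x - t) * φ t) t := by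
  by_cases h : t < x
  · rw [indicator_of_mem (show x - t ∈ Ioo 0 R from ⟨by linarith, by linarith⟩),
      indicator_of_mem (show t ∈ Ioo a x from ⟨ht, h⟩)]
  · rw [indicator_of_notMem fun h' => h (by linarith [h'.1]),
      indicator_of_notMem fun h' => h h'.2, zero_mul]

lemma aestronglyMeasurable_indicator_sub_mul (hK : ContinuousOn K (Ioo 0 R)) {S T : Set ℝ}
    (hφ : AEStronglyMeasurable φ (volume.restrict T)) :
    AEStronglyMeasurable (fun z : ℝ × ℝ => indicator (Ioo 0 R) K (z.1 - z.2) * φ z.2)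
      ((volume.restrict S).prod (volume.restrict T)) := by
  have h1 : AEStronglyMeasurable (indicator (Ioo 0 R) K) volume :=
    (aestronglyMeasurable_indicator_iff measurableSet_Ioo).2
      (hK.aestronglyMeasurable measurableSet_Ioo)
  have h2 : AEStronglyMeasurable (fun z : ℝ × ℝ => indicator (Ioo 0 R) K (z.1 - z.2))
      ((volume.restrict S).prod (volume.restrict T)) := by
    refine AEStronglyMeasurable.mono_ac ?_
      (h1.comp_quasiMeasurePreserving (quasiMeasurePreserving_sub volume volume))
    exact (Measure.absolutelyContinuous_of_le Measure.restrict_le_self).prod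
      (Measure.absolutelyContinuous_of_le Measure.restrict_le_self)
  exact h2.mul hφ.comp_snd

/-- The condition `1 ≤ ρ + re ν` makes the convolution of the two kernels bounded. -/
lemma integrable_rlKernel_mul_kernel (hK : IsWeaklySingular R ρ K) (hρ : 0 < ρ) (hν : 0 < ν.re)
    (hρν : 1 ≤ ρ + ν.re) (hyR : y - a ≤ R) (hφ : IntegrableOn φ (Ioo a y)) :
    Integrable (fun z : ℝ × ℝ =>
        rlKernel ν (y - z.1) * (indicator (Ioo 0 R) K (z.1 - z.2) * φ z.2))
      ((volume.restrict (Ioo a y)).prod (volume.restrict (Ioo a y))) := by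
  obtain ⟨C, hC0, hC⟩ := hK.exists_nonneg
  obtain ⟨B, hB0, hB⟩ := integral_rpow_mul_rpow ρ ν.re
  have hm : AEStronglyMeasurable (fun z : ℝ × ℝ =>
        rlKernel ν (y - z.1) * (indicator (Ioo 0 R) K (z.1 - z.2) * φ z.2))
      ((volume.restrict (Ioo a y)).prod (volume.restrict (Ioo a y))) :=
    ((measurable_rlKernel ν).comp (measurable_const.sub measurable_fst)).aestronglyMeasurable.mul
      (aestronglyMeasurable_indicator_sub_mul hK.1 hφ.aestronglyMeasurable)
  set D : ℝ := ‖Gamma ν‖⁻¹ * C with hD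
  have hD0 : 0 ≤ D := mul_nonneg (inv_nonneg.2 (norm_nonneg _)) hC0
  set Q : ℝ → ℝ → ℝ := fun u => indicator (Ioo 0 u) fun s => s ^ (ρ - 1) * (u - s) ^ (ν.re - 1)
    with hQ
  have hQint : ∀ u, 0 < u → Integrable (Q u) := fun u hu =>
    (integrableOn_rpow_mul_rpow hρ hν hu).integrable_indicator measurableSet_Ioo
  have hQ0 : ∀ u s, 0 ≤ Q u s := fun u s => indicator_nonneg (fun s hs => mul_nonneg
    (Real.rpow_nonneg hs.1.le _) (Real.rpow_nonneg (sub_pos.2 hs.2).le _)) s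
  have hbd : ∀ t ∈ Ioo a y, ∀ x ∈ Ioo a y,
      ‖rlKernel ν (y - x) * (indicator (Ioo 0 R) K (x - t) * φ t)‖ ≤
        D * ‖φ t‖ * Q (y - t) (x - t) := by
    intro t ht x hx
    by_cases htx : t < x
    · have h1 : x - t ∈ Ioo 0 R := ⟨by linarith, by linarith [hx.2, ht.1]⟩
      rw [indicator_of_mem h1, hQ]
      simp only
      rw [indicator_of_mem (show x - t ∈ Ioo 0 (y - t) from ⟨h1.1, by linarith [hx.2]⟩),
        norm_mul, norm_mul, norm_rlKernel ν (sub_pos.2 hx.2), sub_sub_sub_cancel_right]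
      refine (mul_le_mul_of_nonneg_left (mul_le_mul_of_nonneg_right (hC _ h1) (norm_nonneg _))
        (mul_nonneg (inv_nonneg.2 (norm_nonneg _))
        (Real.rpow_nonneg (sub_pos.2 hx.2).le _))).trans_eq ?_
      rw [hD]
      ring
    · rw [indicator_of_notMem fun h => htx (by linarith [h.1]), zero_mul, mul_zero, norm_zero]
      exact mul_nonneg (mul_nonneg hD0 (norm_nonneg _)) (hQ0 _ _)
  have hQt : ∀ t ∈ Ioo a y, Integrable fun x => D * ‖φ t‖ * Q (y - t) (x - t) := fun t ht =>
    ((hQint (y - t) (sub_pos.2 ht.2)).comp_sub_right t).const_mul _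
  rw [integrable_prod_iff' hm]
  constructor
  · filter_upwards [ae_restrict_mem measurableSet_Ioo] with t ht
    refine Integrable.mono' (hQt t ht).integrableOn ?_
      (ae_restrict_of_forall_mem measurableSet_Ioo (hbd t ht))
    have h1 : AEStronglyMeasurable (fun x => indicator (Ioo 0 R) K (x - t)) volume :=
      ((aestronglyMeasurable_indicator_iff measurableSet_Ioo).2
        (hK.1.aestronglyMeasurable measurableSet_Ioo)).comp_quasiMeasurePreserving
        (measurePreserving_sub_right volume t).quasiMeasurePreserving
    exact ((measurable_rlKernel ν).comp
      (measurable_const.sub measurable_id)).aestronglyMeasurable.mul (h1.restrict.mul_const _)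
  · refine Integrable.mono' (hφ.norm.const_mul (R ^ (ρ + ν.re - 1) * B * D))
      hm.norm.prod_swap.integral_prod_right' ?_
    filter_upwards [ae_restrict_mem measurableSet_Ioo] with t ht
    rw [Real.norm_of_nonneg (integral_nonneg fun _ => norm_nonneg _)]
    have hu : 0 < y - t := sub_pos.2 ht.2
    calc ∫ x in Ioo a y, ‖rlKernel ν (y - x) * (indicator (Ioo 0 R) K (x - t) * φ t)‖
        ≤ ∫ x in Ioo a y, D * ‖φ t‖ * Q (y - t) (x - t) := by
          refine integral_mono_of_nonneg (Eventually.of_forall fun _ => norm_nonneg _)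
            (hQt t ht).integrableOn ?_
          exact ae_restrict_of_forall_mem measurableSet_Ioo (hbd t ht)
      _ ≤ ∫ x, D * ‖φ t‖ * Q (y - t) (x - t) := setIntegral_le_integral (hQt t ht)
          (Eventually.of_forall fun x => mul_nonneg (mul_nonneg hD0 (norm_nonneg _)) (hQ0 _ _))
      _ = D * ‖φ t‖ * ((y - t) ^ (ρ + ν.re - 1) * B) := by
          rw [integral_const_mul, integral_sub_right_eq_self (Q (y - t)) t, hQ,
            integral_indicator measurableSet_Ioo, hB _ hu]
      _ ≤ D * ‖φ t‖ * (R ^ (ρ + ν.re - 1) * B) := by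
          have := Real.rpow_le_rpow hu.le (show y - t ≤ R by linarith [ht.1])
            (show 0 ≤ ρ + ν.re - 1 by linarith)
          gcongr
      _ = R ^ (ρ + ν.re - 1) * B * D * ‖φ t‖ := by ring

lemma setIntegral_indicator_sub_mul {x : ℝ} (hx : x ∈ Ioo a y) (hyR : y - a ≤ R) :
    ∫ t in Ioo a y, indicator (Ioo 0 R) K (x - t) * φ t = volterra a K φ x := by
  rw [setIntegral_congr_fun measurableSet_Ioo fun t ht => indicator_sub_mul hx.2 hyR ht.1,
    setIntegral_indicator measurableSet_Ioo, inter_eq_right.2 (Ioo_subset_Ioo_right hx.2.le),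
    volterra, intervalIntegral.integral_of_le hx.1.le, integral_Ioc_eq_integral_Ioo]

lemma integrableOn_rlKernel_mul_volterra (hK : IsWeaklySingular R ρ K) (hρ : 0 < ρ)
    (hν : 0 < ν.re) (hρν : 1 ≤ ρ + ν.re) (hyR : y - a ≤ R) (hφ : IntegrableOn φ (Ioo a y)) :
    IntegrableOn (fun x => rlKernel ν (y - x) * volterra a K φ x) (Ioo a y) := by
  refine (integrable_rlKernel_mul_kernel hK hρ hν hρν hyR hφ).integral_prod_left.congr ?_
  filter_upwards [ae_restrict_mem measurableSet_Ioo] with x hx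
  rw [integral_const_mul, setIntegral_indicator_sub_mul hx hyR]

/-- Fubini's theorem: associativity of convolution. -/
lemma volterra_rlKernel_volterra (hK : IsWeaklySingular R ρ K) (hρ : 0 < ρ)
    (hν : 0 < ν.re) (hρν : 1 ≤ ρ + ν.re) (hay : a ≤ y) (hyR : y - a ≤ R)
    (hφ : IntegrableOn φ (Ioo a y)) :
    volterra a (rlKernel ν) (volterra a K φ) y =
      volterra a (fun u => ∫ s in (0 : ℝ)..u, rlKernel ν (u - s) * K s) φ y := by
  have h := integral_integral_swap (f := fun x t =>
    rlKernel ν (y - x) * (indicator (Ioo 0 R) K (x - t) * φ t))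
    (integrable_rlKernel_mul_kernel hK hρ hν hρν hyR hφ)
  rw [volterra, volterra, intervalIntegral.integral_of_le hay, intervalIntegral.integral_of_le hay,
    integral_Ioc_eq_integral_Ioo, integral_Ioc_eq_integral_Ioo]
  refine Eq.trans (setIntegral_congr_fun measurableSet_Ioo fun x hx => ?_)
    (h.trans (setIntegral_congr_fun measurableSet_Ioo fun t ht => ?_))
  · rw [integral_const_mul, setIntegral_indicator_sub_mul hx hyR]
  · have h1 : ∀ x ∈ Ioo a y, rlKernel ν (y - x) * (indicator (Ioo 0 R) K (x - t) * φ t) =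
        indicator (Ioo t y) (fun x => rlKernel ν (y - t - (x - t)) * K (x - t) * φ t) x := by
      intro x hx
      rw [indicator_sub_mul hx.2 hyR ht.1]
      by_cases htx : t < x
      · rw [indicator_of_mem (show t ∈ Ioo a x from ⟨ht.1, htx⟩),
          indicator_of_mem (show x ∈ Ioo t y from ⟨htx, hx.2⟩), sub_sub_sub_cancel_right, mul_assoc]
      · rw [indicator_of_notMem fun h => htx h.2, indicator_of_notMem fun h => htx h.1, mul_zero]
    rw [setIntegral_congr_fun measurableSet_Ioo h1, setIntegral_indicator measurableSet_Ioo,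
      inter_eq_right.2 (Ioo_subset_Ioo_left ht.1.le), ← integral_Ioc_eq_integral_Ioo,
      ← intervalIntegral.integral_of_le ht.2.le, intervalIntegral.integral_mul_const,
      intervalIntegral.integral_comp_sub_right (fun s => rlKernel ν (y - t - s) * K s) t, sub_self]

lemma ae_intervalIntegrable_volterra (hK : IsWeaklySingular (b - a) ρ K) (hρ : 0 < ρ)
    (hφ : IntegrableOn φ (Ioo a b)) :
    ∀ᵐ x, x ∈ Ioo a b → IntervalIntegrable (fun t => K (x - t) * φ t) volume a x := by
  -- the kernel of order `1` is constant
  have h := (integrable_rlKernel_mul_kernel (ν := 1) hK hρ (by simp) (by simp; linarith) le_rfl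
    hφ).prod_right_ae
  rw [ae_restrict_iff' measurableSet_Ioo] at h
  filter_upwards [h] with x hx hxm
  rw [intervalIntegrable_iff_integrableOn_Ioo_of_le hxm.1.le]
  refine IntegrableOn.congr_fun ((hx hxm).mono_measure
    (Measure.restrict_mono (Ioo_subset_Ioo_right hxm.2.le) le_rfl)) (fun t ht => ?_)
    measurableSet_Ioo
  rw [rlKernel_one, one_mul, indicator_sub_mul hxm.2 le_rfl ht.1, indicator_of_mem ht]

lemma integrableOn_volterra (hK : IsWeaklySingular (b - a) ρ K) (hρ : 0 < ρ)
    (hφ : IntegrableOn φ (Ioo a b)) : IntegrableOn (volterra a K φ) (Ioo a b) := by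
  have h := integrableOn_rlKernel_mul_volterra (ν := 1) hK hρ (by simp) (by simp; linarith) le_rfl
    hφ
  simpa only [rlKernel_one, one_mul] using h

/-! ### Volterra operators at points of continuity -/

lemma IsWeaklySingular.exists_bound (hK : IsWeaklySingular R ρ K) {d : ℝ} (hd : 0 < d) :
    ∃ M, ∀ u ∈ Ioo 0 R, d ≤ u → ‖K u‖ ≤ M := by
  obtain ⟨C, hC0, hC⟩ := hK.exists_nonneg
  refine ⟨C * (d ^ (ρ - 1) + R ^ (ρ - 1)), fun u hu hdu => (hC u hu).trans ?_⟩
  refine mul_le_mul_of_nonneg_left ?_ hC0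
  have h1 := Real.rpow_nonneg hd.le (ρ - 1)
  have h2 := Real.rpow_nonneg (hu.1.trans hu.2).le (ρ - 1)
  rcases le_total 0 (ρ - 1) with h | h
  · linarith [Real.rpow_le_rpow hu.1.le hu.2.le h]
  · linarith [Real.rpow_le_rpow_of_nonpos hd hdu h]

lemma IsWeaklySingular.integrable (hK : IsWeaklySingular R ρ K) (hρ : 0 < ρ) :
    Integrable (indicator (Ioo 0 R) K) := by
  obtain ⟨C, hC⟩ := hK.2
  rw [integrable_indicator_iff measurableSet_Ioo]
  have h1 : IntegrableOn (fun u : ℝ => u ^ (ρ - 1)) (Ioo 0 R) := by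
    rcases lt_or_ge 0 R with hR | hR
    · exact (intervalIntegrable_iff_integrableOn_Ioo_of_le hR.le).1
        (intervalIntegral.intervalIntegrable_rpow' (by linarith))
    · rw [Ioo_eq_empty (not_lt.2 hR)]
      exact integrableOn_empty
  refine Integrable.mono' (h1.const_mul C) (hK.1.aestronglyMeasurable measurableSet_Ioo) ?_
  exact ae_restrict_of_forall_mem measurableSet_Ioo hC

lemma volterra_eq_integral {x : ℝ} (hx : x ∈ Ioo a b) :
    volterra a K φ x =
      ∫ t, indicator (Ioo 0 (b - a)) K (x - t) * indicator (Ioo a b) φ t := by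
  rw [← setIntegral_indicator_sub_mul hx le_rfl, ← integral_indicator measurableSet_Ioo]
  congr 1
  ext t
  by_cases ht : t ∈ Ioo a b
  · rw [indicator_of_mem ht, indicator_of_mem ht]
  · rw [indicator_of_notMem ht, indicator_of_notMem ht, mul_zero]

/-- The far part of the integral is integrable, and depends continuously on the end point. -/
lemma integrable_and_continuousAt_of_eq_zero (hK : IsWeaklySingular (b - a) ρ K) {ψ : ℝ → ℂ}
    (hψ : Integrable ψ) {x d : ℝ} (hx : x ∈ Ioo a b) (hd : 0 < d)
    (hψa : ∀ t ≤ a, ψ t = 0) (hψx : ∀ t, |t - x| < d → ψ t = 0) :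
    (∀ y, |y - x| < d / 2 →
      Integrable fun t => indicator (Ioo 0 (b - a)) K (y - t) * ψ t) ∧
    ContinuousAt (fun y => ∫ t, indicator (Ioo 0 (b - a)) K (y - t) * ψ t) x := by
  obtain ⟨M, hM⟩ := hK.exists_bound (half_pos hd)
  have hm : ∀ y, AEStronglyMeasurable
      (fun t => indicator (Ioo 0 (b - a)) K (y - t) * ψ t) volume := by
    intro y
    refine AEStronglyMeasurable.mul ?_ hψ.aestronglyMeasurable
    exact ((aestronglyMeasurable_indicator_iff measurableSet_Ioo).2
      (hK.1.aestronglyMeasurable measurableSet_Ioo)).comp_quasiMeasurePreserving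
      (quasiMeasurePreserving_sub_left volume y)
  have hbd : ∀ y, |y - x| < d / 2 → ∀ t,
      ‖indicator (Ioo 0 (b - a)) K (y - t) * ψ t‖ ≤ |M| * ‖ψ t‖ := by
    intro y hy t
    rw [norm_mul]
    by_cases ht : |t - x| < d
    · rw [hψx t ht]
      simp
    refine mul_le_mul_of_nonneg_right ?_ (norm_nonneg _)
    by_cases h : y - t ∈ Ioo 0 (b - a)
    · rw [indicator_of_mem h]
      refine (hM _ h ?_).trans (le_abs_self M)
      rw [abs_lt] at hy
      rw [not_lt, le_abs] at ht
      rcases ht with ht | ht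
      · linarith [h.1]
      · linarith
    · rw [indicator_of_notMem h, norm_zero]
      exact abs_nonneg M
  refine ⟨fun y hy => Integrable.mono' (hψ.norm.const_mul |M|) (hm y)
    (Eventually.of_forall (hbd y hy)), ?_⟩
  refine continuousAt_of_dominated (Eventually.of_forall hm) ?_ (hψ.norm.const_mul |M|) ?_
  · have : ∀ᶠ y in 𝓝 x, |y - x| < d / 2 := Metric.ball_mem_nhds x (half_pos hd)
    exact this.mono fun y hy => Eventually.of_forall (hbd y hy)
  · refine Eventually.of_forall fun t => ?_
    by_cases hta : t ≤ a
    · simp only [hψa t hta, mul_zero]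
      exact continuousAt_const
    by_cases htx : |t - x| < d
    · simp only [hψx t htx, mul_zero]
      exact continuousAt_const
    refine ContinuousAt.mul ?_ continuousAt_const
    rw [not_lt, le_abs] at htx
    rcases htx with ht | ht
    · have h0 : (fun y => indicator (Ioo 0 (b - a)) K (y - t)) =ᶠ[𝓝 x] fun _ => 0 := by
        filter_upwards [eventually_lt_nhds (show x < t by linarith)] with y hy
        exact indicator_of_notMem (fun h => by linarith [h.1]) _
      exact continuousAt_const.congr h0.symm
    · have hu : x - t ∈ Ioo 0 (b - a) := ⟨by linarith, by linarith [hx.2]⟩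
      have h1 : ContinuousAt (indicator (Ioo 0 (b - a)) K) (x - t) := by
        refine (hK.1.continuousAt (Ioo_mem_nhds hu.1 hu.2)).congr ?_
        filter_upwards [Ioo_mem_nhds hu.1 hu.2] with v hv
        rw [indicator_of_mem hv]
      exact ContinuousAt.comp (f := fun y => y - t) h1 (by fun_prop)

/-- The near part of the integral is small. -/
lemma integrable_and_norm_integral_le (hk : Integrable K) {ψ : ℝ → ℂ} {x d M : ℝ}
    (hψm : AEStronglyMeasurable ψ) (hψ : ∀ t, ‖ψ t‖ ≤ M) (hψx : ∀ t, d ≤ |t - x| → ψ t = 0) :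
    ∀ y, |y - x| < d → Integrable (fun t => K (y - t) * ψ t) ∧
      ‖∫ t, K (y - t) * ψ t‖ ≤ M * ∫ u in Ioo (-(2 * d)) (2 * d), ‖K u‖ := by
  intro y hy
  have hM : 0 ≤ M := (norm_nonneg _).trans (hψ 0)
  have hky : Integrable fun t => K (y - t) := hk.comp_sub_left y
  refine ⟨(hky.bdd_mul hψm (Eventually.of_forall hψ)).congr
    (Eventually.of_forall fun t => mul_comm _ _), ?_⟩
  have hi : Integrable (fun t => M * indicator (Ioo (-(2 * d)) (2 * d)) (fun u => ‖K u‖) (y - t)) :=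
    ((hk.norm.indicator measurableSet_Ioo).comp_sub_left y).const_mul M
  refine (norm_integral_le_of_norm_le hi (Eventually.of_forall fun t => ?_)).trans_eq ?_
  · by_cases ht : d ≤ |t - x|
    · rw [hψx t ht, mul_zero, norm_zero]
      exact mul_nonneg hM (indicator_nonneg (fun _ _ => norm_nonneg _) _)
    · rw [not_le, abs_lt] at ht
      rw [abs_lt] at hy
      rw [indicator_of_mem (show y - t ∈ Ioo (-(2 * d)) (2 * d) from
        ⟨by linarith, by linarith⟩), norm_mul, mul_comm]
      exact mul_le_mul_of_nonneg_right (hψ t) (norm_nonneg _)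
  · rw [integral_const_mul, integral_sub_left_eq_self
      (indicator (Ioo (-(2 * d)) (2 * d)) fun u => ‖K u‖) volume y,
      integral_indicator measurableSet_Ioo]

lemma tendsto_setIntegral_Ioo_zero {k : ℝ → ℝ} (hk : Integrable k) :
    Tendsto (fun d : ℝ => ∫ u in Ioo (-(2 * d)) (2 * d), k u) (𝓝[>] 0) (𝓝 0) := by
  have hs : Tendsto (fun d : ℝ => volume (Ioo (-(2 * d)) (2 * d))) (𝓝[>] 0) (𝓝 0) := by
    have h1 : Tendsto (fun d : ℝ => ENNReal.ofReal (2 * d - -(2 * d))) (𝓝 0) (𝓝 0) := by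
      have : Continuous fun d : ℝ => ENNReal.ofReal (2 * d - -(2 * d)) :=
        ENNReal.continuous_ofReal.comp (by fun_prop)
      simpa using this.tendsto 0
    simpa only [Real.volume_Ioo] using h1.mono_left nhdsWithin_le_nhds
  exact hk.hasFiniteIntegral.tendsto_setIntegral_nhds_zero hs

/-- At a point of continuity of `φ`, the integral that defines `volterra a K φ` converges
absolutely, and `volterra a K φ` is continuous. -/
lemma volterra_of_continuousAt (hK : IsWeaklySingular (b - a) ρ K) (hρ : 0 < ρ)
    (hφ : IntegrableOn φ (Ioo a b)) {x : ℝ} (hx : x ∈ Ioo a b) (hc : ContinuousAt φ x) :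
    IntervalIntegrable (fun t => K (x - t) * φ t) volume a x ∧
      ContinuousAt (volterra a K φ) x := by
  have hk := hK.integrable hρ
  set k := indicator (Ioo 0 (b - a)) K with hkdef
  set f := indicator (Ioo a b) φ with hf
  have hfi : Integrable f := hφ.integrable_indicator measurableSet_Ioo
  obtain ⟨d₀, hd₀, hbd⟩ : ∃ d₀ > 0, ∀ t, |t - x| < d₀ → ‖φ t‖ ≤ ‖φ x‖ + 1 := by
    have : ∀ᶠ t in 𝓝 x, ‖φ t‖ < ‖φ x‖ + 1 := hc.norm.eventually_lt_const (by simp)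
    obtain ⟨d, hd, h⟩ := Metric.eventually_nhds_iff.1 this
    exact ⟨d, hd, fun t ht => (h ht).le⟩
  set M := ‖φ x‖ + 1
  have hM : 0 ≤ M := by positivity
  -- the near and the far part of `φ`
  set f₁ : ℝ → ℝ → ℂ := fun d => indicator (Metric.ball x d) f
  set f₂ : ℝ → ℝ → ℂ := fun d => indicator (Metric.ball x d)ᶜ f
  have hsplit : ∀ d t, f t = f₁ d t + f₂ d t := fun d t =>
    (congrFun (indicator_self_add_compl (Metric.ball x d) f) t).symm
  have hnear : ∀ d, 0 < d → d ≤ d₀ → ∀ y, |y - x| < d →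
      Integrable (fun t => k (y - t) * f₁ d t) ∧
      ‖∫ t, k (y - t) * f₁ d t‖ ≤ M * ∫ u in Ioo (-(2 * d)) (2 * d), ‖k u‖ := by
    intro d hd hdd
    refine integrable_and_norm_integral_le hk
      (hfi.indicator Metric.isOpen_ball.measurableSet).aestronglyMeasurable (fun t => ?_)
      fun t ht => indicator_of_notMem (fun h => not_lt.2 ht (by simpa [Real.dist_eq] using h)) _
    by_cases ht : t ∈ Metric.ball x d
    · simp only [f₁, indicator_of_mem ht, hf]
      rw [Metric.mem_ball, Real.dist_eq] at ht
      exact (norm_indicator_le_norm_self φ t).trans (hbd t (ht.trans_le hdd))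
    · simp only [f₁, indicator_of_notMem ht, norm_zero]
      exact hM
  have hfar : ∀ d, 0 < d →
      (∀ y, |y - x| < d / 2 → Integrable fun t => k (y - t) * f₂ d t) ∧
      ContinuousAt (fun y => ∫ t, k (y - t) * f₂ d t) x := by
    intro d hd
    refine integrable_and_continuousAt_of_eq_zero hK
      (hfi.indicator Metric.isOpen_ball.measurableSet.compl) hx hd (fun t ht => ?_) fun t ht => ?_
    · rw [hf, indicator_indicator]
      exact indicator_of_notMem (fun h => not_lt.2 ht h.2.1) _
    · exact indicator_of_notMem (s := (Metric.ball x d)ᶜ)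
        (fun h => h (by simpa [Real.dist_eq] using ht)) _
  have hint : Integrable fun t => k (x - t) * f t := by
    simp only [hsplit d₀, mul_add]
    exact (hnear d₀ hd₀ le_rfl x (by simpa using hd₀)).1.add ((hfar d₀ hd₀).1 x (by simpa using hd₀))
  constructor
  · rw [intervalIntegrable_iff_integrableOn_Ioo_of_le hx.1.le]
    refine hint.integrableOn.congr_fun (fun t ht => ?_) measurableSet_Ioo
    simp only [hkdef, hf]
    rw [indicator_of_mem (show t ∈ Ioo a b from ⟨ht.1, ht.2.trans hx.2⟩),
      indicator_sub_mul hx.2 le_rfl ht.1, indicator_of_mem ht]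
  · have hV : volterra a K φ =ᶠ[𝓝 x] fun y => ∫ t, k (y - t) * f t := by
      filter_upwards [Ioo_mem_nhds hx.1 hx.2] with y hy using volterra_eq_integral hy
    refine ContinuousAt.congr ?_ hV.symm
    refine continuousAt_of_locally_uniform_approx_of_continuousAt fun u hu => ?_
    obtain ⟨ε, hε, hεu⟩ := Metric.mem_uniformity_dist.1 hu
    have hsmall : ∀ᶠ d : ℝ in 𝓝[>] 0, M * ∫ u in Ioo (-(2 * d)) (2 * d), ‖k u‖ < ε := by
      have := (tendsto_setIntegral_Ioo_zero hk.norm).const_mul M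
      rw [mul_zero] at this
      exact this.eventually_lt_const hε
    obtain ⟨d, ⟨hdε, hdd⟩, hd⟩ := ((hsmall.and (nhdsWithin_le_nhds
      (eventually_le_nhds hd₀))).and self_mem_nhdsWithin).exists
    have hd : 0 < d := hd
    refine ⟨Metric.ball x (d / 2), Metric.ball_mem_nhds x (half_pos hd), _, (hfar d hd).2,
      fun y hy => hεu ?_⟩
    rw [Metric.mem_ball, Real.dist_eq] at hy
    obtain ⟨h1, h2⟩ := hnear d hd hdd y (by linarith)
    rw [dist_eq_norm]
    simp only [hsplit d, mul_add]
    rw [integral_add h1 ((hfar d hd).1 y hy), add_sub_cancel_right]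
    exact h2.trans_lt hdε

end

/-! ### Repeated integrals -/

section

variable {a b : ℝ} {g : ℝ → ℂ}

lemma volterra_congr {K K' φ : ℝ → ℂ} {y : ℝ} (hay : a ≤ y)
    (h : ∀ u ∈ Ioo 0 (y - a), K u = K' u) : volterra a K φ y = volterra a K' φ y := by
  rw [volterra, volterra, intervalIntegral.integral_of_le hay, intervalIntegral.integral_of_le hay,
    integral_Ioc_eq_integral_Ioo, integral_Ioc_eq_integral_Ioo]
  refine setIntegral_congr_fun measurableSet_Ioo fun t ht => ?_
  simp only [h (y - t) ⟨sub_pos.2 ht.2, by linarith [ht.1]⟩]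

lemma volterra_rlKernel_one (φ : ℝ → ℂ) (x : ℝ) :
    volterra a (rlKernel 1) φ x = ∫ t in a..x, φ t := by
  simp only [volterra, rlKernel_one, one_mul]

lemma isWeaklySingular_rlKernel_natCast (R : ℝ) (k : ℕ) :
    IsWeaklySingular R (k + 1) (rlKernel (k + 1)) := by
  simpa using isWeaklySingular_rlKernel (R := R) (ν := k + 1)

lemma integrableOn_volterra_rlKernel (hg : IntegrableOn g (Ioo a b)) (k : ℕ) :
    IntegrableOn (volterra a (rlKernel (k + 1)) g) (Ioo a b) :=
  integrableOn_volterra (isWeaklySingular_rlKernel_natCast _ k) (by positivity) hg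

/-- Cauchy's formula for repeated integration. -/
lemma volterra_rlKernel_succ (hg : IntegrableOn g (Ioo a b)) (k : ℕ) {y : ℝ} (hy : y ∈ Ioo a b) :
    volterra a (rlKernel ((k + 1 : ℕ) + 1)) g y =
      ∫ x in a..y, volterra a (rlKernel (k + 1)) g x := by
  have hg' := hg.mono_set (Ioo_subset_Ioo_right hy.2.le)
  rw [← volterra_rlKernel_one, volterra_rlKernel_volterra (R := y - a)
    (isWeaklySingular_rlKernel_natCast _ k) (by positivity) (by simp) (by simp; positivity)
    hy.1.le le_rfl hg']
  refine (volterra_congr hy.1.le fun u hu => ?_).symm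
  have h1 : (0 : ℝ) < ((k : ℂ) + 1).re := by
    simp
    positivity
  have h2 := Gamma_ne_zero_of_re_pos h1
  simp only [show ∀ s : ℝ, rlKernel 1 (u - s) * rlKernel (k + 1) s =
      (Gamma (k + 1))⁻¹ * (rlKernel 1 (u - s) * (s : ℂ) ^ ((k : ℂ) + 1 - 1)) from fun s => by
    rw [rlKernel, rlKernel]
    ring]
  rw [intervalIntegral.integral_const_mul, integral_rlKernel_mul_cpow h1 (by simp) hu.1, rlKernel]
  push_cast
  field_simp

lemma intervalIntegrable_of_mem (hg : IntegrableOn g (Ioo a b)) {y : ℝ} (hy : y ∈ Ioo a b) :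
    IntervalIntegrable g volume a y :=
  (intervalIntegrable_iff_integrableOn_Ioo_of_le hy.1.le).2
    (hg.mono_set (Ioo_subset_Ioo_right hy.2.le))

lemma hasDerivAt_integral_of_continuousAt (hg : IntegrableOn g (Ioo a b)) {y : ℝ}
    (hy : y ∈ Ioo a b) (hc : ContinuousAt g y) :
    HasDerivAt (fun y => ∫ t in a..y, g t) (g y) y :=
  intervalIntegral.integral_hasDerivAt_right (intervalIntegrable_of_mem hg hy)
    ⟨Ioo a b, Ioo_mem_nhds hy.1 hy.2, hg.aestronglyMeasurable⟩ hc

lemma continuousAt_integral (hg : IntegrableOn g (Ioo a b)) {y : ℝ} (hy : y ∈ Ioo a b) :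
    ContinuousAt (fun y => ∫ t in a..y, g t) y := by
  have hab := hy.1.trans hy.2
  have h := intervalIntegral.continuousOn_primitive_interval' (a := a)
    ((intervalIntegrable_iff_integrableOn_Ioo_of_le hab.le).2 hg) left_mem_uIcc
  rw [uIcc_of_le hab.le] at h
  exact h.continuousAt (Icc_mem_nhds hy.1 hy.2)

lemma continuousAt_volterra_rlKernel (hg : IntegrableOn g (Ioo a b)) (k : ℕ) {y : ℝ}
    (hy : y ∈ Ioo a b) : ContinuousAt (volterra a (rlKernel (k + 1)) g) y := by
  cases k with
  | zero =>
    refine (continuousAt_integral hg hy).congr (Eventually.of_forall fun x => ?_)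
    simp only [Nat.cast_zero, zero_add, volterra_rlKernel_one]
  | succ k =>
    refine (continuousAt_integral (integrableOn_volterra_rlKernel hg k) hy).congr ?_
    filter_upwards [Ioo_mem_nhds hy.1 hy.2] with x hx
    exact (volterra_rlKernel_succ hg k hx).symm

lemma hasDerivAt_volterra_rlKernel (hg : IntegrableOn g (Ioo a b)) (k : ℕ) {y : ℝ}
    (hy : y ∈ Ioo a b) : HasDerivAt (volterra a (rlKernel ((k + 1 : ℕ) + 1)) g)
      (volterra a (rlKernel (k + 1)) g y) y := by
  refine (hasDerivAt_integral_of_continuousAt (integrableOn_volterra_rlKernel hg k) hy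
    (continuousAt_volterra_rlKernel hg k hy)).congr_of_eventuallyEq ?_
  filter_upwards [Ioo_mem_nhds hy.1 hy.2] with x hx
  exact volterra_rlKernel_succ hg k hx

lemma contDiffOn_volterra_rlKernel (hg : IntegrableOn g (Ioo a b)) (k : ℕ) :
    ContDiffOn ℝ k (volterra a (rlKernel (k + 1)) g) (Ioo a b) := by
  induction k with
  | zero =>
    exact contDiffOn_zero.2 fun y hy =>
      (continuousAt_volterra_rlKernel hg 0 hy).continuousWithinAt
  | succ k ih =>
    rw [Nat.cast_succ, contDiffOn_succ_iff_deriv_of_isOpen isOpen_Ioo]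
    refine ⟨fun y hy => (hasDerivAt_volterra_rlKernel hg k
      hy).differentiableAt.differentiableWithinAt, fun h => by simp at h, ih.congr fun y hy => ?_⟩
    exact (hasDerivAt_volterra_rlKernel hg k hy).deriv

/-- All but one of the `k + 1` integrations are undone by derivatives at every point. -/
lemma iteratedDeriv_volterra_rlKernel (hg : IntegrableOn g (Ioo a b)) (k : ℕ) {y : ℝ}
    (hy : y ∈ Ioo a b) :
    iteratedDeriv k (volterra a (rlKernel (k + 1)) g) y = ∫ t in a..y, g t := by
  have key : ∀ k i : ℕ, ∀ y ∈ Ioo a b,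
      iteratedDeriv k (volterra a (rlKernel ((k + i : ℕ) + 1)) g) y =
        volterra a (rlKernel (i + 1)) g y := by
    intro k
    induction k with
    | zero => intro i y _; simp
    | succ k ih =>
      intro i y hy
      rw [iteratedDeriv_succ, show k + 1 + i = k + (i + 1) by ring]
      refine Eq.trans (EventuallyEq.deriv_eq ?_) (hasDerivAt_volterra_rlKernel hg i hy).deriv
      filter_upwards [Ioo_mem_nhds hy.1 hy.2] with x hx using ih (i + 1) x hx
  have := key k 0 y hy
  rwa [Nat.cast_zero, zero_add, volterra_rlKernel_one, add_zero] at this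

/-! ### The fractional derivative -/

lemma rlIntegrand_eq {ν : ℂ} (hν : 0 < ν.re) (f : ℝ → ℂ) (y t : ℝ) :
    f t / ((y - t : ℝ) : ℂ) ^ (1 - ν) = Gamma ν * (rlKernel ν (y - t) * f t) := by
  have := Gamma_ne_zero_of_re_pos hν
  rw [rlKernel, ← neg_sub 1 ν, cpow_neg]
  field_simp

lemma rlIntegral_eq_volterra {ν : ℂ} (hν : 0 < ν.re) (f : ℝ → ℂ) :
    rlIntegral a ν f = volterra a (rlKernel ν) f := by
  ext y
  simp only [rlIntegral, rlIntegrand_eq hν, intervalIntegral.integral_const_mul, volterra]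
  rw [← mul_assoc, one_div_mul_cancel (Gamma_ne_zero_of_re_pos hν), one_mul]

lemma re_floor_sub_pos (μ : ℂ) : 0 < (((⌊μ.re⌋₊ + 1 : ℕ) : ℂ) - μ).re := by
  rw [sub_re, natCast_re]
  push_cast
  linarith [Nat.lt_floor_add_one μ.re]

namespace RLPair

variable {ρ σ : ℝ} {μ : ℂ} {K K' φ : ℝ → ℂ}

lemma isWeaklySingular_left {R : ℝ} {ν ν' : ℂ} (h : RLPair R ρ σ ν ν' K K') :
    IsWeaklySingular R ρ K := ⟨h.continuousOn_left, h.bound_left⟩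

lemma isWeaklySingular_right {R : ℝ} {ν ν' : ℂ} (h : RLPair R ρ σ ν ν' K K') :
    IsWeaklySingular R σ K' := ⟨h.continuousOn_right, h.bound_right⟩

/-- Both sides are convolutions of `φ` with the common fractional integral of the kernels. -/
lemma rlIntegral_eq (h : RLPair (b - a) ρ σ (((⌊μ.re⌋₊ + 1 : ℕ) : ℂ) - μ)
      ((⌊μ.re⌋₊ + 1 : ℕ) : ℂ) K K') (hρ : 0 < ρ) (hσ : 0 < σ) (hρσ : ρ = σ + μ.re)
    (hφ : IntegrableOn φ (Ioo a b)) {y : ℝ} (hy : y ∈ Ioo a b) :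
    rlIntegral a (((⌊μ.re⌋₊ + 1 : ℕ) : ℂ) - μ) (volterra a K φ) y =
      volterra a (rlKernel (⌊μ.re⌋₊ + 1)) (volterra a K' φ) y := by
  have hν := re_floor_sub_pos μ
  have hN : (0 : ℝ) ≤ ⌊μ.re⌋₊ := Nat.cast_nonneg _
  have hyR : y - a ≤ b - a := by linarith [hy.2]
  have hφ' := hφ.mono_set (Ioo_subset_Ioo_right hy.2.le)
  rw [rlIntegral_eq_volterra hν, volterra_rlKernel_volterra h.isWeaklySingular_left hρ hν ?_
    hy.1.le hyR hφ', ← Nat.cast_succ, volterra_rlKernel_volterra h.isWeaklySingular_right hσ ?_ ?_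
    hy.1.le hyR hφ']
  · exact volterra_congr hy.1.le fun u hu => h.integral_eq u ⟨hu.1, hu.2.trans_le hyR⟩
  · rw [natCast_re]
    positivity
  · rw [natCast_re, Nat.cast_succ]
    linarith
  · rw [sub_re, natCast_re]
    push_cast
    linarith

/-- The fractional derivative of `volterra a K φ` is `volterra a K' φ`, wherever the latter is
the derivative of its primitive. -/
lemma hasRLDeriv (h : RLPair (b - a) ρ σ (((⌊μ.re⌋₊ + 1 : ℕ) : ℂ) - μ)
      ((⌊μ.re⌋₊ + 1 : ℕ) : ℂ) K K') (hρ : 0 < ρ) (hσ : 0 < σ) (hρσ : ρ = σ + μ.re)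
    (hφ : IntegrableOn φ (Ioo a b)) {x : ℝ} (hx : x ∈ Ioo a b)
    (hd : HasDerivAt (fun y => ∫ t in a..y, volterra a K' φ t) (volterra a K' φ x) x) :
    HasRLDeriv a μ (volterra a K φ) x ∧ rlDeriv a μ (volterra a K φ) x = volterra a K' φ x := by
  have hν := re_floor_sub_pos μ
  have hN : (0 : ℝ) ≤ ⌊μ.re⌋₊ := Nat.cast_nonneg _
  have hg := integrableOn_volterra h.isWeaklySingular_right hσ hφ
  have hev : ∀ y ∈ Ioo a b, rlIntegral a (((⌊μ.re⌋₊ + 1 : ℕ) : ℂ) - μ) (volterra a K φ) =ᶠ[𝓝 y]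
      volterra a (rlKernel (⌊μ.re⌋₊ + 1)) (volterra a K' φ) := fun y hy => by
    filter_upwards [Ioo_mem_nhds hy.1 hy.2] with z hz
    exact h.rlIntegral_eq hρ hσ hρσ hφ hz
  have hiter : iteratedDeriv ⌊μ.re⌋₊
      (rlIntegral a (((⌊μ.re⌋₊ + 1 : ℕ) : ℂ) - μ) (volterra a K φ)) =ᶠ[𝓝 x]
      fun y => ∫ t in a..y, volterra a K' φ t := by
    filter_upwards [Ioo_mem_nhds hx.1 hx.2] with y hy
    rw [(hev y hy).iteratedDeriv_eq, iteratedDeriv_volterra_rlKernel hg _ hy]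
  have hd' := hd.congr_of_eventuallyEq hiter
  refine ⟨⟨?_, ?_, hd'.differentiableAt⟩, ?_⟩
  · filter_upwards [Ioo_mem_nhds hx.1 hx.2] with y hy
    simp only [rlIntegrand_eq hν]
    refine IntervalIntegrable.const_mul ?_ _
    rw [intervalIntegrable_iff_integrableOn_Ioo_of_le hy.1.le]
    refine integrableOn_rlKernel_mul_volterra h.isWeaklySingular_left hρ hν ?_
      (by linarith [hy.2]) (hφ.mono_set (Ioo_subset_Ioo_right hy.2.le))
    rw [sub_re, natCast_re]
    push_cast
    linarith
  · exact ((contDiffOn_volterra_rlKernel hg _).contDiffAt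
      (Ioo_mem_nhds hx.1 hx.2)).congr_of_eventuallyEq (hev x hx)
  · rw [rlDeriv, iteratedDeriv_succ]
    exact hd'.deriv

end RLPair

namespace FoxParams

variable {m n p q : ℕ}

lemma opIntegrand_eq (P : FoxParams m n p q) (α : ℝ) (β w : ℂ) (φ : ℝ → ℂ) (x : ℝ) :
    P.opIntegrand α β w φ x = fun t => P.opKernel α β w (x - t) * φ t := rfl

lemma foxOp_eq_volterra (P : FoxParams m n p q) (α : ℝ) (β w : ℂ) (φ : ℝ → ℂ) :
    P.foxOp a α β w φ = volterra a (P.opKernel α β w) φ := rfl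

end FoxParams

end

end

theorem theorem3 {m n p q : ℕ} (hm : 1 ≤ m) (hmq : m ≤ q) (hnp : n ≤ p)
    (P : FoxParams m n p q) (hP : P.Valid)
    (a b : ℝ) (hab : a < b) (α : ℝ) (hα : 0 < α) (β μ w : ℂ)
    (hμ : 0 < μ.re) (hβ : 0 < β.re) (hw : w ≠ 0)
    -- the H-function exists at the arguments `w (x - t)^α`, `a < t < x < b`
    (hH : (0 < P.Omega ∧ |w.arg| < Real.pi * P.Omega / 2) ∨ 0 < P.Delta ∨
      (P.Delta = 0 ∧ ‖w‖ * (b - a) ^ α < P.delta))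
    -- the parameter condition of the two operators (for `β` it follows from that for `β - μ`)
    (hβb : ∀ j : Fin q, (j : ℕ) < m → 0 < β.re + ((α : ℂ) * P.b j / (P.B j : ℂ)).re)
    (hβμb : ∀ j : Fin q, (j : ℕ) < m → 0 < (β - μ).re + ((α : ℂ) * P.b j / (P.B j : ℂ)).re)
    (φ : ℝ → ℂ) (hφ : MeasureTheory.IntegrableOn φ (Set.Ioo a b)) :
    -- the integral that defines the operator on the left converges absolutely almost everywhere
    (∀ᵐ x, x ∈ Set.Ioo a b →
      IntervalIntegrable (P.opIntegrand α β w φ x) MeasureTheory.volume a x) ∧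
    -- the formula holds almost everywhere
    (∀ᵐ x, x ∈ Set.Ioo a b →
      IntervalIntegrable ((P.raise α β μ).opIntegrand α (β - μ) w φ x)
        MeasureTheory.volume a x ∧
      HasRLDeriv a μ (P.foxOp a α β w φ) x ∧
      rlDeriv a μ (P.foxOp a α β w φ) x = (P.raise α β μ).foxOp a α (β - μ) w φ x) ∧
    -- the formula holds at every point of continuity of `φ`
    (∀ x ∈ Set.Ioo a b, ContinuousAt φ x →
      IntervalIntegrable (P.opIntegrand α β w φ x) MeasureTheory.volume a x ∧
      IntervalIntegrable ((P.raise α β μ).opIntegrand α (β - μ) w φ x)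
        MeasureTheory.volume a x ∧
      HasRLDeriv a μ (P.foxOp a α β w φ) x ∧
      rlDeriv a μ (P.foxOp a α β w φ) x = (P.raise α β μ).foxOp a α (β - μ) w φ x) := by
  obtain ⟨c, hρ, hσ, hK⟩ := FoxParams.exists_rlPair hmq hα hw hP (sub_pos.2 hab) hH hβb hβμb
  have hρσ : β.re + α * c = (β - μ).re + α * c + μ.re := by
    rw [Complex.sub_re]
    ring
  simp only [FoxParams.opIntegrand_eq, FoxParams.foxOp_eq_volterra]
  have hg := integrableOn_volterra hK.isWeaklySingular_right hσ hφ
  refine ⟨ae_intervalIntegrable_volterra hK.isWeaklySingular_left hρ hφ, ?_,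
    fun x hx hc => ?_⟩
  · have hLeb := ((intervalIntegrable_iff_integrableOn_Ioo_of_le hab.le).2
      hg).ae_hasDerivAt_integral
    filter_upwards [ae_intervalIntegrable_volterra hK.isWeaklySingular_right hσ hφ, hLeb]
      with x hx1 hx2 hx
    rw [Set.uIcc_of_le hab.le] at hx2
    exact ⟨hx1 hx, hK.hasRLDeriv hρ hσ hρσ hφ hx
      (hx2 (Set.Ioo_subset_Icc_self hx) a (Set.left_mem_Icc.2 hab.le))⟩
  · have h := volterra_of_continuousAt hK.isWeaklySingular_right hσ hφ hx hc
    exact ⟨(volterra_of_continuousAt hK.isWeaklySingular_left hρ hφ hx hc).1, h.1,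
      hK.hasRLDeriv hρ hσ hρσ hφ hx (hasDerivAt_integral_of_continuousAt hg hx h.2)⟩
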